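/- **Setting.** Let $M$ be a smooth $n$-manifold (Hausdorff, $\sigma$-compact), $E=\bigoplus_i E_i\to M$ a $\mathbb Z$-graded vector bundle of finite rank (the grading is the ghost number $\mathrm{gh}$), and $\Lambda(J^\infty E)=\bigoplus\Lambda^{p,q}(J^\infty E)$ the graded commutative algebra of forms on its infinite jet bundle. The coefficients depend on finitely many jets, are smooth in the jet coordinates of ghost number $0$ and polynomial in the others, and signs are governed by the total degree $p+q+\mathrm{gh}$. Let $\delta$ and $d$ be the vertical and horizontal differentials ($\delta^2=d^2=\delta d+d\delta=0$). A vertical vector field $X$ is *evolutionary* if $i_Xd+(-1)^{\mathrm{gh}X}d\,i_X=0$; put $L_X=i_X\delta+(-1)^{\mathrm{gh}X}\delta i_X$ and $i_{[X,Y]}=[L_X,i_Y]$ (graded commutator). Write $\alpha\simeq\alpha'$ if $\alpha-\alpha'$ is $d$-exact. A *gauge system* $(Q,\omega)$ of degree $m$ consists of an evolutionary $Q$ with $\mathrm{gh}(Q)=1$, $[Q,Q]=0$, and a form $\omega\in\Lambda^{2,m}(J^\infty E)$, homogeneous in ghost number, with $\delta\omega\simeq0$ and $L_Q\omega\simeq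 0$. Its shell $\Sigma^\infty$ is the zero locus of $Q$: $\alpha|_{\Sigma^\infty}=0$ means that $\alpha$ lies in the ideal generated by the functions $Qf$ and the forms $\delta(Qf)$, where $f$ runs over the functions on $J^\infty E$ (for regular $(Q,\omega)$, these are exactly the forms whose pullback to the submanifold $\Sigma^\infty$ is zero). Write $\alpha\approx\alpha'$ if $\alpha|_{\Sigma^\infty}\simeq\alpha'|_{\Sigma^\infty}$. A symmetry (evolutionary $X$ with $[X,Q]=0$) is *on-shell Hamiltonian*, and $\alpha\in\Lambda^{0,m}(J^\infty E)$ with $\mathrm{gh}(\alpha)=\mathrm{gh}(X)+\mathrm{gh}(\omega)$ is an *on-shell Hamiltonian form* with symmetry $X$, if $i_X\omega\approx\delta\alpha$. Let $\mathrm{Sym}_\Sigma(Q,\omega)$ be the graded space of on-shell Hamiltonian symmetries, $\Lambda^H(Q,\omega)$ that of on-shell Hamiltonian forms modulo $\approx$ (graded by the ghost number of the symmetry), and $Z\subset\Lambda^H(Q,\omega)$ the subspace of classes of $\alpha$ with $\delta\alpha\approx0$ (it contains the classes of all on-shell Hamiltonian forms pulled back from $M$). A form is *flat* if it vanishes on the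 zero section $M\subset J^\infty E$; $\hat\alpha$ denotes the flat part of a purely horizontal form, i.e. $\alpha$ minus the pullback to $J^\infty E$ of the restriction of $\alpha$ to the zero section. A form $\alpha\in\Lambda^{0,m}(J^\infty E)$ is a *conservation law* if $d\alpha|_{\Sigma^\infty}=0$. **Proposition.** Let $(Q,\omega)$ be a regular gauge system of degree $m$ such that (i) $d\omega|_{\Sigma^\infty}=0$; (ii) $H^{0,*}_{\rm flat}(\Sigma^\infty;\delta)=0$, i.e. for every $q$ and every flat $\alpha\in\Lambda^{0,q}(J^\infty E)$, $\delta\alpha|_{\Sigma^\infty}=0$ implies $\alpha|_{\Sigma^\infty}=0$. Then the following hold. 1. For every on-shell Hamiltonian form $\alpha$, the flat part $\hat\alpha$ is on-shell Hamiltonian and is a flat conservation law. In particular every flat on-shell Hamiltonian form is a conservation law. 2. If $i_X\omega\approx\delta\alpha$ and $i_Y\omega\approx\delta\beta$ with $X,Y\in\mathrm{Sym}_\Sigma(Q,\omega)$, then $[X,Y]\in\mathrm{Sym}_\Sigma(Q,\omega)$ and $i_{[X,Y]}\omega\approx\delta\{\alpha,\beta\}$, where $\{\alpha,\beta\}=(-1)^{\mathrm{gh}X}i_Xi_Y\omega$.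 This bracket is well defined and bilinear on $\Lambda^H(Q,\omega)$ and makes it a graded Lie algebra: with $j,k,l$ the degrees of $\gamma,\alpha,\beta$, one has $\{\alpha,\beta\}=-(-1)^{kl}\{\beta,\alpha\}$ and $\{\gamma,\{\alpha,\beta\}\}=\{\{\gamma,\alpha\},\beta\}+(-1)^{jk}\{\alpha,\{\gamma,\beta\}\}$. The subspace $Z$ is central. 3. The relation $i_X\omega\approx\delta\alpha$ determines the class of $\alpha$ modulo $Z$ and gives a homomorphism of graded Lie algebras $h:\mathrm{Sym}_\Sigma(Q,\omega)\to\Lambda^H(Q,\omega)/Z$: one has $h(X)=[\alpha]$ if and only if $i_X\omega\approx\delta\alpha$, and $h([X,Y])=\{h(X),h(Y)\}$. Trivial symmetries $[Q,Y]$, with $Y$ evolutionary, belong to $\mathrm{Sym}_\Sigma(Q,\omega)$ and $h([Q,Y])=0$. -/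

import Mathlib

open scoped Manifold ContDiff

namespace JetForms

noncomputable section
theorem apply_eq_sum_single {N : ℕ} (T : (Fin N → ℝ) →L[ℝ] ℝ) (v : Fin N → ℝ) :
    T v = ∑ j, v j * T (Pi.single j 1) := by
  conv_lhs => rw [← Finset.univ_sum_single v, map_sum]
  refine Finset.sum_congr rfl fun j _ => ?_
  have : (Pi.single j (v j) : Fin N → ℝ) = v j • Pi.single j 1 := by
    rw [← Pi.single_smul]; simp
  rw [this, map_smul, smul_eq_mul]

/-- Hadamard's lemma: a smooth function is affine up to smooth coefficients. -/
theorem exists_hadamard_decomposition {N : ℕ} {F : (Fin N → ℝ) → ℝ} (hF : ContDiff ℝ ∞ F)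
    (y₀ : Fin N → ℝ) :
    ∃ G : Fin N → (Fin N → ℝ) → ℝ, (∀ j, ContDiff ℝ ∞ (G j)) ∧
      (∀ y, F y = F y₀ + ∑ j, (y j - y₀ j) * G j y) := by
  classical
  obtain ⟨χ, hχ⟩ : ∃ χ : ContDiffBump (0 : ℝ), χ.rIn = 2 := ⟨⟨2, 3, by norm_num, by norm_num⟩, rfl⟩
  let D : Fin N → (Fin N → ℝ) → ℝ := fun j y => fderiv ℝ F y (Pi.single j 1)
  have hD : ∀ j, ContDiff ℝ ∞ (D j) := fun j =>
    (hF.fderiv_right (m := ∞) (by simp)).clm_apply contDiff_const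
  let g : Fin N → (Fin N → ℝ) → ℝ → ℝ := fun j y s => χ s * D j (y₀ - s • (y - y₀))
  let f : ℝ → ℝ := Set.indicator (Set.Ioc 0 1) 1
  refine ⟨fun j y => (MeasureTheory.convolution f (g j y) (ContinuousLinearMap.mul ℝ ℝ)
    MeasureTheory.volume) 0, ?_, ?_⟩
  · intro j
    rw [← contDiffOn_univ]
    refine MeasureTheory.contDiffOn_convolution_right_with_param_comp (𝕜 := ℝ) (n := ⊤) (ContinuousLinearMap.mul ℝ ℝ)
      (v := fun _ => (0 : ℝ)) (s := Set.univ) (k := Metric.closedBall 0 χ.rOut)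
      contDiffOn_const isOpen_univ (isCompact_closedBall _ _) ?_ ?_ ?_
    · intro p x _ hx
      have : χ x = 0 := χ.zero_of_le_dist (by
        rw [Metric.mem_closedBall, not_le] at hx; exact hx.le)
      simp [g, this]
    · refine (MeasureTheory.IntegrableOn.integrable_indicator (f := (1 : ℝ → ℝ)) ?_ measurableSet_Ioc).locallyIntegrable
      exact MeasureTheory.integrableOn_const (by simp) (by simp)
    · apply ContDiff.contDiffOn
      refine (χ.contDiff.comp contDiff_snd).mul ((hD j).comp ?_)
      exact contDiff_const.sub (contDiff_snd.smul (contDiff_fst.sub contDiff_const))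
  · intro y
    have key : ∀ j, (MeasureTheory.convolution f (g j y) (ContinuousLinearMap.mul ℝ ℝ)
        MeasureTheory.volume) 0 = ∫ t in (0:ℝ)..1, D j (y₀ + t • (y - y₀)) := by
      intro j
      rw [intervalIntegral.integral_of_le zero_le_one, ← MeasureTheory.integral_indicator measurableSet_Ioc]
      unfold MeasureTheory.convolution
      congr 1
      ext t
      by_cases ht : t ∈ Set.Ioc (0:ℝ) 1
      · have : χ (-t) = 1 := χ.one_of_mem_closedBall (by
          rw [hχ, Metric.mem_closedBall, Real.dist_eq, sub_zero, abs_neg, abs_of_pos ht.1]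
          linarith [ht.2])
        simp [f, g, ht, this]
      · simp [f, ht]
    simp only [key]
    have hd : ∀ t : ℝ, HasDerivAt (fun t : ℝ => F (y₀ + t • (y - y₀)))
        (∑ j, (y j - y₀ j) * D j (y₀ + t • (y - y₀))) t := by
      intro t
      have h1 : HasDerivAt (fun t : ℝ => y₀ + t • (y - y₀)) (y - y₀) t := by
        simpa using ((hasDerivAt_id t).smul_const (y - y₀)).const_add y₀
      have h2 := ((hF.differentiable (by simp)) (y₀ + t • (y - y₀))).hasFDerivAt.comp_hasDerivAt t h1
      exact h2.congr_deriv (apply_eq_sum_single _ _)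
    have hc : ∀ j, Continuous fun t : ℝ => D j (y₀ + t • (y - y₀)) := fun j =>
      (hD j).continuous.comp (by fun_prop)
    have h3 := intervalIntegral.integral_eq_sub_of_hasDerivAt (a := 0) (b := 1) (fun t _ => hd t)
      ((continuous_finsetSum _ fun j _ => continuous_const.mul (hc j)).intervalIntegrable _ _)
    rw [intervalIntegral.integral_finsetSum (f := fun j t => (y j - y₀ j) * D j (y₀ + t • (y - y₀)))
      (fun j _ => (continuous_const.mul (hc j)).intervalIntegrable _ _)] at h3
    simp only [intervalIntegral.integral_const_mul] at h3
    simp at h3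
    linarith



/-- The partial derivative `∂F/∂y_j`. -/
def pd {N : ℕ} (j : Fin N) (F : (Fin N → ℝ) → ℝ) (y : Fin N → ℝ) : ℝ :=
  fderiv ℝ F y (Pi.single j 1)

theorem contDiff_pd {N : ℕ} (j : Fin N) {F : (Fin N → ℝ) → ℝ} (hF : ContDiff ℝ ∞ F) :
    ContDiff ℝ ∞ (pd j F) :=
  (hF.fderiv_right (m := ∞) (by simp)).clm_apply contDiff_const

theorem pd_comm {N : ℕ} (j k : Fin N) {F : (Fin N → ℝ) → ℝ} (hF : ContDiff ℝ ∞ F) :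
    pd j (pd k F) = pd k (pd j F) := by
  have h : ∀ a b : Fin N, ∀ y, pd a (pd b F) y
      = fderiv ℝ (fderiv ℝ F) y (Pi.single a 1) (Pi.single b 1) := by
    intro a b y
    have hd : DifferentiableAt ℝ (fderiv ℝ F) y :=
      (hF.fderiv_right (m := ∞) (by simp)).differentiable (by simp) y
    unfold pd
    rw [fderiv_clm_apply hd (differentiableAt_const _)]
    simp
  ext y
  rw [h, h]
  exact (hF.contDiffAt.isSymmSndFDerivAt (by simpa using WithTop.coe_le_coe.2 (le_top : (2 : ℕ∞) ≤ ⊤))).eq _ _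

/-- The algebra `C^∞(M)` of smooth functions on the manifold `M`. -/
abbrev SmoothFn (n : ℕ) (M : Type*) [TopologicalSpace M]
    [ChartedSpace (EuclideanSpace ℝ (Fin n)) M] : Type _ :=
  C^∞⟮𝓡 n, M; ℝ⟯

/-- Vector fields on `M`: the derivations of `C^∞(M)`. -/
abbrev VF (n : ℕ) (M : Type*) [TopologicalSpace M]
    [ChartedSpace (EuclideanSpace ℝ (Fin n)) M] : Type _ :=
  Derivation ℝ (SmoothFn n M) (SmoothFn n M)

section
variable {n : ℕ} {M : Type*} [TopologicalSpace M] [ChartedSpace (EuclideanSpace ℝ (Fin n)) M]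

/-- The smooth function `F(a₁, …, a_N)` on `M`. -/
def smoothComp {N : ℕ} (F : (Fin N → ℝ) → ℝ) (hF : ContDiff ℝ ∞ F) (a : Fin N → SmoothFn n M) :
    SmoothFn n M :=
  ⟨fun x => F fun j => a j x,
    hF.contMDiff.comp (contMDiff_pi_space.2 fun j => (a j).contMDiff)⟩

/-- Chain rule: derivations of `C^∞(M)` are vector fields. -/
theorem derivation_smoothComp (ξ : VF n M) {N : ℕ} {F : (Fin N → ℝ) → ℝ} (hF : ContDiff ℝ ∞ F)
    (a : Fin N → SmoothFn n M) :
    ξ (smoothComp F hF a) = ∑ j, smoothComp (pd j F) (contDiff_pd j hF) a * ξ (a j) := by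
  ext x
  obtain ⟨G, hG, hFG⟩ := exists_hadamard_decomposition hF (fun j => a j x)
  have h1 : smoothComp F hF a = algebraMap ℝ (SmoothFn n M) (F fun j => a j x)
      + ∑ j, (a j - algebraMap ℝ (SmoothFn n M) (a j x)) * smoothComp (G j) (hG j) a := by
    ext z
    have h := hFG (fun j => a j z)
    have hs := map_sum (ContMDiffMap.evalRingHom (n := ∞) (I := 𝓡 n) (I' := 𝓘(ℝ, ℝ)) z)
      (fun j => (a j - algebraMap ℝ (SmoothFn n M) (a j x)) * smoothComp (G j) (hG j) a)
      Finset.univ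
    exact h.trans (congrArg (fun t => F (fun j => a j x) + t) hs.symm)
  have h2 : ∀ j, pd j F (fun j => a j x) = G j (fun j => a j x) := by
    intro j
    have hd : HasFDerivAt F (∑ k, (G k (fun j => a j x)) •
        (ContinuousLinearMap.proj k : (Fin N → ℝ) →L[ℝ] ℝ)) (fun j => a j x) := by
      have : F = fun y => F (fun j => a j x) + ∑ k, (y k - a k x) * G k y := funext hFG
      rw [this]
      refine (HasFDerivAt.fun_sum fun k _ => ?_).const_add _
      have h3 : HasFDerivAt (fun y : Fin N → ℝ => y k - a k x)
          (ContinuousLinearMap.proj k : (Fin N → ℝ) →L[ℝ] ℝ) (fun j => a j x) :=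
        (ContinuousLinearMap.proj (R := ℝ) (φ := fun _ : Fin N => ℝ) k).hasFDerivAt.sub_const _
      exact (h3.mul (((hG k).differentiable (by simp)) _).hasFDerivAt).congr_fderiv (by simp)
    rw [pd, hd.fderiv]
    simp [Pi.single_apply]
  rw [h1, map_add, Derivation.map_algebraMap, zero_add, map_sum]
  have ev := fun f : Fin N → SmoothFn n M =>
    map_sum (ContMDiffMap.evalRingHom (n := ∞) (I := 𝓡 n) (I' := 𝓘(ℝ, ℝ)) x) f Finset.univ
  refine (ev _).trans (Eq.trans (Finset.sum_congr rfl fun j _ => ?_) (ev _).symm)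
  rw [Derivation.leibniz, map_sub, Derivation.map_algebraMap, sub_zero]
  change (a j x - a j x) * _ + G j (fun j => a j x) * ξ (a j) x
    = pd j F (fun j => a j x) * ξ (a j) x
  rw [h2]; ring
end


section Jets
variable (n : ℕ) (M : Type*) [TopologicalSpace M] [ChartedSpace (EuclideanSpace ℝ (Fin n)) M]

/-- `IsDiffOp n M k D`: the map `D` from a `C^∞(M)`-module to `C^∞(M)` is a differential operator of
order at most `k`, i.e. all its `(k+1)`-fold commutators with multiplication operators vanish. For
`S = Γ(E)` these are the differential operators in the usual sense. -/
def IsDiffOp {S : Type*} [AddCommGroup S] [Module (SmoothFn n M) S] :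
    ℕ → (S → SmoothFn n M) → Prop
  | 0, D => ∀ (a : SmoothFn n M) (s : S), D (a • s) = a * D s
  | k + 1, D => ∀ a : SmoothFn n M, IsDiffOp k fun s => D (a • s) - a * D s

variable {n M} in
theorem IsDiffOp.succ {S : Type*} [AddCommGroup S] [Module (SmoothFn n M) S] (k : ℕ) :
    ∀ {D : S → SmoothFn n M}, IsDiffOp n M k D → IsDiffOp n M (k + 1) D := by
  induction k with
  | zero =>
    intro D h a b s
    have h' : ∀ (a : SmoothFn n M) (s : S), D (a • s) = a * D s := h
    simp [h']
  | succ k ih => exact fun h a => ih (h a)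

variable {n M} in
theorem IsDiffOp.mono {S : Type*} [AddCommGroup S] [Module (SmoothFn n M) S] {k l : ℕ}
    (hkl : k ≤ l) {D : S → SmoothFn n M} (h : IsDiffOp n M k D) : IsDiffOp n M l D := by
  induction hkl with
  | refl => exact h
  | step _ ih => exact ih.succ

variable {n M} in
theorem IsDiffOp.add {S : Type*} [AddCommGroup S] [Module (SmoothFn n M) S] (k : ℕ) :
    ∀ {D D' : S → SmoothFn n M}, IsDiffOp n M k D → IsDiffOp n M k D' →
      IsDiffOp n M k fun s => D s + D' s := by
  induction k with
  | zero =>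
    intro D D' h h' a s
    have h1 : D (a • s) = a * D s := h a s
    have h2 : D' (a • s) = a * D' s := h' a s
    simp only [h1, h2, mul_add]
  | succ k ih =>
    intro D D' h h' a
    convert ih (h a) (h' a) using 2 with s
    ring

variable {n M} in
theorem IsDiffOp.smul {S : Type*} [AddCommGroup S] [Module (SmoothFn n M) S] (k : ℕ)
    (b : SmoothFn n M) :
    ∀ {D : S → SmoothFn n M}, IsDiffOp n M k D → IsDiffOp n M k fun s => b * D s := by
  induction k with
  | zero =>
    intro D h a s
    have h1 : D (a • s) = a * D s := h a s
    simp only [h1]; ring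
  | succ k ih =>
    intro D h a
    convert ih (h a) using 2 with s
    ring

variable {n M} in
theorem IsDiffOp.derivation {S : Type*} [AddCommGroup S] [Module (SmoothFn n M) S] (k : ℕ)
    (ξ : VF n M) :
    ∀ {D : S → SmoothFn n M}, IsDiffOp n M k D → IsDiffOp n M (k + 1) fun s => ξ (D s) := by
  induction k with
  | zero =>
    intro D h a b s
    have h1 : ∀ (a : SmoothFn n M) (s : S), D (a • s) = a * D s := h
    simp only [h1, Derivation.leibniz, smul_eq_mul]; ring
  | succ k ih =>
    intro D h a
    convert (ih (h a)).add _ ((h.smul (k + 1) (ξ a))) using 2 with s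
    simp only [map_sub, Derivation.leibniz, smul_eq_mul]; ring

/-- The `C^∞(M)`-module of linear differential operators `S → C^∞(M)` (of any finite order). For
`S = Γ(E)` these are precisely the functions on the infinite jet bundle `J^∞E` that are linear along
the fibres. -/
def DiffOp (S : Type*) [AddCommGroup S] [Module ℝ S] [Module (SmoothFn n M) S] :
    Submodule (SmoothFn n M) (S →ₗ[ℝ] SmoothFn n M) where
  carrier := {D | ∃ k, IsDiffOp n M k D}
  add_mem' := by
    rintro D D' ⟨k, h⟩ ⟨l, h'⟩
    exact ⟨max k l, (h.mono (le_max_left _ _)).add _ (h'.mono (le_max_right _ _))⟩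
  zero_mem' := ⟨0, fun a s => by simp⟩
  smul_mem' := fun b D ⟨k, h⟩ => ⟨k, h.smul k b⟩

variable {n M} in
/-- The composition `ξ ∘ D`. -/
def DiffOp.derive {S : Type*} [AddCommGroup S] [Module ℝ S] [Module (SmoothFn n M) S]
    (ξ : VF n M) (D : DiffOp n M S) : DiffOp n M S :=
  ⟨(ξ : SmoothFn n M →ₗ[ℝ] SmoothFn n M) ∘ₗ D.1, by
    obtain ⟨k, h⟩ := D.2
    exact ⟨k + 1, h.derivation k ξ⟩⟩

variable {ι : Type*} (P : ι → Type*) [∀ i, AddCommGroup (P i)] [∀ i, Module ℝ (P i)]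
  [∀ i, Module (SmoothFn n M) (P i)] (gh : ι → ℤ)

/-- Smooth functions on the infinite jet bundle of the ghost number zero part `E₀` of the bundle `E`.
Here `P i` is the module of sections of the component `E i` of `E`, which has ghost number `gh i`.
A function `f` of finitely many jet coordinates is identified with the local functional that it
defines: a field configuration `φ` goes to the function `x ↦ f (j^∞_x φ)` on `M`. Those are exactly the
smooth functions of finitely many functions on `M` and finitely many linear differential operators
applied to `φ`: each `J^k E₀` embeds, via finitely many functions on `M` and finitely many fibrewise
linear functions, as a closed submanifold of some `ℝ^N`. -/
inductive IsLocalFn : ((∀ i : {i : ι // gh i = 0}, P i) → SmoothFn n M) → Prop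
  | base (a : SmoothFn n M) : IsLocalFn fun _ => a
  | lin (i : {i : ι // gh i = 0}) (D : DiffOp n M (P i)) : IsLocalFn fun φ => D.1 (φ i)
  | comp {N : ℕ} (F : (Fin N → ℝ) → ℝ) (hF : ContDiff ℝ ∞ F)
      (f : Fin N → (∀ i : {i : ι // gh i = 0}, P i) → SmoothFn n M) (hf : ∀ j, IsLocalFn (f j)) :
      IsLocalFn fun φ => smoothComp F hF fun j => f j φ

theorem IsLocalFn.add {f g : (∀ i : {i : ι // gh i = 0}, P i) → SmoothFn n M}
    (hf : IsLocalFn n M P gh f) (hg : IsLocalFn n M P gh g) : IsLocalFn n M P gh (f + g) :=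
  IsLocalFn.comp (fun y : Fin 2 → ℝ => y 0 + y 1) (by fun_prop) ![f, g]
    (by intro j; fin_cases j <;> assumption)

theorem IsLocalFn.mul {f g : (∀ i : {i : ι // gh i = 0}, P i) → SmoothFn n M}
    (hf : IsLocalFn n M P gh f) (hg : IsLocalFn n M P gh g) : IsLocalFn n M P gh (f * g) :=
  IsLocalFn.comp (fun y : Fin 2 → ℝ => y 0 * y 1) (by fun_prop) ![f, g]
    (by intro j; fin_cases j <;> assumption)

/-- The algebra `C^∞(J^∞E₀)` of smooth functions on the jet bundle of the ghost number zero fields. -/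
def LocalFn : Subalgebra ℝ ((∀ i : {i : ι // gh i = 0}, P i) → SmoothFn n M) where
  carrier := {f | IsLocalFn n M P gh f}
  add_mem' := IsLocalFn.add n M P gh
  mul_mem' := IsLocalFn.mul n M P gh
  algebraMap_mem' r := IsLocalFn.base (algebraMap ℝ (SmoothFn n M) r)

namespace LocalFn
variable {n M P gh}

/-- The pullback to the jet bundle of a function on `M`. -/
def base (a : SmoothFn n M) : LocalFn n M P gh := ⟨fun _ => a, IsLocalFn.base a⟩

/-- The smooth function `F(f₁, …, f_N)` on the jet bundle. -/
def comp {N : ℕ} (F : (Fin N → ℝ) → ℝ) (hF : ContDiff ℝ ∞ F) (f : Fin N → LocalFn n M P gh) :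
    LocalFn n M P gh :=
  ⟨fun φ => smoothComp F hF fun j => (f j).1 φ, IsLocalFn.comp F hF _ fun j => (f j).2⟩

theorem derive_mem (ξ : VF n M) {f : (∀ i : {i : ι // gh i = 0}, P i) → SmoothFn n M}
    (hf : IsLocalFn n M P gh f) : IsLocalFn n M P gh fun φ => ξ (f φ) := by
  induction hf with
  | base a => exact IsLocalFn.base (ξ a)
  | lin i D => exact IsLocalFn.lin i (DiffOp.derive ξ D)
  | @comp N F hF f hf ih =>
    have : (fun φ => ξ (smoothComp F hF fun j => f j φ))
        = ∑ j, (fun φ => smoothComp (pd j F) (contDiff_pd j hF) fun j => f j φ) *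
          (fun φ => ξ (f j φ)) := by
      funext φ
      rw [derivation_smoothComp, Finset.sum_apply]
      rfl
    rw [this]
    exact (LocalFn n M P gh).sum_mem fun j _ => (LocalFn n M P gh).mul_mem
      (IsLocalFn.comp (pd j F) (contDiff_pd j hF) f hf) (ih j)

/-- The total derivative along a vector field `ξ` on `M`. -/
def derive (ξ : VF n M) (f : LocalFn n M P gh) : LocalFn n M P gh :=
  ⟨fun φ => ξ (f.1 φ), derive_mem ξ f.2⟩

end LocalFn


/-- Generators of the algebra `Λ^{*,0}(J^∞E)` of vertical forms on the infinite jet bundle of the graded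
bundle `E`: `fn f` is a function `f` of the ghost number zero jets, `dfn f` its vertical differential
`δf`; `fld i D` is the fibrewise linear function on jets given by a differential operator `D` on the
component `E i` of ghost number `gh i ≠ 0` (locally a combination of the coordinates `φ^a_I`), and
`dfld i D` its vertical differential (a combination of the `δφ^a_I`). -/
inductive Gen
  | fn (f : LocalFn n M P gh)
  | dfn (f : LocalFn n M P gh)
  | fld (i : {i : ι // gh i ≠ 0}) (D : DiffOp n M (P i))
  | dfld (i : {i : ι // gh i ≠ 0}) (D : DiffOp n M (P i))

namespace Gen
variable {n M P gh}

/-- The vertical degree. -/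
def vdeg : Gen n M P gh → ℕ
  | fn _ => 0
  | dfn _ => 1
  | fld _ _ => 0
  | dfld _ _ => 1

/-- The ghost number. -/
def ghost : Gen n M P gh → ℤ
  | fn _ => 0
  | dfn _ => 0
  | fld i _ => gh i
  | dfld i _ => gh i

/-- The total degree (vertical degree plus ghost number), which governs the signs. -/
def deg (x : Gen n M P gh) : ℤ := x.vdeg + x.ghost

end Gen

variable {n M P gh} in
/-- The relations between the generators: functions of the ghost number zero jets form an algebra, the
other generators are `C^∞(M)`-linear in the operator, `δ` satisfies the chain rule and kills functions
on `M`, and everything is graded commutative. -/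
structure IsFormAssignment {B : Type*} [Ring B] [Algebra ℝ B] (u : Gen n M P gh → B) : Prop where
  fn_add : ∀ f g, u (.fn (f + g)) = u (.fn f) + u (.fn g)
  fn_mul : ∀ f g, u (.fn (f * g)) = u (.fn f) * u (.fn g)
  fn_const : ∀ r : ℝ, u (.fn (algebraMap ℝ _ r)) = algebraMap ℝ B r
  fld_add : ∀ i D E, u (.fld i (D + E)) = u (.fld i D) + u (.fld i E)
  fld_smul : ∀ i (a : SmoothFn n M) D, u (.fld i (a • D)) = u (.fn (LocalFn.base a)) * u (.fld i D)
  dfld_add : ∀ i D E, u (.dfld i (D + E)) = u (.dfld i D) + u (.dfld i E)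
  dfld_smul : ∀ i (a : SmoothFn n M) D, u (.dfld i (a • D)) = u (.fn (LocalFn.base a)) * u (.dfld i D)
  dfn_base : ∀ a : SmoothFn n M, u (.dfn (LocalFn.base a)) = 0
  dfn_comp : ∀ (N : ℕ) (F : (Fin N → ℝ) → ℝ) (hF : ContDiff ℝ ∞ F) (f : Fin N → LocalFn n M P gh),
    u (.dfn (LocalFn.comp F hF f)) = ∑ j, u (.fn (LocalFn.comp (pd j F) (contDiff_pd j hF) f)) * u (.dfn (f j))
  comm : ∀ x y, u x * u y = (-1 : ℝ) ^ (x.deg * y.deg) • (u y * u x)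

/-- The same relations in the free algebra. -/
inductive FormRel : FreeAlgebra ℝ (Gen n M P gh) → FreeAlgebra ℝ (Gen n M P gh) → Prop
  | fn_add (f g : LocalFn n M P gh) :
      FormRel (FreeAlgebra.ι ℝ (.fn (f + g))) (FreeAlgebra.ι ℝ (.fn f) + FreeAlgebra.ι ℝ (.fn g))
  | fn_mul (f g : LocalFn n M P gh) :
      FormRel (FreeAlgebra.ι ℝ (.fn (f * g))) (FreeAlgebra.ι ℝ (.fn f) * FreeAlgebra.ι ℝ (.fn g))
  | fn_const (r : ℝ) : FormRel (FreeAlgebra.ι ℝ (.fn (algebraMap ℝ _ r))) (algebraMap ℝ _ r)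
  | fld_add (i : {i : ι // gh i ≠ 0}) (D E : DiffOp n M (P i)) :
      FormRel (FreeAlgebra.ι ℝ (.fld i (D + E))) (FreeAlgebra.ι ℝ (.fld i D) + FreeAlgebra.ι ℝ (.fld i E))
  | fld_smul (i : {i : ι // gh i ≠ 0}) (a : SmoothFn n M) (D : DiffOp n M (P i)) :
      FormRel (FreeAlgebra.ι ℝ (.fld i (a • D))) (FreeAlgebra.ι ℝ (.fn (LocalFn.base a)) * FreeAlgebra.ι ℝ (.fld i D))
  | dfld_add (i : {i : ι // gh i ≠ 0}) (D E : DiffOp n M (P i)) :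
      FormRel (FreeAlgebra.ι ℝ (.dfld i (D + E))) (FreeAlgebra.ι ℝ (.dfld i D) + FreeAlgebra.ι ℝ (.dfld i E))
  | dfld_smul (i : {i : ι // gh i ≠ 0}) (a : SmoothFn n M) (D : DiffOp n M (P i)) :
      FormRel (FreeAlgebra.ι ℝ (.dfld i (a • D))) (FreeAlgebra.ι ℝ (.fn (LocalFn.base a)) * FreeAlgebra.ι ℝ (.dfld i D))
  | dfn_base (a : SmoothFn n M) : FormRel (FreeAlgebra.ι ℝ (.dfn (LocalFn.base a))) 0
  | dfn_comp {N : ℕ} (F : (Fin N → ℝ) → ℝ) (hF : ContDiff ℝ ∞ F) (f : Fin N → LocalFn n M P gh) :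
      FormRel (FreeAlgebra.ι ℝ (.dfn (LocalFn.comp F hF f)))
        (∑ j, FreeAlgebra.ι ℝ (.fn (LocalFn.comp (pd j F) (contDiff_pd j hF) f)) * FreeAlgebra.ι ℝ (.dfn (f j)))
  | comm (x y : Gen n M P gh) :
      FormRel (FreeAlgebra.ι ℝ x * FreeAlgebra.ι ℝ y) ((-1 : ℝ) ^ (x.deg * y.deg) • (FreeAlgebra.ι ℝ y * FreeAlgebra.ι ℝ x))

/-- The algebra `Λ^{*,0}(J^∞E)` of vertical forms on `J^∞E`: forms on the graded manifold `J^∞E` without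
horizontal differentials. It is the free graded commutative algebra over `C^∞(J^∞E₀)` on the `φ^a_I` of
nonzero ghost number and all `δφ^a_I`; coefficients are thus smooth in the jets of ghost number zero
and polynomial in those of nonzero ghost number. -/
def VForm := RingQuot (FormRel n M P gh)

instance : Ring (VForm n M P gh) := inferInstanceAs (Ring (RingQuot (FormRel n M P gh)))
instance : Algebra ℝ (VForm n M P gh) :=
  inferInstanceAs (Algebra ℝ (RingQuot (FormRel n M P gh)))

namespace VForm
variable {n M P gh}

/-- The class of a generator. -/
def gen (x : Gen n M P gh) : VForm n M P gh :=
  RingQuot.mkAlgHom ℝ (FormRel n M P gh) (FreeAlgebra.ι ℝ x)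

theorem isFormAssignment_gen : IsFormAssignment (gen : Gen n M P gh → VForm n M P gh) where
  fn_add f g := (RingQuot.mkAlgHom_rel ℝ (.fn_add f g)).trans (map_add _ _ _)
  fn_mul f g := (RingQuot.mkAlgHom_rel ℝ (.fn_mul f g)).trans (map_mul _ _ _)
  fn_const r := (RingQuot.mkAlgHom_rel ℝ (.fn_const r)).trans (AlgHom.commutes _ _)
  fld_add i D E := (RingQuot.mkAlgHom_rel ℝ (.fld_add i D E)).trans (map_add _ _ _)
  fld_smul i a D := (RingQuot.mkAlgHom_rel ℝ (.fld_smul i a D)).trans (map_mul _ _ _)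
  dfld_add i D E := (RingQuot.mkAlgHom_rel ℝ (.dfld_add i D E)).trans (map_add _ _ _)
  dfld_smul i a D := (RingQuot.mkAlgHom_rel ℝ (.dfld_smul i a D)).trans (map_mul _ _ _)
  dfn_base a := (RingQuot.mkAlgHom_rel ℝ (.dfn_base a)).trans (map_zero _)
  dfn_comp N F hF f := by
    refine (RingQuot.mkAlgHom_rel ℝ (.dfn_comp F hF f)).trans ((map_sum _ _ _).trans ?_)
    exact Finset.sum_congr rfl fun j _ => map_mul _ _ _
  comm x y := by
    refine ((map_mul _ _ _).symm.trans (RingQuot.mkAlgHom_rel ℝ (.comm x y))).trans ?_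
    exact (map_smul _ _ _).trans (congrArg _ (map_mul _ _ _))

/-- The universal property. -/
def lift {B : Type*} [Ring B] [Algebra ℝ B] (u : Gen n M P gh → B) (hu : IsFormAssignment u) :
    VForm n M P gh →ₐ[ℝ] B :=
  RingQuot.liftAlgHom ℝ ⟨FreeAlgebra.lift ℝ u, by
    intro x y h
    induction h with
    | fn_add f g => simpa using hu.fn_add f g
    | fn_mul f g => simpa using hu.fn_mul f g
    | fn_const r => simpa using hu.fn_const r
    | fld_add i D E => simpa using hu.fld_add i D E
    | fld_smul i a D => simpa using hu.fld_smul i a D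
    | dfld_add i D E => simpa using hu.dfld_add i D E
    | dfld_smul i a D => simpa using hu.dfld_smul i a D
    | dfn_base a => simpa using hu.dfn_base a
    | dfn_comp F hF f => simpa using hu.dfn_comp _ F hF f
    | comm x y => simpa using hu.comm x y⟩

@[simp] theorem lift_gen {B : Type*} [Ring B] [Algebra ℝ B] (u : Gen n M P gh → B)
    (hu : IsFormAssignment u) (x : Gen n M P gh) : lift u hu (gen x) = u x := by
  unfold lift gen
  exact (RingQuot.liftAlgHom_mkAlgHom_apply ℝ _ _ _).trans (FreeAlgebra.lift_ι_apply _ _)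

/-- Restriction to the zero section, on generators. -/
def zeroSectionGen : Gen n M P gh → SmoothFn n M
  | .fn f => f.1 0
  | .dfn _ => 0
  | .fld _ _ => 0
  | .dfld _ _ => 0

theorem isFormAssignment_zeroSection :
    IsFormAssignment (zeroSectionGen : Gen n M P gh → SmoothFn n M) where
  fn_add f g := rfl
  fn_mul f g := rfl
  fn_const r := rfl
  fld_add i D E := (add_zero _).symm
  fld_smul i a D := (mul_zero _).symm
  dfld_add i D E := (add_zero _).symm
  dfld_smul i a D := (mul_zero _).symm
  dfn_base a := rfl
  dfn_comp N F hF f := by simp [zeroSectionGen]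
  comm x y := by
    cases x <;> cases y <;> simp [zeroSectionGen, Gen.deg, Gen.vdeg, Gen.ghost, mul_comm]

/-- Pullback along the zero section `M → J^∞E`. -/
def zeroSection : VForm n M P gh →ₐ[ℝ] SmoothFn n M := lift _ isFormAssignment_zeroSection

/-- The pullback to `J^∞E` of a function on `M`. -/
def baseFn (a : SmoothFn n M) : VForm n M P gh := gen (.fn (LocalFn.base a))


theorem fn_one : (gen (.fn 1) : VForm n M P gh) = 1 := by
  simpa using isFormAssignment_gen.fn_const (P := P) (gh := gh) (n := n) (M := M) 1

theorem fn_sum {N : ℕ} (f : Fin N → LocalFn n M P gh) :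
    (gen (.fn (∑ j, f j)) : VForm n M P gh) = ∑ j, gen (.fn (f j)) :=
  map_sum (AddMonoidHom.mk' (fun f : LocalFn n M P gh => gen (.fn f))
    isFormAssignment_gen.fn_add) _ _

theorem dfn_add (f g : LocalFn n M P gh) :
    (gen (.dfn (f + g)) : VForm n M P gh) = gen (.dfn f) + gen (.dfn g) := by
  have h := isFormAssignment_gen.dfn_comp 2 (fun y : Fin 2 → ℝ => y 0 + y 1) (by fun_prop) ![f, g]
  have hp : ∀ j : Fin 2, pd j (fun y : Fin 2 → ℝ => y 0 + y 1) = fun _ => 1 := by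
    intro j; ext y
    rw [pd, fderiv_fun_add (by fun_prop) (by fun_prop)]
    have h0 : ∀ i : Fin 2, HasFDerivAt (fun y : Fin 2 → ℝ => y i)
      (ContinuousLinearMap.proj i : (Fin 2 → ℝ) →L[ℝ] ℝ) y := fun i => hasFDerivAt_apply i y
    rw [(h0 0).fderiv, (h0 1).fderiv]
    fin_cases j <;> simp
  have h1 : ∀ j : Fin 2, LocalFn.comp (pd j (fun y : Fin 2 → ℝ => y 0 + y 1))
      (contDiff_pd j (by fun_prop)) ![f, g] = 1 := by
    intro j; ext φ x
    exact congrFun (hp j) _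
  simp only [h1, fn_one, one_mul, Fin.sum_univ_two] at h
  exact h

theorem dfn_mul (f g : LocalFn n M P gh) : (gen (.dfn (f * g)) : VForm n M P gh)
    = gen (.fn f) * gen (.dfn g) + gen (.fn g) * gen (.dfn f) := by
  have h := isFormAssignment_gen.dfn_comp 2 (fun y : Fin 2 → ℝ => y 0 * y 1) (by fun_prop) ![f, g]
  have hp : ∀ j : Fin 2, pd j (fun y : Fin 2 → ℝ => y 0 * y 1) = fun y => y (1 - j) := by
    intro j; ext y
    rw [pd, fderiv_fun_mul (by fun_prop) (by fun_prop)]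
    have h0 : ∀ i : Fin 2, HasFDerivAt (fun y : Fin 2 → ℝ => y i)
      (ContinuousLinearMap.proj i : (Fin 2 → ℝ) →L[ℝ] ℝ) y := fun i => hasFDerivAt_apply i y
    rw [(h0 0).fderiv, (h0 1).fderiv]
    fin_cases j <;> simp
  have h1 : ∀ j : Fin 2, LocalFn.comp (pd j (fun y : Fin 2 → ℝ => y 0 * y 1))
      (contDiff_pd j (by fun_prop)) ![f, g] = (![f, g] : Fin 2 → LocalFn n M P gh) (1 - j) := by
    intro j; ext φ x
    exact congrFun (hp j) _
  simp only [h1, Fin.sum_univ_two] at h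
  refine Eq.trans h ?_
  simp [add_comm]

theorem dfn_sum {N : ℕ} (f : Fin N → LocalFn n M P gh) :
    (gen (.dfn (∑ j, f j)) : VForm n M P gh) = ∑ j, gen (.dfn (f j)) :=
  map_sum (AddMonoidHom.mk' (fun f : LocalFn n M P gh => gen (.dfn f)) dfn_add) _ _

/-- The conditions under which `D` extends from the generators to a derivation of parity `e`. -/
structure IsDerivationData (e : ℤ) (D : Gen n M P gh → VForm n M P gh) : Prop where
  fn_add : ∀ f g, D (.fn (f + g)) = D (.fn f) + D (.fn g)
  fn_mul : ∀ f g, D (.fn (f * g)) = gen (.fn f) * D (.fn g) + D (.fn f) * gen (.fn g)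
  fn_const : ∀ r : ℝ, D (.fn (algebraMap ℝ _ r)) = 0
  fld_add : ∀ i A B, D (.fld i (A + B)) = D (.fld i A) + D (.fld i B)
  fld_smul : ∀ i (a : SmoothFn n M) A, D (.fld i (a • A))
    = gen (.fn (LocalFn.base a)) * D (.fld i A) + D (.fn (LocalFn.base a)) * gen (.fld i A)
  dfld_add : ∀ i A B, D (.dfld i (A + B)) = D (.dfld i A) + D (.dfld i B)
  dfld_smul : ∀ i (a : SmoothFn n M) A, D (.dfld i (a • A))
    = gen (.fn (LocalFn.base a)) * D (.dfld i A) + D (.fn (LocalFn.base a)) * gen (.dfld i A)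
  dfn_base : ∀ a : SmoothFn n M, D (.dfn (LocalFn.base a)) = 0
  dfn_comp : ∀ (N : ℕ) (F : (Fin N → ℝ) → ℝ) (hF : ContDiff ℝ ∞ F) (f : Fin N → LocalFn n M P gh),
    D (.dfn (LocalFn.comp F hF f)) = ∑ j,
      (gen (.fn (LocalFn.comp (pd j F) (contDiff_pd j hF) f)) * D (.dfn (f j))
        + D (.fn (LocalFn.comp (pd j F) (contDiff_pd j hF) f)) * gen (.dfn (f j)))
  comm : ∀ x y, gen x * D y = (-1 : ℝ) ^ (x.deg * (y.deg + e)) • (D y * gen x)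

/-- Derivations of parity `e` as homomorphisms to triangular matrices. -/
def triangular (e : ℤ) (D : Gen n M P gh → VForm n M P gh) (x : Gen n M P gh) :
    Matrix (Fin 2) (Fin 2) (VForm n M P gh) :=
  !![(-1 : ℝ) ^ (e * x.deg) • gen x, D x; 0, gen x]

theorem neg_one_zpow_mul_self (k : ℤ) : (-1 : ℝ) ^ k * (-1 : ℝ) ^ k = 1 := by
  rw [← mul_zpow]; simp

theorem IsDerivationData.isFormAssignment {e : ℤ} {D : Gen n M P gh → VForm n M P gh}
    (hD : IsDerivationData e D) : IsFormAssignment (triangular e D) where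
  fn_add f g := by
    simp [triangular, Gen.deg, Gen.vdeg, Gen.ghost, hD.fn_add, isFormAssignment_gen.fn_add]
  fn_mul f g := by
    simp [triangular, Gen.deg, Gen.vdeg, Gen.ghost, hD.fn_mul, isFormAssignment_gen.fn_mul]
  fn_const r := by
    simp [triangular, Gen.deg, Gen.vdeg, Gen.ghost, hD.fn_const, isFormAssignment_gen.fn_const,
      Matrix.algebraMap_eq_diagonal]
    ext i j; fin_cases i <;> fin_cases j <;> simp
  fld_add i A B := by
    simp [triangular, Gen.deg, Gen.vdeg, Gen.ghost, hD.fld_add, isFormAssignment_gen.fld_add]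
  fld_smul i a A := by
    simp [triangular, Gen.deg, Gen.vdeg, Gen.ghost, hD.fld_smul, isFormAssignment_gen.fld_smul]
  dfld_add i A B := by
    simp [triangular, Gen.deg, Gen.vdeg, Gen.ghost, hD.dfld_add, isFormAssignment_gen.dfld_add]
  dfld_smul i a A := by
    simp [triangular, Gen.deg, Gen.vdeg, Gen.ghost, hD.dfld_smul, isFormAssignment_gen.dfld_smul]
  dfn_base a := by
    ext i j
    fin_cases i <;> fin_cases j <;> simp [triangular, hD.dfn_base, isFormAssignment_gen.dfn_base]
  dfn_comp N F hF f := by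
    ext i j
    fin_cases i <;> fin_cases j <;>
      simp [triangular, hD.dfn_comp, isFormAssignment_gen.dfn_comp, Matrix.sum_apply,
        Finset.smul_sum, Gen.deg, Gen.vdeg, Gen.ghost]
  comm x y := by
    have h1 := isFormAssignment_gen.comm (n := n) (M := M) (P := P) (gh := gh) x y
    have h2 := hD.comm x y
    have h3 := hD.comm y x
    have h4 : D x * gen y = (-1 : ℝ) ^ (y.deg * (x.deg + e)) • (gen y * D x) := by
      rw [h3, smul_smul, neg_one_zpow_mul_self, one_smul]
    have h5 : (-1 : ℝ) ^ (e * x.deg) * (-1 : ℝ) ^ (x.deg * (y.deg + e))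
        = (-1 : ℝ) ^ (x.deg * y.deg) := by
      rw [mul_add, zpow_add₀ (by norm_num), mul_comm e, mul_left_comm, neg_one_zpow_mul_self,
        mul_one]
    have h6 : (-1 : ℝ) ^ (y.deg * (x.deg + e))
        = (-1 : ℝ) ^ (x.deg * y.deg) * (-1 : ℝ) ^ (e * y.deg) := by
      rw [← zpow_add₀ (by norm_num)]; congr 1; ring
    ext i j
    fin_cases i <;> fin_cases j
    · simp [triangular, h1, smul_smul]; congr 1; ring
    · simp [triangular, h2, h4, smul_smul, h5, h6]
      exact add_comm _ _
    · simp [triangular]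
    · simp [triangular, h1]

/-- The derivation of parity `e` with prescribed values on generators:
`D (v w) = D v * w + (-1)^{e |v|} v * D w`. -/
def derivation (e : ℤ) (D : Gen n M P gh → VForm n M P gh) (hD : IsDerivationData e D) :
    VForm n M P gh →ₗ[ℝ] VForm n M P gh :=
  (Matrix.entryLinearMap ℝ (VForm n M P gh) (0 : Fin 2) (1 : Fin 2)) ∘ₗ
    (lift (triangular e D) hD.isFormAssignment).toLinearMap

theorem derivation_gen (e : ℤ) (D : Gen n M P gh → VForm n M P gh) (hD : IsDerivationData e D)
    (x : Gen n M P gh) : derivation e D hD (gen x) = D x := by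
  simp [derivation, triangular]

/-- The vertical differential on generators. -/
def deltaGen : Gen n M P gh → VForm n M P gh
  | .fn f => gen (.dfn f)
  | .dfn _ => 0
  | .fld i D => gen (.dfld i D)
  | .dfld _ _ => 0

theorem isDerivationData_deltaGen :
    IsDerivationData 1 (deltaGen : Gen n M P gh → VForm n M P gh) where
  fn_add f g := dfn_add f g
  fn_mul f g := by
    have h := isFormAssignment_gen.comm (n := n) (M := M) (P := P) (gh := gh) (.fn g) (.dfn f)
    simp only [Gen.deg, Gen.vdeg, Gen.ghost] at h
    simp only [deltaGen, dfn_mul, h]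
    simp
  fn_const r := isFormAssignment_gen.dfn_base _
  fld_add i A B := isFormAssignment_gen.dfld_add i A B
  fld_smul i a A := by
    simp [deltaGen, isFormAssignment_gen.dfld_smul, isFormAssignment_gen.dfn_base]
  dfld_add i A B := by simp [deltaGen]
  dfld_smul i a A := by simp [deltaGen, isFormAssignment_gen.dfn_base]
  dfn_base a := rfl
  dfn_comp N F hF f := by
    simp only [deltaGen, mul_zero, zero_add, isFormAssignment_gen.dfn_comp]
    have hc : ∀ j k, (gen (.dfn (f k)) : VForm n M P gh) * gen (.dfn (f j))
        = - (gen (.dfn (f j)) * gen (.dfn (f k))) := by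
      intro j k
      have h := isFormAssignment_gen.comm (n := n) (M := M) (P := P) (gh := gh)
        (.dfn (f k)) (.dfn (f j))
      simpa [Gen.deg, Gen.vdeg, Gen.ghost] using h
    set S := ∑ j, (∑ k, (gen (.fn (LocalFn.comp (pd k (pd j F))
      (contDiff_pd k (contDiff_pd j hF)) f)) : VForm n M P gh) * gen (.dfn (f k))) *
        gen (.dfn (f j)) with hS
    have hneg : S = - S := by
      conv_lhs => rw [hS]
      conv_rhs => rw [hS]
      simp only [Finset.sum_mul, mul_assoc]
      conv_lhs => rw [Finset.sum_comm]
      rw [← Finset.sum_neg_distrib]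
      refine Finset.sum_congr rfl fun j _ => ?_
      rw [← Finset.sum_neg_distrib]
      refine Finset.sum_congr rfl fun k _ => ?_
      rw [hc k j, mul_neg]
      simp only [pd_comm j k hF]
    have h2 : (2 : ℝ) • S = 0 := by
      rw [two_smul]; nth_rewrite 2 [hneg]; exact add_neg_cancel S
    exact ((smul_eq_zero_iff_right (by norm_num : (2 : ℝ) ≠ 0)).1 h2).symm
  comm x y := by
    cases y with
    | fn f => simpa [deltaGen, Gen.deg, Gen.vdeg, Gen.ghost]
        using isFormAssignment_gen.comm (n := n) (M := M) (P := P) (gh := gh) x (.dfn f)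
    | dfn f => simp [deltaGen]
    | fld i D => simpa [deltaGen, Gen.deg, Gen.vdeg, Gen.ghost, add_comm]
        using isFormAssignment_gen.comm (n := n) (M := M) (P := P) (gh := gh) x (.dfld i D)
    | dfld i D => simp [deltaGen]

/-- The vertical differential `δ` on vertical forms: the odd derivation with `fn f ↦ dfn f`,
`fld i D ↦ dfld i D`, `dfn f ↦ 0`, `dfld i D ↦ 0`. -/
def delta : VForm n M P gh →ₗ[ℝ] VForm n M P gh := derivation 1 deltaGen isDerivationData_deltaGen

/-- The total derivative along `ξ` on generators. -/
def totalGen (ξ : VF n M) : Gen n M P gh → VForm n M P gh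
  | .fn f => gen (.fn (LocalFn.derive ξ f))
  | .dfn f => gen (.dfn (LocalFn.derive ξ f))
  | .fld i D => gen (.fld i (DiffOp.derive ξ D))
  | .dfld i D => gen (.dfld i (DiffOp.derive ξ D))

theorem isDerivationData_totalGen (ξ : VF n M) :
    IsDerivationData 0 (totalGen ξ : Gen n M P gh → VForm n M P gh) := by
  have hadd : ∀ f g : LocalFn n M P gh, LocalFn.derive ξ (f + g)
      = LocalFn.derive ξ f + LocalFn.derive ξ g := fun f g =>
    Subtype.ext (funext fun φ => map_add ξ _ _)
  have hmul : ∀ f g : LocalFn n M P gh, LocalFn.derive ξ (f * g)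
      = f * LocalFn.derive ξ g + g * LocalFn.derive ξ f := fun f g =>
    Subtype.ext (funext fun φ => ξ.leibniz _ _)
  have hconst : ∀ r : ℝ, LocalFn.derive ξ (algebraMap ℝ (LocalFn n M P gh) r)
      = algebraMap ℝ (LocalFn n M P gh) 0 := fun r => by
    rw [map_zero]
    exact Subtype.ext (funext fun φ => ξ.map_algebraMap r)
  have hcomp : ∀ {N : ℕ} {F : (Fin N → ℝ) → ℝ} (hF : ContDiff ℝ ∞ F)
      (f : Fin N → LocalFn n M P gh), LocalFn.derive ξ (LocalFn.comp F hF f)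
      = ∑ j, LocalFn.comp (pd j F) (contDiff_pd j hF) f * LocalFn.derive ξ (f j) := by
    intro N F hF f
    refine Subtype.ext (funext fun φ => (derivation_smoothComp ξ hF _).trans ?_)
    rw [AddSubmonoidClass.coe_finsetSum, Finset.sum_apply]
    rfl
  have hD : ∀ (i : {i : ι // gh i ≠ 0}) (A B : DiffOp n M (P i)), DiffOp.derive ξ (A + B)
      = DiffOp.derive ξ A + DiffOp.derive ξ B := fun i A B =>
    Subtype.ext (LinearMap.ext fun s => map_add ξ _ _)
  have hDs : ∀ (i : {i : ι // gh i ≠ 0}) (a : SmoothFn n M) (A : DiffOp n M (P i)),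
      DiffOp.derive ξ (a • A) = a • DiffOp.derive ξ A + ξ a • A := fun i a A =>
    Subtype.ext (LinearMap.ext fun s => (ξ.leibniz _ _).trans
      (congrArg _ (mul_comm _ _)))
  have hbase : ∀ a : SmoothFn n M, LocalFn.derive ξ (LocalFn.base a : LocalFn n M P gh)
      = LocalFn.base (ξ a) := fun a => rfl
  have hcm : ∀ f g : LocalFn n M P gh, (gen (.fn f) : VForm n M P gh) * gen (.fn g)
      = gen (.fn g) * gen (.fn f) := fun f g => by
    rw [← isFormAssignment_gen.fn_mul, mul_comm, isFormAssignment_gen.fn_mul]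
  constructor
  case fn_add => intro f g; simp [totalGen, hadd, isFormAssignment_gen.fn_add]
  case fn_mul =>
    intro f g
    simp [totalGen, hmul, isFormAssignment_gen.fn_add, isFormAssignment_gen.fn_mul, hcm g]
  case fn_const =>
    intro r
    simp only [totalGen, hconst]
    rw [isFormAssignment_gen.fn_const, map_zero]
  case fld_add => intro i A B; simp [totalGen, hD, isFormAssignment_gen.fld_add]
  case fld_smul =>
    intro i a A
    simp [totalGen, hDs, hbase, isFormAssignment_gen.fld_add, isFormAssignment_gen.fld_smul]
  case dfld_add => intro i A B; simp [totalGen, hD, isFormAssignment_gen.dfld_add]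
  case dfld_smul =>
    intro i a A
    simp [totalGen, hDs, hbase, isFormAssignment_gen.dfld_add, isFormAssignment_gen.dfld_smul]
  case dfn_base => intro a; exact isFormAssignment_gen.dfn_base (ξ a)
  case dfn_comp =>
    intro N F hF f
    simp only [totalGen, hcomp, dfn_sum, dfn_mul, fn_sum, Finset.sum_add_distrib,
      isFormAssignment_gen.fn_mul, isFormAssignment_gen.dfn_comp, Finset.mul_sum, Finset.sum_mul]
    congr 1
    rw [Finset.sum_comm]
    refine Finset.sum_congr rfl fun j _ => Finset.sum_congr rfl fun k _ => ?_
    rw [← mul_assoc, hcm]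
    simp only [pd_comm j k hF]
  case comm =>
    intro x y
    cases y with
    | fn f => simpa [totalGen, Gen.deg, Gen.vdeg, Gen.ghost]
        using isFormAssignment_gen.comm (n := n) (M := M) (P := P) (gh := gh) x (.fn (LocalFn.derive ξ f))
    | dfn f => simpa [totalGen, Gen.deg, Gen.vdeg, Gen.ghost]
        using isFormAssignment_gen.comm (n := n) (M := M) (P := P) (gh := gh) x (.dfn (LocalFn.derive ξ f))
    | fld i D => simpa [totalGen, Gen.deg, Gen.vdeg, Gen.ghost]
        using isFormAssignment_gen.comm (n := n) (M := M) (P := P) (gh := gh) x (.fld i (DiffOp.derive ξ D))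
    | dfld i D => simpa [totalGen, Gen.deg, Gen.vdeg, Gen.ghost]
        using isFormAssignment_gen.comm (n := n) (M := M) (P := P) (gh := gh) x (.dfld i (DiffOp.derive ξ D))

/-- The total derivative along a vector field `ξ = ξ^i ∂_i` on `M`, i.e. the even derivation `ξ^i D_i`
of the algebra of vertical forms. It commutes with `δ`. -/
def total (ξ : VF n M) : VForm n M P gh →ₗ[ℝ] VForm n M P gh :=
  derivation 0 (totalGen ξ) (isDerivationData_totalGen ξ)

theorem delta_gen (x : Gen n M P gh) : delta (gen x) = deltaGen x :=
  derivation_gen _ _ _ _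

theorem total_gen (ξ : VF n M) (x : Gen n M P gh) : total ξ (gen x) = totalGen ξ x :=
  derivation_gen _ _ _ _

/-- The vertical forms of vertical degree `p` and ghost number `r`. -/
def deg (n : ℕ) (M : Type*) [TopologicalSpace M] [ChartedSpace (EuclideanSpace ℝ (Fin n)) M]
    {ι : Type*} (P : ι → Type*) [∀ i, AddCommGroup (P i)] [∀ i, Module ℝ (P i)]
    [∀ i, Module (SmoothFn n M) (P i)] (gh : ι → ℤ) (p : ℕ) (r : ℤ) :
    Submodule ℝ (VForm n M P gh) :=
  Submodule.span ℝ {v | ∃ l : List (Gen n M P gh), (l.map Gen.vdeg).sum = p ∧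
    (l.map Gen.ghost).sum = r ∧ v = (l.map gen).prod}

end VForm

/-- Maps from `q`-tuples of vector fields on `M` to vertical forms. A form on `J^∞E` of horizontal degree
`q` is regarded as such a map: `dx^J v` has the value `dx^J(ξ₁, …, ξ_q) v`, with `v` a vertical form. -/
abbrev Cochain (q : ℕ) : Type _ := (Fin q → VF n M) → VForm n M P gh

variable {n M P gh}

/-- `IsForm p r α`: `α` is a form on `J^∞E` of vertical degree `p`, horizontal degree `q` and ghost number
`r`, i.e. it is `C^∞(M)`-multilinear, alternating and has values of degree `(p, r)`. -/
structure IsForm (p : ℕ) {q : ℕ} (r : ℤ) (α : Cochain n M P gh q) : Prop where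
  map_update_add : ∀ (ξ : Fin q → VF n M) (i : Fin q) (η ζ : VF n M),
    α (Function.update ξ i (η + ζ)) = α (Function.update ξ i η) + α (Function.update ξ i ζ)
  map_update_smul : ∀ (ξ : Fin q → VF n M) (i : Fin q) (a : SmoothFn n M) (η : VF n M),
    α (Function.update ξ i (a • η)) = VForm.baseFn a * α (Function.update ξ i η)
  map_eq_zero_of_eq : ∀ (ξ : Fin q → VF n M) (i j : Fin q), i ≠ j → ξ i = ξ j → α ξ = 0
  mem_deg : ∀ ξ, α ξ ∈ VForm.deg n M P gh p r

/-- The space `Λ^{p,q,r}(J^∞E)` of forms of vertical degree `p`, horizontal degree `q` and ghost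
number `r`. -/
def forms (q p : ℕ) (r : ℤ) : Submodule ℝ (Cochain n M P gh q) where
  carrier := {α | IsForm p r α}
  add_mem' := by
    intro α β hα hβ
    refine ⟨fun ξ i η ζ => ?_, fun ξ i a η => ?_, fun ξ i j hij h => ?_, fun ξ => ?_⟩
    · simp only [Pi.add_apply, hα.map_update_add, hβ.map_update_add]; abel
    · simp only [Pi.add_apply, hα.map_update_smul, hβ.map_update_smul, mul_add]
    · simp only [Pi.add_apply, hα.map_eq_zero_of_eq ξ i j hij h,
        hβ.map_eq_zero_of_eq ξ i j hij h, add_zero]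
    · exact Submodule.add_mem _ (hα.mem_deg ξ) (hβ.mem_deg ξ)
  zero_mem' := ⟨fun ξ i η ζ => (add_zero _).symm, fun ξ i a η => (mul_zero _).symm,
    fun ξ i j hij h => rfl, fun ξ => Submodule.zero_mem _⟩
  smul_mem' := by
    intro c α hα
    refine ⟨fun ξ i η ζ => ?_, fun ξ i a η => ?_, fun ξ i j hij h => ?_, fun ξ => ?_⟩
    · simp only [Pi.smul_apply, hα.map_update_add, smul_add]
    · simp only [Pi.smul_apply, hα.map_update_smul, mul_smul_comm]
    · simp only [Pi.smul_apply, hα.map_eq_zero_of_eq ξ i j hij h, smul_zero]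
    · exact Submodule.smul_mem _ c (hα.mem_deg ξ)

/-- The horizontal differential `d = dx^i D_i`,
`(dα)(ξ₀, …, ξ_q) = ∑ᵢ (-1)^i ξᵢ(α(…, ξ̂ᵢ, …)) + ∑_{i<j} (-1)^{i+j} α([ξᵢ, ξⱼ], …, ξ̂ᵢ, …, ξ̂ⱼ, …)`.
In the second sum the bracket is moved to the place of `ξⱼ`, which costs the sign `(-1)^{j-1}`. -/
def horD {q : ℕ} : Cochain n M P gh q →ₗ[ℝ] Cochain n M P gh (q + 1) where
  toFun α ξ := ∑ i : Fin (q + 1), (-1 : ℝ) ^ (i : ℕ) •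
    (VForm.total (ξ i) (α fun k => ξ (i.succAbove k))
      - ∑ j : Fin q, if i ≤ j.castSucc then
          α (Function.update (fun k => ξ (i.succAbove k)) j ⁅ξ i, ξ (i.succAbove j)⁆)
        else 0)
  map_add' α β := by
    funext ξ
    simp only [Pi.add_apply, map_add, ← Finset.sum_add_distrib, ← smul_add]
    refine Finset.sum_congr rfl fun i _ => ?_
    congr 1
    rw [sub_add_sub_comm, ← Finset.sum_add_distrib]
    congr 1
    refine Finset.sum_congr rfl fun j _ => ?_
    split_ifs <;> simp
  map_smul' c α := by
    funext ξ
    simp only [Pi.smul_apply, map_smul, RingHom.id_apply, Finset.smul_sum]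
    refine Finset.sum_congr rfl fun i _ => ?_
    rw [smul_comm c]
    refine congrArg _ ?_
    rw [smul_sub, Finset.smul_sum]
    refine congrArg _ (Finset.sum_congr rfl fun j _ => ?_)
    split_ifs <;> simp

/-- The vertical differential `δ (dx^J v) = (-1)^{|J|} dx^J δv` on forms. -/
def verD {q : ℕ} : Cochain n M P gh q →ₗ[ℝ] Cochain n M P gh q where
  toFun α ξ := (-1 : ℝ) ^ q • VForm.delta (α ξ)
  map_add' α β := by funext ξ; simp
  map_smul' c α := by funext ξ; simp [smul_comm c]

/-- The space `dΛ^{p,q-1,r}` of `d`-exact forms of horizontal degree `q` (zero for `q = 0`). Two forms are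
related by `≃` if their difference is `d`-exact. -/
def horExact (p : ℕ) (r : ℤ) : (q : ℕ) → Submodule ℝ (Cochain n M P gh q)
  | 0 => ⊥
  | q + 1 => (forms q p r).map horD

/-- Contraction of forms with a vertical vector field `X` of ghost number `k`, given by its contraction
operator on vertical forms: `i_X (dx^J v) = (-1)^{|J| (k-1)} dx^J i_X v`. -/
def contr {q : ℕ} (k : ℤ) (X : Module.End ℝ (VForm n M P gh)) :
    Cochain n M P gh q →ₗ[ℝ] Cochain n M P gh q where
  toFun α ξ := (-1 : ℝ) ^ (q * (k - 1)) • X (α ξ)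
  map_add' α β := by funext ξ; simp
  map_smul' c α := by funext ξ; simp [smul_comm c]

theorem contr_add_left {q : ℕ} (k : ℤ) (X Y : Module.End ℝ (VForm n M P gh))
    (α : Cochain n M P gh q) : contr k (X + Y) α = contr k X α + contr k Y α := by
  funext ξ; simp [contr]

theorem contr_smul_left {q : ℕ} (k : ℤ) (c : ℝ) (X : Module.End ℝ (VForm n M P gh))
    (α : Cochain n M P gh q) : contr k (c • X) α = c • contr k X α := by
  funext ξ; simp [contr, smul_comm c]

theorem contr_zero_left {q : ℕ} (k : ℤ)
    (α : Cochain n M P gh q) : contr k (0 : Module.End ℝ (VForm n M P gh)) α = 0 := by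
  funext ξ; simp [contr]

/-- `X` is (the contraction operator `i_X` of) an evolutionary vector field of ghost number `k`. The first
three conditions say that it is a vertical vector field: a derivation of vertical degree `-1` and
ghost number `k`, hence of parity `k - 1`. The last one is `i_X d + (-1)^k d i_X = 0`. -/
structure IsEvolutionary (k : ℤ) (X : Module.End ℝ (VForm n M P gh)) : Prop where
  map_fn : ∀ r, ∀ f ∈ VForm.deg n M P gh 0 r, X f = 0
  map_deg : ∀ p r, ∀ v ∈ VForm.deg n M P gh (p + 1) r, X v ∈ VForm.deg n M P gh p (r + k)
  leibniz : ∀ p r, ∀ v ∈ VForm.deg n M P gh p r, ∀ w,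
    X (v * w) = X v * w + (-1 : ℝ) ^ ((k - 1) * (p + r)) • (v * X w)
  evolutionary : ∀ q p r, ∀ α ∈ forms (n := n) (M := M) (P := P) (gh := gh) q p r,
    contr k X (horD α) + (-1 : ℝ) ^ k • horD (contr k X α) = 0

/-- The space of evolutionary vector fields of ghost number `k`. -/
def evolutionary (k : ℤ) : Submodule ℝ (Module.End ℝ (VForm n M P gh)) where
  carrier := {X | IsEvolutionary k X}
  add_mem' := by
    intro X Y hX hY
    refine ⟨fun r f hf => ?_, fun p r v hv => ?_, fun p r v hv w => ?_, fun q p r α hα => ?_⟩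
    · simp only [LinearMap.add_apply, hX.map_fn r f hf, hY.map_fn r f hf, add_zero]
    · exact Submodule.add_mem _ (hX.map_deg p r v hv) (hY.map_deg p r v hv)
    · simp only [LinearMap.add_apply, hX.leibniz p r v hv, hY.leibniz p r v hv, add_mul, mul_add,
        smul_add]
      abel
    · rw [contr_add_left, contr_add_left, map_add, smul_add, add_add_add_comm, hX.evolutionary q p r α hα,
        hY.evolutionary q p r α hα, add_zero]
  zero_mem' := by
    exact ⟨fun r f hf => rfl, fun p r v hv => Submodule.zero_mem _, fun p r v hv w => by simp,
      fun q p r α hα => by simp [contr_zero_left]⟩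
  smul_mem' := by
    intro c X hX
    refine ⟨fun r f hf => ?_, fun p r v hv => ?_, fun p r v hv w => ?_, fun q p r α hα => ?_⟩
    · simp only [LinearMap.smul_apply, hX.map_fn r f hf, smul_zero]
    · exact Submodule.smul_mem _ c (hX.map_deg p r v hv)
    · simp only [LinearMap.smul_apply, hX.leibniz p r v hv, smul_add, smul_mul_assoc,
        mul_smul_comm, smul_comm c]
    · rw [contr_smul_left, contr_smul_left, map_smul, smul_comm _ c, ← smul_add, hX.evolutionary q p r α hα, smul_zero]

/-- The Lie derivative `L_X = i_X δ + (-1)^k δ i_X` on vertical forms. -/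
def lieV (k : ℤ) (X : Module.End ℝ (VForm n M P gh)) : Module.End ℝ (VForm n M P gh) :=
  X * VForm.delta + (-1 : ℝ) ^ k • (VForm.delta * X)

/-- The Lie derivative `L_X = i_X δ + (-1)^k δ i_X` on forms. -/
def lieD {q : ℕ} (k : ℤ) (X : Module.End ℝ (VForm n M P gh)) (α : Cochain n M P gh q) :
    Cochain n M P gh q :=
  contr k X (verD α) + (-1 : ℝ) ^ k • verD (contr k X α)

/-- The graded commutator of vector fields of ghost numbers `k` and `l`:
`i_{[X,Y]} = [L_X, i_Y] = L_X i_Y - (-1)^{k (l-1)} i_Y L_X`. -/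
def bracket (k l : ℤ) (X Y : Module.End ℝ (VForm n M P gh)) : Module.End ℝ (VForm n M P gh) :=
  lieV k X * Y - (-1 : ℝ) ^ (k * (l - 1)) • (Y * lieV k X)

/-- The ideal of vertical forms that vanish on the shell `Σ^∞`, the zero locus of the homological vector
field `Q`: the two-sided ideal generated by the functions `Q f` and their differentials `δ(Q f)`, for
`f` a function on `J^∞E`. -/
def shellIdeal (Q : Module.End ℝ (VForm n M P gh)) : Submodule ℝ (VForm n M P gh) :=
  Submodule.span ℝ {v | ∃ a b : VForm n M P gh, ∃ r, ∃ f ∈ VForm.deg n M P gh 0 r,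
    v = a * lieV 1 Q f * b ∨ v = a * VForm.delta (lieV 1 Q f) * b}

/-- The forms that vanish on the shell, `α|_Σ = 0`. -/
def onShellZero (Q : Module.End ℝ (VForm n M P gh)) (q : ℕ) : Submodule ℝ (Cochain n M P gh q) :=
  Submodule.pi Set.univ fun _ => shellIdeal Q

/-- The forms `α` with `α ≈ 0`, i.e. whose restriction to the shell is `d`-exact. -/
def onShellExact (Q : Module.End ℝ (VForm n M P gh)) (q p : ℕ) (r : ℤ) :
    Submodule ℝ (Cochain n M P gh q) :=
  onShellZero Q q ⊔ horExact p r q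

/-- `(Q, Ω)` is a gauge system of degree `m`: `Q` is a homological vector field (evolutionary, of ghost
number one, `[Q, Q] = 0`) and `Ω` is a `Q`-invariant presymplectic form of type `(2, m)` and ghost
number `g`: `δΩ ≃ 0` and `L_Q Ω ≃ 0`. -/
structure IsGaugeSystem (Q : Module.End ℝ (VForm n M P gh)) (m : ℕ) (g : ℤ)
    (Ω : Cochain n M P gh m) : Prop where
  evolutionary : IsEvolutionary 1 Q
  homological : bracket 1 1 Q Q = 0
  form : Ω ∈ forms m 2 g
  presymplectic : verD Ω ∈ horExact 3 g m
  invariant : lieD 1 Q Ω ∈ horExact 2 (g + 1) m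

/-- Symmetries of ghost number `k`: the evolutionary vector fields `X` with `[X, Q] = 0`. -/
def symmetries (Q : Module.End ℝ (VForm n M P gh)) (k : ℤ) :
    Submodule ℝ (Module.End ℝ (VForm n M P gh)) where
  carrier := {X | X ∈ evolutionary k ∧ bracket k 1 X Q = 0}
  add_mem' := by
    rintro X Y ⟨hX, hX'⟩ ⟨hY, hY'⟩
    refine ⟨Submodule.add_mem _ hX hY, ?_⟩
    have : bracket k 1 (X + Y) Q = bracket k 1 X Q + bracket k 1 Y Q := by
      simp only [bracket, lieV, add_mul, mul_add, smul_add]; abel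
    rw [this, hX', hY', add_zero]
  zero_mem' := ⟨Submodule.zero_mem _, by simp [bracket, lieV]⟩
  smul_mem' := by
    rintro c X ⟨hX, hX'⟩
    refine ⟨Submodule.smul_mem _ c hX, ?_⟩
    have : bracket k 1 (c • X) Q = c • bracket k 1 X Q := by
      simp only [bracket, lieV, smul_mul_assoc, mul_smul_comm, smul_add, smul_sub, smul_comm c,
        add_mul, mul_add]
    rw [this, hX', smul_zero]

/-- The relation `i_X Ω ≈ δα` between symmetries `X` of ghost number `k` and forms
`α ∈ Λ^{0,m}(J^∞E)` of ghost number `k + g`. -/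
def hamiltonianPairs (Q : Module.End ℝ (VForm n M P gh)) {m : ℕ} (g : ℤ)
    (Ω : Cochain n M P gh m) (k : ℤ) :
    Submodule ℝ (Module.End ℝ (VForm n M P gh) × Cochain n M P gh m) where
  carrier := {x | x.1 ∈ symmetries Q k ∧ x.2 ∈ forms m 0 (k + g) ∧
    contr k x.1 Ω - verD x.2 ∈ onShellExact Q m 1 (k + g)}
  add_mem' := by
    rintro x y ⟨h1, h2, h3⟩ ⟨h1', h2', h3'⟩
    refine ⟨Submodule.add_mem _ h1 h1', Submodule.add_mem _ h2 h2', ?_⟩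
    rw [Prod.fst_add, Prod.snd_add, contr_add_left, map_add, add_sub_add_comm]
    exact Submodule.add_mem _ h3 h3'
  zero_mem' := by
    refine ⟨Submodule.zero_mem _, Submodule.zero_mem _, ?_⟩
    rw [Prod.fst_zero, Prod.snd_zero, contr_zero_left, map_zero, sub_zero]
    exact Submodule.zero_mem _
  smul_mem' := by
    rintro c x ⟨h1, h2, h3⟩
    refine ⟨Submodule.smul_mem _ c h1, Submodule.smul_mem _ c h2, ?_⟩
    rw [Prod.smul_fst, Prod.smul_snd, contr_smul_left, map_smul, ← smul_sub]
    exact Submodule.smul_mem _ c h3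

/-- The on-shell Hamiltonian symmetries of ghost number `k`, i.e. `Sym_Σ(Q, Ω)` in that degree. -/
def hamiltonianSymmetries (Q : Module.End ℝ (VForm n M P gh)) {m : ℕ} (g : ℤ)
    (Ω : Cochain n M P gh m) (k : ℤ) : Submodule ℝ (Module.End ℝ (VForm n M P gh)) :=
  (hamiltonianPairs Q g Ω k).map (LinearMap.fst ℝ _ _)

/-- The on-shell Hamiltonian forms whose symmetries have ghost number `k`. -/
def hamiltonianForms (Q : Module.End ℝ (VForm n M P gh)) {m : ℕ} (g : ℤ)
    (Ω : Cochain n M P gh m) (k : ℤ) : Submodule ℝ (Cochain n M P gh m) :=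
  (hamiltonianPairs Q g Ω k).map (LinearMap.snd ℝ _ _)

/-- The space `Λ^H(Q, Ω)` of on-shell Hamiltonian forms up to `≈`, graded by the ghost number `k` of the
symmetries (the forms have ghost number `k + g`). -/
abbrev LamH (Q : Module.End ℝ (VForm n M P gh)) {m : ℕ} (g : ℤ)
    (Ω : Cochain n M P gh m) (k : ℤ) : Type _ :=
  hamiltonianForms Q g Ω k ⧸
    (onShellExact Q m 0 (k + g)).comap (hamiltonianForms Q g Ω k).subtype

/-- The class of an on-shell Hamiltonian form in `Λ^H(Q, Ω)`. -/
def LamH.mk (Q : Module.End ℝ (VForm n M P gh)) {m : ℕ} (g : ℤ)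
    (Ω : Cochain n M P gh m) (k : ℤ) : hamiltonianForms Q g Ω k →ₗ[ℝ] LamH Q g Ω k :=
  Submodule.mkQ _

/-- The classes of the forms `α` with `δα ≈ 0`, i.e. of the Hamiltonians of the zero vector field. -/
def LamH.constants (Q : Module.End ℝ (VForm n M P gh)) {m : ℕ} (g : ℤ)
    (Ω : Cochain n M P gh m) (k : ℤ) : Submodule ℝ (LamH Q g Ω k) :=
  ((onShellExact Q m 1 (k + g)).comap (verD ∘ₗ (hamiltonianForms Q g Ω k).subtype)).map
    (LamH.mk Q g Ω k)

/-- Transport along an equality of degrees. -/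
def LamH.recast {Q : Module.End ℝ (VForm n M P gh)} {m : ℕ} {g : ℤ}
    {Ω : Cochain n M P gh m} {k k' : ℤ} (h : k = k') (a : LamH Q g Ω k) : LamH Q g Ω k' :=
  h ▸ a

/-- A form is flat if it vanishes on the zero section `M ⊂ J^∞E`. -/
def IsFlat {q : ℕ} (α : Cochain n M P gh q) : Prop := ∀ ξ, VForm.zeroSection (α ξ) = 0

/-- The projection of a purely horizontal form to its flat part: subtract the pullback to `J^∞E` of its
restriction to the zero section. -/
def flatPart {q : ℕ} (α : Cochain n M P gh q) : Cochain n M P gh q :=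
  fun ξ => α ξ - VForm.baseFn (VForm.zeroSection (α ξ))

/-- `dα|_Σ = 0`. -/
def IsConservationLaw (Q : Module.End ℝ (VForm n M P gh)) {q : ℕ} (α : Cochain n M P gh q) :
    Prop :=
  horD α ∈ onShellZero Q (q + 1)

/-- The groups `H^{0,q}_flat(Σ^∞; δ)` vanish: in vertical degree zero they consist of the restrictions to
the shell of flat forms that are annihilated by `δ` on the shell. -/
def FlatVerticalCohomologyTrivial (Q : Module.End ℝ (VForm n M P gh)) : Prop :=
  ∀ (q : ℕ) (r : ℤ), ∀ α ∈ forms q 0 r, IsFlat α → verD α ∈ onShellZero Q q → α ∈ onShellZero Q q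

end Jets

section Sections
variable {n : ℕ} {M : Type*} [TopologicalSpace M] [ChartedSpace (EuclideanSpace ℝ (Fin n)) M]
  {F : Type*} [NormedAddCommGroup F] [NormedSpace ℝ F] {V : M → Type*}
  [∀ x, AddCommGroup (V x)] [∀ x, Module ℝ (V x)] [∀ x, TopologicalSpace (V x)]
  [TopologicalSpace (Bundle.TotalSpace F V)] [FiberBundle F V] [VectorBundle ℝ F V]

/-- Sections of a vector bundle over `M` form a module over `C^∞(M)`. -/
instance : SMul (SmoothFn n M) (ContMDiffSection (𝓡 n) F ∞ V) :=
  ⟨fun a s => ⟨fun x => a x • s x, a.contMDiff.smul_section s.contMDiff⟩⟩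

instance : Module (SmoothFn n M) (ContMDiffSection (𝓡 n) F ∞ V) where
  one_smul s := ContMDiffSection.ext fun x => one_smul ℝ (s x)
  mul_smul a b s := ContMDiffSection.ext fun x => mul_smul (a x) (b x) (s x)
  smul_zero a := ContMDiffSection.ext fun x => smul_zero (a x)
  smul_add a s t := ContMDiffSection.ext fun x => smul_add (a x) (s x) (t x)
  add_smul a b s := ContMDiffSection.ext fun x => add_smul (a x) (b x) (s x)
  zero_smul s := ContMDiffSection.ext fun x => zero_smul ℝ (s x)

end Sections

end

end JetForms

open JetForms

namespace JetForms

noncomputable section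

section
variable {n : ℕ} {M : Type*} [TopologicalSpace M] [ChartedSpace (EuclideanSpace ℝ (Fin n)) M]
  {ι : Type*} {P : ι → Type*} [∀ i, AddCommGroup (P i)] [∀ i, Module ℝ (P i)]
  [∀ i, Module (SmoothFn n M) (P i)] {gh : ι → ℤ}

/-! The proposition is Cartan calculus modulo `≈`. What has to be shown is that `≈` is compatible
with the operators involved. The shell ideal is generated by the functions `Qf` and the forms
`δ(Qf)`. It is stable under `δ` and total derivatives, and under `i_X` for every symmetry `X`, since
`i_X δ(Qf) = L_X (Qf) = ± Q(Xf)` is again in the ideal. Exact forms are stable under `δ` and under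
contraction with evolutionary fields, because these operators commute with `d` up to sign. So `δ`
and contractions with symmetries preserve `≈ 0` (`verD_mem_onShellExact`, `contr_mem_onShellExact`).

Bracket: `i_X Ω ≈ δα` gives `δ i_X Ω ≈ 0`, hence `L_X Ω ≈ 0` because `δΩ ≃ 0`. In `i_{[X,Y]} Ω = L_X
i_Y Ω ∓ i_Y L_X Ω` only `(-1)^k δ i_X i_Y Ω` then survives, where `k` is the ghost number of `X`.
Contractions commute in the graded sense, which gives antisymmetry. Jacobi holds because triple
contractions of a `2`-form vanish: up to `≈`, bracketing with a Hamiltonian of `W` is `L_W`, a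
graded derivation of contractions that kills `Ω` up to `≈`. Since `i_X Ω` is determined up to `≈` by
`δα`, the bracket does not depend on the choice of `X` and vanishes on `Z`.

Conservation laws: `d` annihilates exact forms, so `i_X Ω ≈ δα` and `dΩ|_Σ = 0` imply `δ d α̂|_Σ =
0`. As `d α̂` is flat, the vanishing of the flat cohomology gives `d α̂|_Σ = 0`.

Trivial symmetries: `L_Q` maps every form into the shell ideal and `L_Q Ω ≃ 0`, so `i_{[Q,Y]} Ω =
L_Q i_Y Ω ∓ i_Y L_Q Ω ≈ 0`.

Two mechanisms support this. Graded derivations of vertical forms are determined by their values on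
generators (`VForm.IsDer.ext`), so operator identities are checked there. For the horizontal
differential, Cartan's formulas for `ins`, `lieH` and `horD` allow induction on the horizontal
degree, which yields `d² = 0` and the fact that `dα` is again a form. -/

theorem neg_one_zpow_sub_one (k : ℤ) : (-1 : ℝ) ^ (k - 1) = -(-1 : ℝ) ^ k := by
  rw [zpow_sub₀ (by norm_num), zpow_one, div_neg, div_one]

theorem neg_one_zpow_eq_or (k : ℤ) : (-1 : ℝ) ^ k = 1 ∨ (-1 : ℝ) ^ k = -1 := by
  rcases Int.even_or_odd k with h | h
  · exact Or.inl h.neg_one_zpow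
  · exact Or.inr h.neg_one_zpow

theorem neg_one_zpow_add (k l : ℤ) : (-1 : ℝ) ^ (k + l) = (-1 : ℝ) ^ k * (-1 : ℝ) ^ l :=
  zpow_add₀ (by norm_num) k l

/-! ### Graded derivations of the algebra of vertical forms -/

namespace VForm

theorem adjoin_range_gen :
    Algebra.adjoin ℝ (Set.range (gen : Gen n M P gh → VForm n M P gh)) = ⊤ := by
  have h1 : (RingQuot.mkAlgHom ℝ (FormRel n M P gh)).range = ⊤ :=
    (AlgHom.range_eq_top _).2 (RingQuot.mkAlgHom_surjective ℝ (FormRel n M P gh))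
  have h2 := AlgHom.map_adjoin (RingQuot.mkAlgHom ℝ (FormRel n M P gh))
    (Set.range (FreeAlgebra.ι ℝ : Gen n M P gh → _))
  rw [FreeAlgebra.adjoin_range_ι, Algebra.map_top, h1, ← Set.range_comp] at h2
  exact h2.symm

/-- Every vertical form is a linear combination of products of generators. -/
theorem induction_monomial {p : VForm n M P gh → Prop} (zero : p 0)
    (add : ∀ v w, p v → p w → p (v + w)) (smul : ∀ (c : ℝ) v, p v → p (c • v))
    (monomial : ∀ l : List (Gen n M P gh), p (l.map gen).prod) (v : VForm n M P gh) : p v := by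
  have hv : v ∈ Submodule.span ℝ
      (Submonoid.closure (Set.range (gen : Gen n M P gh → VForm n M P gh)) : Set _) := by
    rw [← Algebra.adjoin_eq_span, adjoin_range_gen]; trivial
  induction hv using Submodule.span_induction with
  | mem x hx =>
    obtain ⟨l, hl, rfl⟩ := Submonoid.exists_list_of_mem_closure hx
    obtain ⟨l', rfl⟩ : l ∈ Set.range (List.map gen) := by
      rw [Set.range_list_map]; exact hl
    exact monomial l'
  | zero => exact zero
  | add x y _ _ hx hy => exact add x y hx hy
  | smul c x _ hx => exact smul c x hx

/-- The vertical forms of total degree congruent to `s` modulo two. -/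
def parity (n : ℕ) (M : Type*) [TopologicalSpace M] [ChartedSpace (EuclideanSpace ℝ (Fin n)) M]
    {ι : Type*} (P : ι → Type*) [∀ i, AddCommGroup (P i)] [∀ i, Module ℝ (P i)]
    [∀ i, Module (SmoothFn n M) (P i)] (gh : ι → ℤ) (s : ℤ) :
    Submodule ℝ (VForm n M P gh) :=
  Submodule.span ℝ {v | ∃ l : List (Gen n M P gh),
    (-1 : ℝ) ^ (l.map Gen.deg).sum = (-1 : ℝ) ^ s ∧ v = (l.map gen).prod}

theorem parity_congr {s t : ℤ} (h : (-1 : ℝ) ^ s = (-1 : ℝ) ^ t) :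
    parity n M P gh s = parity n M P gh t := by
  simp only [parity, h]

theorem monomial_mem_parity (l : List (Gen n M P gh)) :
    (l.map gen).prod ∈ parity n M P gh (l.map Gen.deg).sum :=
  Submodule.subset_span ⟨l, rfl, rfl⟩

theorem gen_mem_parity (x : Gen n M P gh) : gen x ∈ parity n M P gh x.deg := by
  simpa using monomial_mem_parity [x]

theorem sum_deg (l : List (Gen n M P gh)) :
    (l.map Gen.deg).sum = (l.map Gen.vdeg).sum + (l.map Gen.ghost).sum := by
  induction l with
  | nil => simp
  | cons x l ih => simp [ih, Gen.deg]; ring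

theorem monomial_mem_deg (l : List (Gen n M P gh)) :
    (l.map gen).prod ∈ deg n M P gh (l.map Gen.vdeg).sum (l.map Gen.ghost).sum :=
  Submodule.subset_span ⟨l, rfl, rfl, rfl⟩

theorem gen_mem_deg (x : Gen n M P gh) : gen x ∈ deg n M P gh x.vdeg x.ghost := by
  simpa using monomial_mem_deg [x]

theorem deg_le_parity (p : ℕ) (r : ℤ) : deg n M P gh p r ≤ parity n M P gh (p + r) := by
  refine Submodule.span_le.2 ?_
  rintro _ ⟨l, rfl, rfl, rfl⟩
  rw [← sum_deg]
  exact monomial_mem_parity l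

theorem mul_mem_deg {p p' : ℕ} {r r' : ℤ} {v w : VForm n M P gh} (hv : v ∈ deg n M P gh p r)
    (hw : w ∈ deg n M P gh p' r') : v * w ∈ deg n M P gh (p + p') (r + r') := by
  induction hv using Submodule.span_induction with
  | mem x hx =>
    induction hw using Submodule.span_induction with
    | mem y hy =>
      obtain ⟨l, rfl, rfl, rfl⟩ := hx
      obtain ⟨l', rfl, rfl, rfl⟩ := hy
      exact Submodule.subset_span ⟨l ++ l', by simp⟩
    | zero => simp
    | add y z _ _ hy hz => rw [mul_add]; exact add_mem hy hz
    | smul c y _ hy => rw [mul_smul_comm]; exact Submodule.smul_mem _ c hy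
  | zero => simp
  | add y z _ _ hy hz => rw [add_mul]; exact add_mem hy hz
  | smul c y _ hy => rw [smul_mul_assoc]; exact Submodule.smul_mem _ c hy

theorem mul_mem_parity {s t : ℤ} {v w : VForm n M P gh} (hv : v ∈ parity n M P gh s)
    (hw : w ∈ parity n M P gh t) : v * w ∈ parity n M P gh (s + t) := by
  induction hv using Submodule.span_induction with
  | mem x hx =>
    induction hw using Submodule.span_induction with
    | mem y hy =>
      obtain ⟨l, h, rfl⟩ := hx
      obtain ⟨l', h', rfl⟩ := hy
      exact Submodule.subset_span ⟨l ++ l', by simp [neg_one_zpow_add, h, h'], by simp⟩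
    | zero => simp
    | add y z _ _ hy hz => rw [mul_add]; exact add_mem hy hz
    | smul c y _ hy => rw [mul_smul_comm]; exact Submodule.smul_mem _ c hy
  | zero => simp
  | add y z _ _ hy hz => rw [add_mul]; exact add_mem hy hz
  | smul c y _ hy => rw [smul_mul_assoc]; exact Submodule.smul_mem _ c hy

theorem one_mem_parity : (1 : VForm n M P gh) ∈ parity n M P gh 0 := by
  simpa using monomial_mem_parity ([] : List (Gen n M P gh))

/-- Every vertical form is a sum of forms of definite parity. -/
theorem induction_parity {p : VForm n M P gh → Prop} (zero : p 0)
    (add : ∀ v w, p v → p w → p (v + w))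
    (homogeneous : ∀ s, ∀ v ∈ parity n M P gh s, p v) (v : VForm n M P gh) : p v := by
  have h : v ∈ ⨆ s, parity n M P gh s := by
    induction v using induction_monomial with
    | zero => exact zero_mem _
    | add v w hv hw => exact add_mem hv hw
    | smul c v hv => exact Submodule.smul_mem _ c hv
    | monomial l => exact Submodule.mem_iSup_of_mem _ (monomial_mem_parity l)
  exact Submodule.iSup_induction _ (motive := p) h homogeneous zero add

/-- Graded derivations of parity `e` of the algebra of vertical forms. -/
structure IsDer (e : ℤ) (D : Module.End ℝ (VForm n M P gh)) : Prop where
  map_parity : ∀ s, ∀ v ∈ parity n M P gh s, D v ∈ parity n M P gh (s + e)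
  leibniz : ∀ s, ∀ v ∈ parity n M P gh s, ∀ w, D (v * w) = D v * w + (-1 : ℝ) ^ (e * s) • (v * D w)

namespace IsDer
variable {e f : ℤ} {D D' : Module.End ℝ (VForm n M P gh)}

theorem map_one (hD : IsDer e D) : D 1 = 0 := by
  simpa using hD.leibniz 0 1 one_mem_parity 1

/-- A derivation kills `1`, and the Leibniz rule propagates agreement from generators to monomials.
Applied to graded commutators, this reduces the operator identities below to generators. -/
theorem ext (hD : IsDer e D) (hD' : IsDer e D') (h : ∀ x, D (gen x) = D' (gen x)) : D = D' := by
  refine LinearMap.ext fun v => ?_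
  induction v using induction_monomial with
  | zero => simp
  | add v w hv hw => simp [hv, hw]
  | smul c v hv => simp [hv]
  | monomial l =>
    induction l with
    | nil => simp [hD.map_one, hD'.map_one]
    | cons x l ih =>
      simp [hD.leibniz _ _ (gen_mem_parity x), hD'.leibniz _ _ (gen_mem_parity x), ih, h]

theorem zero : IsDer e (0 : Module.End ℝ (VForm n M P gh)) :=
  ⟨fun _ _ _ => zero_mem _, fun _ _ _ _ => by simp⟩

theorem add (hD : IsDer e D) (hD' : IsDer e D') : IsDer e (D + D') := by
  refine ⟨fun s v hv => add_mem (hD.map_parity s v hv) (hD'.map_parity s v hv),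
    fun s v hv w => ?_⟩
  simp only [LinearMap.add_apply, hD.leibniz s v hv, hD'.leibniz s v hv, add_mul, mul_add, smul_add]
  abel

/-- The graded commutator of graded derivations is a graded derivation. -/
theorem commutator (hD : IsDer e D) (hD' : IsDer f D') :
    IsDer (e + f) (D * D' - (-1 : ℝ) ^ (e * f) • (D' * D)) := by
  refine ⟨fun s v hv => ?_, fun s v hv w => ?_⟩
  · refine sub_mem ?_ (Submodule.smul_mem _ _ ?_)
    · have := hD.map_parity _ _ (hD'.map_parity _ _ hv)
      rwa [add_assoc, add_comm f] at this
    · have := hD'.map_parity _ _ (hD.map_parity _ _ hv)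
      rwa [add_assoc] at this
  · have h1 := hD'.map_parity s v hv
    have h2 := hD.map_parity s v hv
    simp only [LinearMap.sub_apply, LinearMap.smul_apply, Module.End.mul_apply, hD.leibniz s v hv,
      hD'.leibniz s v hv, map_add, map_smul, hD.leibniz _ _ h1, hD'.leibniz _ _ h2]
    rw [mul_add e, mul_add f, add_mul, neg_one_zpow_add, neg_one_zpow_add, neg_one_zpow_add,
      mul_comm f e]
    -- Every sign is now a product of `(-1)^(es)`, `(-1)^(fs)` and `(-1)^(ef)`. Once their values
    -- are fixed, an additive identity remains.
    rcases neg_one_zpow_eq_or (e * s) with h | h <;>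
      rcases neg_one_zpow_eq_or (f * s) with h' | h' <;>
      rcases neg_one_zpow_eq_or (e * f) with h'' | h'' <;>
      simp only [h, h', h'', one_smul, neg_smul, mul_one, neg_neg, mul_neg, sub_mul, mul_sub, neg_mul] <;>
      abel

/-- A map with the Leibniz rule has a definite parity if its values on generators have. -/
theorem of_gen (hD : ∀ s, ∀ v ∈ parity n M P gh s, ∀ w,
      D (v * w) = D v * w + (-1 : ℝ) ^ (e * s) • (v * D w))
    (h : ∀ x, D (gen x) ∈ parity n M P gh (x.deg + e)) : IsDer e D := by
  refine ⟨fun s v hv => ?_, hD⟩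
  have key : ∀ l : List (Gen n M P gh),
      D (l.map gen).prod ∈ parity n M P gh ((l.map Gen.deg).sum + e) := by
    intro l
    induction l with
    | nil =>
      have : D 1 = 0 := by simpa using hD 0 1 one_mem_parity 1
      simp [this]
    | cons x l ih =>
      simp only [List.map_cons, List.prod_cons, List.sum_cons, hD _ _ (gen_mem_parity x)]
      refine add_mem ?_ (Submodule.smul_mem _ _ ?_)
      · have := mul_mem_parity (h x) (monomial_mem_parity l)
        rwa [add_right_comm] at this
      · have := mul_mem_parity (gen_mem_parity x) ih
        rwa [← add_assoc] at this
  induction hv using Submodule.span_induction with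
  | mem x hx =>
    obtain ⟨l, hl, rfl⟩ := hx
    rw [parity_congr (t := (l.map Gen.deg).sum + e) (by simp only [neg_one_zpow_add, hl])]
    exact key l
  | zero => simp
  | add y z _ _ hy hz => rw [map_add]; exact add_mem hy hz
  | smul c y _ hy => rw [map_smul]; exact Submodule.smul_mem _ c hy

end IsDer

/-- On an element of definite parity the triangular matrix carries the sign-twisted element and the
element itself on the diagonal, with the derivation in the corner. The corner of a product of two
such matrices is the graded Leibniz rule. -/
theorem lift_triangular_apply {e : ℤ} {D : Gen n M P gh → VForm n M P gh}
    (hD : IsDerivationData e D) {s : ℤ} {v : VForm n M P gh} (hv : v ∈ parity n M P gh s) :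
    lift (triangular e D) hD.isFormAssignment v
      = !![(-1 : ℝ) ^ (e * s) • v, derivation e D hD v; 0, v] := by
  have key : ∀ l : List (Gen n M P gh),
      lift (triangular e D) hD.isFormAssignment (l.map gen).prod 0 0
          = (-1 : ℝ) ^ (e * (l.map Gen.deg).sum) • (l.map gen).prod ∧
        lift (triangular e D) hD.isFormAssignment (l.map gen).prod 1 0 = 0 ∧
        lift (triangular e D) hD.isFormAssignment (l.map gen).prod 1 1 = (l.map gen).prod := by
    intro l
    induction l with
    | nil => simp
    | cons x l ih =>
      obtain ⟨h1, h2, h3⟩ := ih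
      simp only [List.map_cons, List.prod_cons, map_mul, lift_gen, Matrix.mul_apply,
        Fin.sum_univ_two, h1, h2, h3]
      simp [triangular, smul_smul, mul_add, neg_one_zpow_add, mul_comm]
  ext i j
  fin_cases i <;> fin_cases j
  · simp only [Fin.zero_eta, Matrix.of_apply, Matrix.cons_val', Matrix.cons_val_zero]
    induction hv using Submodule.span_induction with
    | mem x hx =>
      obtain ⟨l, hl, rfl⟩ := hx
      rw [(key l).1, mul_comm, zpow_mul, hl, ← zpow_mul, mul_comm]
    | zero => simp
    | add y z _ _ hy hz => simp [hy, hz]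
    | smul c y _ hy => simp [hy, smul_comm c]
  · rfl
  · induction hv using Submodule.span_induction with
    | mem x hx =>
      obtain ⟨l, hl, rfl⟩ := hx
      exact (key l).2.1
    | zero => simp
    | add y z _ _ hy hz => simpa using congrArg₂ (· + ·) hy hz
    | smul c y _ hy => simpa using congrArg (c • ·) hy
  · induction hv using Submodule.span_induction with
    | mem x hx =>
      obtain ⟨l, hl, rfl⟩ := hx
      exact (key l).2.2
    | zero => simp
    | add y z _ _ hy hz => simpa using congrArg₂ (· + ·) hy hz
    | smul c y _ hy => simpa using congrArg (c • ·) hy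

theorem isDer_derivation {e : ℤ} {D : Gen n M P gh → VForm n M P gh}
    (hD : IsDerivationData e D) (h : ∀ x, D x ∈ parity n M P gh (x.deg + e)) :
    IsDer e (derivation e D hD) := by
  refine IsDer.of_gen (fun s v hv w => ?_) fun x => by rw [derivation_gen]; exact h x
  induction w using induction_parity with
  | zero => simp
  | add w w' hw hw' => simp only [mul_add, map_add, hw, hw', smul_add]; abel
  | homogeneous t w hw =>
    -- The upper right entry of the product of the two matrices is the Leibniz rule for `v * w`.
    have h1 := congrFun (congrFun (map_mul (lift (triangular e D) hD.isFormAssignment) v w) 0) 1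
    rw [lift_triangular_apply hD hv, lift_triangular_apply hD hw] at h1
    refine h1.trans ?_
    simp [Matrix.mul_apply, add_comm]

theorem isDer_delta : IsDer 1 (delta : Module.End ℝ (VForm n M P gh)) := by
  refine isDer_derivation _ fun x => ?_
  cases x with
  | fn f => simpa [deltaGen, Gen.deg, Gen.vdeg, Gen.ghost] using gen_mem_parity (.dfn f)
  | dfn f => exact zero_mem _
  | fld i D => simpa [deltaGen, Gen.deg, Gen.vdeg, Gen.ghost, add_comm] using gen_mem_parity (.dfld i D)
  | dfld i D => exact zero_mem _

theorem isDer_total (ξ : VF n M) : IsDer 0 (total ξ : Module.End ℝ (VForm n M P gh)) := by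
  refine isDer_derivation _ fun x => ?_
  rw [add_zero]
  cases x with
  | fn f => exact gen_mem_parity (.fn (LocalFn.derive ξ f))
  | dfn f => exact gen_mem_parity (.dfn (LocalFn.derive ξ f))
  | fld i D => exact gen_mem_parity (.fld i (DiffOp.derive ξ D))
  | dfld i D => exact gen_mem_parity (.dfld i (DiffOp.derive ξ D))

/-- The graded commutator of `δ` with itself is `2δ²`. It is a derivation and vanishes on
generators. -/
theorem delta_mul_delta : (delta * delta : Module.End ℝ (VForm n M P gh)) = 0 := by
  have h := (isDer_delta (P := P) (gh := gh) (n := n) (M := M)).commutator isDer_delta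
  have h2 := h.ext IsDer.zero fun x => by
    cases x <;> simp [delta_gen, deltaGen]
  refine LinearMap.ext fun v => ?_
  have h3 : delta (delta v) - (-1 : ℝ) ^ (1 * 1 : ℤ) • delta (delta v) = 0 :=
    LinearMap.congr_fun h2 v
  rw [mul_one, zpow_one, neg_smul, one_smul, sub_neg_eq_add, ← two_smul ℝ] at h3
  exact (smul_eq_zero_iff_right (by norm_num : (2 : ℝ) ≠ 0)).1 h3

theorem commute_delta_total (ξ : VF n M) :
    Commute (delta : Module.End ℝ (VForm n M P gh)) (total ξ) := by
  have h := (isDer_delta (P := P) (gh := gh) (n := n) (M := M)).commutator (isDer_total ξ)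
  have h2 := h.ext IsDer.zero fun x => by
    cases x <;> simp [delta_gen, deltaGen, total_gen, totalGen]
  rw [Commute, SemiconjBy]
  simpa [sub_eq_zero] using h2

theorem total_add (ξ η : VF n M) :
    (total (ξ + η) : Module.End ℝ (VForm n M P gh)) = total ξ + total η := by
  have hf : ∀ f : LocalFn n M P gh, LocalFn.derive (ξ + η) f
      = LocalFn.derive ξ f + LocalFn.derive η f := fun f => rfl
  have hD : ∀ (i : {i : ι // gh i ≠ 0}) (D : DiffOp n M (P i)), DiffOp.derive (ξ + η) D
      = DiffOp.derive ξ D + DiffOp.derive η D := fun i D => rfl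
  refine (isDer_total _).ext ((isDer_total ξ).add (isDer_total η)) fun x => ?_
  cases x <;> simp [total_gen, totalGen, hf, hD, isFormAssignment_gen.fn_add,
    dfn_add, isFormAssignment_gen.fld_add, isFormAssignment_gen.dfld_add]

/-- Flatness of the Cartan connection. Both sides are even derivations, and on generators the
identity is the definition of the commutator of derivations of `C^∞(M)`. -/
theorem total_lie (ξ η : VF n M) :
    (total ⁅ξ, η⁆ : Module.End ℝ (VForm n M P gh)) = total ξ * total η - total η * total ξ := by
  have hf : ∀ f : LocalFn n M P gh, LocalFn.derive ⁅ξ, η⁆ f + LocalFn.derive η (LocalFn.derive ξ f)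
      = LocalFn.derive ξ (LocalFn.derive η f) := fun f =>
    Subtype.ext (funext fun φ => by
      change ⁅ξ, η⁆ (f.1 φ) + η (ξ (f.1 φ)) = ξ (η (f.1 φ))
      rw [Derivation.commutator_apply, sub_add_cancel])
  have hD : ∀ (i : {i : ι // gh i ≠ 0}) (D : DiffOp n M (P i)), DiffOp.derive ⁅ξ, η⁆ D
      + DiffOp.derive η (DiffOp.derive ξ D) = DiffOp.derive ξ (DiffOp.derive η D) := fun i D =>
    Subtype.ext (LinearMap.ext fun s => by
      change ⁅ξ, η⁆ (D.1 s) + η (ξ (D.1 s)) = ξ (η (D.1 s))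
      rw [Derivation.commutator_apply, sub_add_cancel])
  have h := ((isDer_total (P := P) (gh := gh) ξ).commutator (isDer_total η))
  have h2 := (isDer_total (P := P) (gh := gh) ⁅ξ, η⁆).ext h fun x => by
    simp only [mul_zero, zpow_zero, one_smul, LinearMap.sub_apply, Module.End.mul_apply,
      total_gen, eq_sub_iff_add_eq]
    cases x <;> simp only [totalGen, total_gen, ← hf, ← hD, isFormAssignment_gen.fn_add,
      dfn_add, isFormAssignment_gen.fld_add, isFormAssignment_gen.dfld_add]
  simpa using h2

theorem baseFn_mem_deg (a : SmoothFn n M) : (baseFn a : VForm n M P gh) ∈ deg n M P gh 0 0 :=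
  gen_mem_deg (.fn (LocalFn.base a))

theorem baseFn_mem_parity (a : SmoothFn n M) : (baseFn a : VForm n M P gh) ∈ parity n M P gh 0 :=
  gen_mem_parity (.fn (LocalFn.base a))

theorem IsDer.map_baseFn_mul {e : ℤ} {D : Module.End ℝ (VForm n M P gh)} (hD : IsDer e D)
    (a : SmoothFn n M) (v : VForm n M P gh) :
    D (baseFn a * v) = D (baseFn a) * v + baseFn a * D v := by
  simpa using hD.leibniz 0 _ (baseFn_mem_parity a) v

theorem baseFn_mul_comm (a : SmoothFn n M) (v : VForm n M P gh) :
    baseFn a * v = v * baseFn a := by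
  induction v using induction_monomial with
  | zero => simp
  | add v w hv hw => simp [mul_add, add_mul, hv, hw]
  | smul c v hv => simp [hv]
  | monomial l =>
    induction l with
    | nil => simp
    | cons x l ih =>
      have h := isFormAssignment_gen.comm (P := P) (gh := gh) (.fn (LocalFn.base a)) x
      simp only [Gen.deg, Gen.vdeg, Gen.ghost, Nat.cast_zero, zero_add, zero_mul, zpow_zero,
        one_smul] at h
      simp only [List.map_cons, List.prod_cons]
      rw [mul_assoc, ← ih, ← mul_assoc, ← mul_assoc]
      exact congrArg (· * _) h

theorem baseFn_add (a b : SmoothFn n M) : (baseFn (a + b) : VForm n M P gh) = baseFn a + baseFn b :=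
  isFormAssignment_gen.fn_add (LocalFn.base a) (LocalFn.base b)

theorem baseFn_mul (a b : SmoothFn n M) : (baseFn (a * b) : VForm n M P gh) = baseFn a * baseFn b :=
  isFormAssignment_gen.fn_mul (LocalFn.base a) (LocalFn.base b)

theorem baseFn_algebraMap (r : ℝ) :
    (baseFn (algebraMap ℝ _ r) : VForm n M P gh) = algebraMap ℝ _ r :=
  isFormAssignment_gen.fn_const r

theorem delta_baseFn (a : SmoothFn n M) : delta (baseFn a : VForm n M P gh) = 0 :=
  (delta_gen _).trans (isFormAssignment_gen.dfn_base a)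

theorem total_baseFn (ξ : VF n M) (a : SmoothFn n M) :
    total ξ (baseFn a : VForm n M P gh) = baseFn (ξ a) :=
  total_gen _ _

theorem total_smul_apply (a : SmoothFn n M) (ξ : VF n M) (v : VForm n M P gh) :
    total (a • ξ) v = baseFn a * total ξ v := by
  -- Multiplication by a central function of degree zero takes derivations to derivations of the
  -- same parity, so generators suffice. On `dfn` the extra term vanishes because `δ` kills
  -- functions on `M`.
  have hD : IsDer 0 (LinearMap.mulLeft ℝ (baseFn a : VForm n M P gh) * total ξ) := by
    refine ⟨fun s v hv => ?_, fun s v hv w => ?_⟩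
    · have := mul_mem_parity (baseFn_mem_parity a) ((isDer_total ξ).map_parity s v hv)
      rwa [zero_add] at this
    · simp only [Module.End.mul_apply, LinearMap.mulLeft_apply, (isDer_total ξ).leibniz s v hv,
        mul_add, mul_assoc, zero_mul, zpow_zero, one_smul]
      rw [← mul_assoc (baseFn a) v, baseFn_mul_comm a v, mul_assoc]
  have hf : ∀ f : LocalFn n M P gh, LocalFn.derive (a • ξ) f
      = LocalFn.base a * LocalFn.derive ξ f := fun f => rfl
  have hDf : ∀ (i : {i : ι // gh i ≠ 0}) (D : DiffOp n M (P i)), DiffOp.derive (a • ξ) D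
      = a • DiffOp.derive ξ D := fun i D => rfl
  have h := (isDer_total (P := P) (gh := gh) (a • ξ)).ext hD fun x => by
    cases x <;> simp [total_gen, totalGen, hf, hDf, isFormAssignment_gen.fn_mul, dfn_mul,
      isFormAssignment_gen.dfn_base, isFormAssignment_gen.fld_smul,
      isFormAssignment_gen.dfld_smul, baseFn]
  exact LinearMap.congr_fun h v

theorem map_deg_of_gen {e : ℤ} {D : Module.End ℝ (VForm n M P gh)} (hD : IsDer e D) {j : ℕ} {k : ℤ}
    (h : ∀ x : Gen n M P gh, D (gen x) ∈ deg n M P gh (x.vdeg + j) (x.ghost + k))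
    {p : ℕ} {r : ℤ} {v : VForm n M P gh} (hv : v ∈ deg n M P gh p r) :
    D v ∈ deg n M P gh (p + j) (r + k) := by
  induction hv using Submodule.span_induction with
  | mem x hx =>
    obtain ⟨l, rfl, rfl, rfl⟩ := hx
    induction l with
    | nil => simp [hD.map_one]
    | cons x l ih =>
      simp only [List.map_cons, List.prod_cons, List.sum_cons, hD.leibniz _ _ (gen_mem_parity x)]
      refine add_mem ?_ (Submodule.smul_mem _ _ ?_)
      · have := mul_mem_deg (h x) (monomial_mem_deg l)
        rwa [add_right_comm, add_right_comm x.ghost] at this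
      · have := mul_mem_deg (gen_mem_deg x) ih
        rwa [← add_assoc, ← add_assoc] at this
  | zero => simp
  | add y z _ _ hy hz => rw [map_add]; exact add_mem hy hz
  | smul c y _ hy => rw [map_smul]; exact Submodule.smul_mem _ c hy

theorem delta_mem_deg {p : ℕ} {r : ℤ} {v : VForm n M P gh} (hv : v ∈ deg n M P gh p r) :
    delta v ∈ deg n M P gh (p + 1) r := by
  have := map_deg_of_gen isDer_delta (j := 1) (k := 0) (fun x => ?_) hv
  · rwa [add_zero] at this
  rw [delta_gen, add_zero]
  cases x with
  | fn f => exact gen_mem_deg (.dfn f)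
  | dfn f => exact zero_mem _
  | fld i D => exact gen_mem_deg (.dfld i D)
  | dfld i D => exact zero_mem _

theorem total_mem_deg (ξ : VF n M) {p : ℕ} {r : ℤ} {v : VForm n M P gh}
    (hv : v ∈ deg n M P gh p r) : total ξ v ∈ deg n M P gh p r := by
  have := map_deg_of_gen (isDer_total ξ) (j := 0) (k := 0) (fun x => ?_) hv
  · rwa [add_zero, add_zero] at this
  rw [total_gen, add_zero, add_zero]
  cases x with
  | fn f => exact gen_mem_deg (.fn (LocalFn.derive ξ f))
  | dfn f => exact gen_mem_deg (.dfn (LocalFn.derive ξ f))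
  | fld i D => exact gen_mem_deg (.fld i (DiffOp.derive ξ D))
  | dfld i D => exact gen_mem_deg (.dfld i (DiffOp.derive ξ D))

/-! ### Restriction to the zero section -/

/-- Pullback to `J^∞E` of the restriction to the zero section. -/
def zeroPart : Module.End ℝ (VForm n M P gh) where
  toFun v := baseFn (zeroSection v)
  map_add' v w := by rw [map_add, baseFn_add]
  map_smul' c v := by
    rw [map_smul, Algebra.smul_def, baseFn_mul, baseFn_algebraMap, RingHom.id_apply,
      ← Algebra.smul_def]

theorem zeroSection_baseFn (a : SmoothFn n M) : zeroSection (baseFn a : VForm n M P gh) = a :=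
  lift_gen _ _ _

theorem zeroSection_gen (x : Gen n M P gh) : zeroSection (gen x) = zeroSectionGen x :=
  lift_gen _ _ _

/-- The zero section consists of the jets of the zero field, so total derivatives are tangent to it.
This is why passing to the flat part commutes with `d`. -/
theorem zeroSection_total (ξ : VF n M) (v : VForm n M P gh) :
    zeroSection (total ξ v) = ξ (zeroSection v) := by
  induction v using induction_monomial with
  | zero => simp
  | add v w hv hw => simp [hv, hw]
  | smul c v hv => simp [hv]
  | monomial l =>
    induction l with
    | nil => simp [(isDer_total ξ).map_one]
    | cons x l ih =>
      have hx : zeroSection (total ξ (gen x)) = ξ (zeroSection (gen x)) := by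
        rw [total_gen, zeroSection_gen]
        cases x
        · exact zeroSection_gen _
        · exact (zeroSection_gen _).trans (map_zero ξ).symm
        · exact (zeroSection_gen _).trans (map_zero ξ).symm
        · exact (zeroSection_gen _).trans (map_zero ξ).symm
      simp only [List.map_cons, List.prod_cons, (isDer_total ξ).leibniz _ _ (gen_mem_parity x),
        map_add, map_mul, ih, hx, Derivation.leibniz, zero_mul, zpow_zero, one_smul, smul_eq_mul]
      ring

theorem zeroPart_total (ξ : VF n M) (v : VForm n M P gh) :
    zeroPart (total ξ v) = total ξ (zeroPart v) := by
  change baseFn _ = total ξ (baseFn _)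
  rw [zeroSection_total, total_baseFn]

/-- A monomial of nonzero ghost number contains a generator of nonzero ghost number, and that
generator vanishes on the zero section. Hence only ghost number zero contributes, where functions on
`M` live. -/
theorem zeroPart_mem_deg {r : ℤ} {v : VForm n M P gh} (hv : v ∈ deg n M P gh 0 r) :
    zeroPart v ∈ deg n M P gh 0 r := by
  by_cases hr : r = 0
  · subst hr; exact baseFn_mem_deg _
  have : zeroSection v = 0 := by
    induction hv using Submodule.span_induction with
    | mem x hx =>
      obtain ⟨l, -, h, rfl⟩ := hx
      rw [map_list_prod, List.map_map]
      obtain ⟨x, hx, h'⟩ : ∃ x ∈ l, x.ghost ≠ 0 := by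
        by_contra! hc
        exact hr (h ▸ List.sum_eq_zero (by simpa using hc))
      refine List.prod_eq_zero (List.mem_map.2 ⟨x, hx, (zeroSection_gen x).trans ?_⟩)
      cases x <;> first | rfl | exact absurd rfl h'
    | zero => simp
    | add y z _ _ hy hz => simp [hy, hz]
    | smul c y _ hy => simp [hy]
  have h2 : zeroPart v = baseFn (zeroSection v) := rfl
  rw [h2, this]
  have h0 := baseFn_algebraMap (P := P) (gh := gh) (n := n) (M := M) 0
  rw [map_zero, map_zero] at h0
  rw [h0]; exact zero_mem _

end VForm

/-! ### Cartan calculus for the horizontal differential -/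

namespace Cochain
open VForm

/-- Insertion of a vector field in the first slot. -/
def ins {q : ℕ} (ξ : VF n M) : Cochain n M P gh (q + 1) →ₗ[ℝ] Cochain n M P gh q where
  toFun α η := α (Fin.cons ξ η)
  map_add' _ _ := rfl
  map_smul' _ _ := rfl

/-- Multiplication by a function on `M`. -/
def baseMul {q : ℕ} (a : SmoothFn n M) : Cochain n M P gh q →ₗ[ℝ] Cochain n M P gh q :=
  (LinearMap.mulLeft ℝ (baseFn a : VForm n M P gh)).compLeft _

/-- The Lie derivative of cochains along a vector field on `M`. -/
def lieH {q : ℕ} (ξ : VF n M) : Cochain n M P gh q →ₗ[ℝ] Cochain n M P gh q where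
  toFun α η := total ξ (α η) - ∑ j, α (Function.update η j ⁅ξ, η j⁆)
  map_add' α β := by
    funext η
    simp only [Pi.add_apply, map_add, Finset.sum_add_distrib]
    abel
  map_smul' c α := by
    funext η
    simp only [Pi.smul_apply, map_smul, RingHom.id_apply, smul_sub, Finset.smul_sum]

theorem ins_apply {q : ℕ} (ξ : VF n M) (α : Cochain n M P gh (q + 1)) (η : Fin q → VF n M) :
    ins ξ α η = α (Fin.cons ξ η) := rfl

theorem lieH_apply {q : ℕ} (ξ : VF n M) (α : Cochain n M P gh q) (η : Fin q → VF n M) :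
    lieH ξ α η = total ξ (α η) - ∑ j, α (Function.update η j ⁅ξ, η j⁆) := rfl

theorem baseMul_apply {q : ℕ} (a : SmoothFn n M) (α : Cochain n M P gh q) (η : Fin q → VF n M) :
    baseMul a α η = baseFn a * α η := rfl

/-- The induction step for identities between cochains. In `horD_horD` and `isForm_horD` the
explicit formula for `horD` enters only through `ins_horD_zero` and `ins_horD`. -/
theorem ext_ins {q : ℕ} {α β : Cochain n M P gh (q + 1)} (h : ∀ ξ, ins ξ α = ins ξ β) : α = β := by
  funext η
  rw [← Fin.cons_self_tail η]
  exact congrFun (h (η 0)) (Fin.tail η)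

theorem ins_baseMul {q : ℕ} (a : SmoothFn n M) (ξ : VF n M) (α : Cochain n M P gh (q + 1)) :
    ins ξ (baseMul a α) = baseMul a (ins ξ α) := rfl

theorem ins_lieH {q : ℕ} (ξ η : VF n M) (α : Cochain n M P gh (q + 1)) :
    ins η (lieH ξ α) = lieH ξ (ins η α) - ins ⁅ξ, η⁆ α := by
  funext ζ
  simp only [ins_apply, lieH_apply, Pi.sub_apply, Fin.sum_univ_succ, Fin.cons_zero, Fin.cons_succ,
    Fin.update_cons_zero, ← Fin.cons_update]
  abel

theorem ins_horD_zero (ξ : VF n M) (α : Cochain n M P gh 0) : ins ξ (horD α) = lieH ξ α := by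
  funext ζ
  simp only [ins_apply, lieH_apply, horD, LinearMap.coe_mk, AddHom.coe_mk, Finset.univ_eq_empty,
    Finset.sum_empty, sub_zero]
  simp [Subsingleton.elim _ ζ]

/-- Cartan's formula. With `ξ` in the first slot, the summand `i = 0` of `horD` is the Lie
derivative, and the others, shifted by one place, are the summands of `horD (ins ξ α)` with the
opposite sign. -/
theorem ins_horD {q : ℕ} (ξ : VF n M) (α : Cochain n M P gh (q + 1)) :
    ins ξ (horD α) = lieH ξ α - horD (ins ξ α) := by
  funext ζ
  simp only [ins_apply, lieH_apply, Pi.sub_apply, horD, LinearMap.coe_mk, AddHom.coe_mk]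
  refine (Fin.sum_univ_succ _).trans (Eq.trans (congrArg₂ (· + ·) ?_ ?_) (sub_eq_add_neg _ _).symm)
  · simp
  · rw [← Finset.sum_neg_distrib]
    refine Finset.sum_congr rfl fun i _ => ?_
    have h1 : (fun k => (Fin.cons ξ ζ : Fin (q + 2) → VF n M) (i.succ.succAbove k))
        = Fin.cons ξ fun k => ζ (i.succAbove k) := by
      funext k
      refine Fin.cases ?_ (fun k => ?_) k <;> simp
    rw [Fin.sum_univ_succ]
    -- The bracket stands in the place of the later of the two fields, so for `i > 0` the slot of
    -- `ξ` contributes no term.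
    have h2 : ¬ i.succ ≤ (0 : Fin (q + 1)).castSucc := by simp
    simp only [h1, h2, if_false, zero_add, Fin.cons_succ, Fin.val_succ, pow_succ, mul_neg, mul_one,
      neg_smul, Fin.succ_succAbove_succ, ← Fin.cons_update, ← Fin.succ_castSucc, Fin.succ_le_succ_iff]

theorem lieH_baseMul {q : ℕ} (a : SmoothFn n M) (ξ : VF n M) (α : Cochain n M P gh q) :
    lieH ξ (baseMul a α) = baseMul (ξ a) α + baseMul a (lieH ξ α) := by
  funext ζ
  simp only [lieH_apply, baseMul_apply, Pi.add_apply, (isDer_total ξ).map_baseFn_mul, total_baseFn,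
    mul_sub, Finset.mul_sum]
  abel

theorem add_lie_vf (ξ η ζ : VF n M) : ⁅ξ + η, ζ⁆ = ⁅ξ, ζ⁆ + ⁅η, ζ⁆ := by
  ext1 b
  simp only [Derivation.commutator_apply, Derivation.add_apply, map_add]
  ring

theorem lie_vf_add (ξ η ζ : VF n M) : ⁅ξ, η + ζ⁆ = ⁅ξ, η⁆ + ⁅ξ, ζ⁆ := by
  ext1 b
  simp only [Derivation.commutator_apply, Derivation.add_apply, map_add]
  ring

theorem lie_lie_vf (ξ η ζ : VF n M) : ⁅⁅ξ, η⁆, ζ⁆ = ⁅ξ, ⁅η, ζ⁆⁆ - ⁅η, ⁅ξ, ζ⁆⁆ := by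
  ext1 b
  simp only [Derivation.commutator_apply, Derivation.sub_apply, map_sub]
  ring

theorem lieH_add {q : ℕ} {p : ℕ} {r : ℤ} (ξ η : VF n M) {α : Cochain n M P gh q}
    (hα : IsForm p r α) : lieH (ξ + η) α = lieH ξ α + lieH η α := by
  funext ζ
  simp only [lieH_apply, Pi.add_apply, add_lie_vf, hα.map_update_add, Finset.sum_add_distrib,
    total_add, LinearMap.add_apply]
  abel

theorem isForm_ins {q p : ℕ} {r : ℤ} (ξ : VF n M) {α : Cochain n M P gh (q + 1)}
    (hα : IsForm p r α) : IsForm p r (ins ξ α) := by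
  refine ⟨fun ζ i η η' => ?_, fun ζ i a η => ?_, fun ζ i j hij h => ?_, fun ζ => hα.mem_deg _⟩
  · simp only [ins_apply, Fin.cons_update, hα.map_update_add]
  · simp only [ins_apply, Fin.cons_update, hα.map_update_smul]
  · exact hα.map_eq_zero_of_eq _ i.succ j.succ (by simpa using hij) (by simpa using h)

theorem ins_add {q p : ℕ} {r : ℤ} (ξ η : VF n M) {α : Cochain n M P gh (q + 1)}
    (hα : IsForm p r α) : ins (ξ + η) α = ins ξ α + ins η α := by
  funext ζ
  have h := hα.map_update_add (Fin.cons 0 ζ) 0 ξ η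
  simp only [Fin.update_cons_zero] at h
  exact h

theorem ins_smul {q p : ℕ} {r : ℤ} (a : SmoothFn n M) (ξ : VF n M) {α : Cochain n M P gh (q + 1)}
    (hα : IsForm p r α) : ins (a • ξ) α = baseMul a (ins ξ α) := by
  funext ζ
  have h := hα.map_update_smul (Fin.cons 0 ζ) 0 a ξ
  simp only [Fin.update_cons_zero] at h
  exact h

theorem ins_sub {q p : ℕ} {r : ℤ} (ξ η : VF n M) {α : Cochain n M P gh (q + 1)}
    (hα : IsForm p r α) : ins (ξ - η) α = ins ξ α - ins η α := by
  rw [eq_sub_iff_add_eq, ← ins_add _ _ hα, sub_add_cancel]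

theorem ins_ins_self {q p : ℕ} {r : ℤ} (ξ : VF n M) {α : Cochain n M P gh (q + 2)}
    (hα : IsForm p r α) : ins ξ (ins ξ α) = 0 := by
  funext ζ
  exact hα.map_eq_zero_of_eq _ 0 1 (by simp) (by simp)

theorem ins_ins_comm {q p : ℕ} {r : ℤ} (ξ η : VF n M) {α : Cochain n M P gh (q + 2)}
    (hα : IsForm p r α) : ins ξ (ins η α) = -ins η (ins ξ α) := by
  have h := ins_ins_self (ξ + η) hα
  rw [ins_add _ _ hα, map_add, ins_add _ _ (isForm_ins ξ hα), ins_add _ _ (isForm_ins η hα),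
    ins_ins_self ξ hα, ins_ins_self η hα, zero_add, add_zero, add_comm] at h
  exact eq_neg_of_add_eq_zero_left h

theorem isForm_zero_iff {p : ℕ} {r : ℤ} {α : Cochain n M P gh 0} :
    IsForm p r α ↔ ∀ ζ, α ζ ∈ deg n M P gh p r :=
  ⟨fun h => h.mem_deg, fun h => ⟨fun _ i => i.elim0, fun _ i => i.elim0, fun _ i => i.elim0, h⟩⟩

theorem isForm_succ {q p : ℕ} {r : ℤ} {α : Cochain n M P gh (q + 1)}
    (hα : ∀ ξ, IsForm p r (ins ξ α)) (hadd : ∀ ξ η, ins (ξ + η) α = ins ξ α + ins η α)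
    (hsmul : ∀ (a : SmoothFn n M) ξ, ins (a • ξ) α = baseMul a (ins ξ α))
    (halt : ∀ (ξ : VF n M) (ζ : Fin q → VF n M) (i : Fin q), ζ i = ξ → ins ξ α ζ = 0) :
    IsForm p r α := by
  refine ⟨fun ζ i η η' => ?_, fun ζ i a η => ?_, fun ζ i j hij h => ?_, fun ζ => ?_⟩
  · rw [← Fin.cons_self_tail ζ]
    refine Fin.cases ?_ (fun i => ?_) i
    · simp only [Fin.update_cons_zero]
      exact congrFun (hadd η η') _
    · simp only [← Fin.cons_update]
      exact (hα _).map_update_add _ i η η'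
  · rw [← Fin.cons_self_tail ζ]
    refine Fin.cases ?_ (fun i => ?_) i
    · simp only [Fin.update_cons_zero]
      exact congrFun (hsmul a η) _
    · simp only [← Fin.cons_update]
      exact (hα _).map_update_smul _ i a η
  · rw [← Fin.cons_self_tail ζ] at h ⊢
    induction i using Fin.cases with
    | zero =>
      induction j using Fin.cases with
      | zero => exact absurd rfl hij
      | succ j => exact halt _ _ j h.symm
    | succ i =>
      induction j using Fin.cases with
      | zero => exact halt _ _ i h
      | succ j => exact (hα _).map_eq_zero_of_eq _ i j (fun e => hij (by rw [e])) h
  · rw [← Fin.cons_self_tail ζ]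
    exact (hα _).mem_deg _

theorem isForm_one {p : ℕ} {r : ℤ} {α : Cochain n M P gh 1}
    (hα : ∀ ξ, IsForm p r (ins ξ α)) (hadd : ∀ ξ η, ins (ξ + η) α = ins ξ α + ins η α)
    (hsmul : ∀ (a : SmoothFn n M) ξ, ins (a • ξ) α = baseMul a (ins ξ α)) : IsForm p r α :=
  isForm_succ hα hadd hsmul fun _ _ i => i.elim0

/-- Alternation has to be checked only for the first two slots: by polarization it gives
antisymmetry in them. If the field equal to `ξ` stands further back, swapping the first two slots
places both equal fields in the arguments of a cochain `ins (ζ 0) α`, which is already a form. -/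
theorem isForm_add_two {q p : ℕ} {r : ℤ} {α : Cochain n M P gh (q + 2)}
    (hα : ∀ ξ, IsForm p r (ins ξ α)) (hadd : ∀ ξ η, ins (ξ + η) α = ins ξ α + ins η α)
    (hsmul : ∀ (a : SmoothFn n M) ξ, ins (a • ξ) α = baseMul a (ins ξ α))
    (halt : ∀ ξ, ins ξ (ins ξ α) = 0) : IsForm p r α := by
  have hanti : ∀ ξ η, ins ξ (ins η α) = -ins η (ins ξ α) := fun ξ η => by
    have h := halt (ξ + η)
    rw [hadd, map_add, ins_add _ _ (hα ξ), ins_add _ _ (hα η), halt, halt, zero_add, add_zero,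
      add_comm] at h
    exact eq_neg_of_add_eq_zero_left h
  refine isForm_succ hα hadd hsmul fun ξ ζ i h => ?_
  rw [← Fin.cons_self_tail ζ] at h ⊢
  induction i using Fin.cases with
  | zero =>
    obtain rfl : ζ 0 = ξ := h
    exact congrFun (halt _) _
  | succ i =>
    have h2 := congrFun (hanti (ζ 0) ξ) (Fin.tail ζ)
    refine h2.trans ?_
    rw [Pi.neg_apply, neg_eq_zero]
    exact (hα (ζ 0)).map_eq_zero_of_eq _ 0 i.succ (Fin.succ_ne_zero i).symm h.symm

theorem isForm_sub {q p : ℕ} {r : ℤ} {α β : Cochain n M P gh q} (hα : IsForm p r α)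
    (hβ : IsForm p r β) : IsForm p r (α - β) :=
  (forms q p r).sub_mem hα hβ

theorem lie_smul_right (a : SmoothFn n M) (ξ η : VF n M) : ⁅ξ, a • η⁆ = ξ a • η + a • ⁅ξ, η⁆ := by
  ext1 b
  simp only [Derivation.commutator_apply, Derivation.add_apply, Derivation.smul_apply,
    Derivation.leibniz, smul_eq_mul]
  ring

theorem lie_smul_left (a : SmoothFn n M) (ξ η : VF n M) : ⁅a • ξ, η⁆ = a • ⁅ξ, η⁆ - η a • ξ := by
  ext1 b
  simp only [Derivation.commutator_apply, Derivation.sub_apply, Derivation.smul_apply,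
    Derivation.leibniz, smul_eq_mul]
  ring

theorem isForm_lieH {p : ℕ} {r : ℤ} (ξ : VF n M) : ∀ {q : ℕ} {α : Cochain n M P gh q},
    IsForm p r α → IsForm p r (lieH ξ α) := by
  intro q
  induction q with
  | zero =>
    intro α hα
    rw [isForm_zero_iff]
    intro ζ
    simpa [lieH_apply] using total_mem_deg ξ (hα.mem_deg ζ)
  | succ q ih =>
    intro α hα
    have h1 : ∀ η, IsForm p r (ins η (lieH ξ α)) := fun η => by
      rw [ins_lieH]
      exact isForm_sub (ih (isForm_ins η hα)) (isForm_ins _ hα)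
    have h2 : ∀ η η', ins (η + η') (lieH ξ α) = ins η (lieH ξ α) + ins η' (lieH ξ α) :=
      fun η η' => by
        simp only [ins_lieH, ins_add _ _ hα, lie_vf_add, map_add]
        abel
    have h3 : ∀ (a : SmoothFn n M) η, ins (a • η) (lieH ξ α) = baseMul a (ins η (lieH ξ α)) :=
      fun a η => by
        simp only [ins_lieH, ins_smul _ _ hα, lie_smul_right, ins_add _ _ hα, lieH_baseMul, map_sub]
        abel
    cases q with
    | zero => exact isForm_one h1 h2 h3
    | succ q =>
      refine isForm_add_two h1 h2 h3 fun η => ?_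
      rw [ins_lieH, map_sub, ins_lieH, ins_ins_self η hα, map_zero, zero_sub,
        ins_ins_comm _ _ hα, neg_neg, sub_self]

theorem lieH_lie {p : ℕ} {r : ℤ} (ξ η : VF n M) : ∀ {q : ℕ} {α : Cochain n M P gh q},
    IsForm p r α → lieH ⁅ξ, η⁆ α = lieH ξ (lieH η α) - lieH η (lieH ξ α) := by
  intro q
  induction q with
  | zero =>
    intro α hα
    funext ζ
    simp [lieH_apply, total_lie]
  | succ q ih =>
    intro α hα
    refine ext_ins fun ζ => ?_
    have hj : ins ⁅⁅ξ, η⁆, ζ⁆ α = ins ⁅ξ, ⁅η, ζ⁆⁆ α - ins ⁅η, ⁅ξ, ζ⁆⁆ α := by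
      rw [← ins_sub _ _ hα, lie_lie_vf]
    simp only [ins_lieH, map_sub, ih (isForm_ins ζ hα), hj]
    abel

theorem lieH_horD {p : ℕ} {r : ℤ} (ξ : VF n M) : ∀ {q : ℕ} {α : Cochain n M P gh q},
    IsForm p r α → lieH ξ (horD α) = horD (lieH ξ α) := by
  intro q
  induction q with
  | zero =>
    intro α hα
    refine ext_ins fun η => ?_
    rw [ins_lieH, ins_horD_zero, ins_horD_zero, ins_horD_zero, lieH_lie ξ η hα]
    abel
  | succ q ih =>
    intro α hα
    refine ext_ins fun η => ?_
    simp only [ins_lieH, ins_horD, map_sub, lieH_lie ξ η hα, ih (isForm_ins η hα)]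
    abel

/-- `d² = 0`. -/
theorem horD_horD {p : ℕ} {r : ℤ} : ∀ {q : ℕ} {α : Cochain n M P gh q},
    IsForm p r α → horD (horD α) = 0 := by
  intro q
  induction q with
  | zero =>
    intro α hα
    refine ext_ins fun ξ => ?_
    rw [ins_horD, ins_horD_zero, lieH_horD ξ hα, sub_self, map_zero]
  | succ q ih =>
    intro α hα
    refine ext_ins fun ξ => ?_
    rw [ins_horD, ins_horD, map_sub, ih (isForm_ins ξ hα), lieH_horD ξ hα, sub_zero, sub_self,
      map_zero]

theorem lieH_smul_zero (a : SmoothFn n M) (ξ : VF n M) (α : Cochain n M P gh 0) :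
    lieH (a • ξ) α = baseMul a (lieH ξ α) := by
  funext ζ
  simp [lieH_apply, baseMul_apply, total_smul_apply]

/-- This is `L_{aξ} = a L_ξ + da ∧ i_ξ`, with `da ∧ β` written as `d(aβ) - a dβ` to avoid wedge
products. -/
theorem lieH_smul {p : ℕ} {r : ℤ} (a : SmoothFn n M) (ξ : VF n M) :
    ∀ {q : ℕ} {α : Cochain n M P gh (q + 1)}, IsForm p r α →
      lieH (a • ξ) α = baseMul a (lieH ξ α) + horD (baseMul a (ins ξ α))
        - baseMul a (horD (ins ξ α)) := by
  intro q
  induction q with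
  | zero =>
    intro α hα
    refine ext_ins fun η => ?_
    simp only [map_add, map_sub, ins_lieH, ins_baseMul, ins_horD_zero, lieH_smul_zero,
      lieH_baseMul, lie_smul_left, ins_sub _ _ hα, ins_smul _ _ hα]
    abel
  | succ q ih =>
    intro α hα
    refine ext_ins fun η => ?_
    simp only [map_add, map_sub, ins_lieH, ins_baseMul, ins_horD, ih (isForm_ins η hα),
      lieH_baseMul, lie_smul_left, ins_sub _ _ hα, ins_smul _ _ hα, ins_ins_comm η ξ hα, map_neg]
    abel

/-- The horizontal differential of a form is a form. -/
theorem isForm_horD {p : ℕ} {r : ℤ} : ∀ {q : ℕ} {α : Cochain n M P gh q},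
    IsForm p r α → IsForm p r (horD α) := by
  intro q
  induction q with
  | zero =>
    intro α hα
    refine isForm_one (fun ξ => ?_) (fun ξ η => ?_) fun a ξ => ?_
    · rw [ins_horD_zero]; exact isForm_lieH ξ hα
    · simp only [ins_horD_zero, lieH_add _ _ hα]
    · simp only [ins_horD_zero, lieH_smul_zero]
  | succ q ih =>
    intro α hα
    refine isForm_add_two (fun ξ => ?_) (fun ξ η => ?_) (fun a ξ => ?_) fun ξ => ?_
    · rw [ins_horD]; exact isForm_sub (isForm_lieH ξ hα) (ih (isForm_ins ξ hα))
    · simp only [ins_horD, lieH_add _ _ hα, ins_add _ _ hα, map_add]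
      abel
    · simp only [ins_horD, lieH_smul _ _ hα, ins_smul _ _ hα, map_sub]
      abel
    -- Both terms of `ins ξ (ins ξ (horD α))` become `lieH ξ (ins ξ α)`: the first because `⁅ξ, ξ⁆ =
    -- 0`, the second by Cartan's formula and `ins_ins_self`.
    · have h0 : ins (0 : VF n M) α = 0 := by simpa using ins_sub (0 : VF n M) 0 hα
      rw [ins_horD, map_sub, ins_lieH, lie_self, h0, sub_zero]
      cases q with
      | zero => rw [ins_horD_zero, sub_self]
      | succ q => rw [ins_horD, ins_ins_self ξ hα, map_zero, sub_zero, sub_self]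

/-- `d` acts on the values of a cochain only through total derivatives and linear combinations.
Commutation of `d` with contractions, with `δ` and with the flat part all reduce to this. -/
theorem horD_compLeft {q : ℕ} {T : Module.End ℝ (VForm n M P gh)}
    (hT : ∀ ξ v, T (total ξ v) = total ξ (T v)) (α : Cochain n M P gh q) :
    horD (T.compLeft _ α) = T.compLeft _ (horD α) := by
  funext ζ
  simp only [horD, LinearMap.coe_mk, AddHom.coe_mk, LinearMap.compLeft_apply, Function.comp_apply, map_sum, map_smul, map_sub, hT]
  refine Finset.sum_congr rfl fun i _ => congrArg _ (congrArg _ ?_)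
  refine Finset.sum_congr rfl fun j _ => ?_
  split_ifs <;> simp

theorem isForm_compLeft {q p p' : ℕ} {r r' : ℤ} {T : Module.End ℝ (VForm n M P gh)}
    (hT : ∀ a v, T (baseFn a * v) = baseFn a * T v)
    (hdeg : ∀ v ∈ deg n M P gh p r, T v ∈ deg n M P gh p' r') {α : Cochain n M P gh q}
    (hα : IsForm p r α) : IsForm p' r' (T.compLeft _ α) := by
  refine ⟨fun ζ i η η' => ?_, fun ζ i a η => ?_, fun ζ i j hij h => ?_, fun ζ => ?_⟩
  · simp [hα.map_update_add]
  · simp [hα.map_update_smul, hT]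
  · simp [hα.map_eq_zero_of_eq ζ i j hij h]
  · exact hdeg _ (hα.mem_deg ζ)

end Cochain

/-! ### Evolutionary vector fields and their brackets -/

open VForm

theorem contr_eq {q : ℕ} (k : ℤ) (X : Module.End ℝ (VForm n M P gh)) (α : Cochain n M P gh q) :
    contr k X α = (-1 : ℝ) ^ (q * (k - 1)) • X.compLeft _ α := rfl

theorem verD_eq {q : ℕ} (α : Cochain n M P gh q) :
    verD α = (-1 : ℝ) ^ q • (delta : Module.End ℝ (VForm n M P gh)).compLeft _ α := rfl

/-- Raising the horizontal degree by one changes the sign of a contraction by `-(-1)^k`. This is the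
sign in the evolutionary condition, so that condition amounts to commuting with total derivatives.
-/
theorem contr_sign (q : ℕ) (k : ℤ) : (-1 : ℝ) ^ (((q + 1 : ℕ) : ℤ) * (k - 1))
    = -((-1 : ℝ) ^ k * (-1 : ℝ) ^ (q * (k - 1))) := by
  rw [Nat.cast_succ, add_mul, one_mul, neg_one_zpow_add, neg_one_zpow_sub_one]
  ring

namespace IsEvolutionary

variable {k l : ℤ} {X Y : Module.End ℝ (VForm n M P gh)}

theorem isDer (hX : IsEvolutionary k X) : IsDer (k - 1) X := by
  refine IsDer.of_gen (fun s v hv w => ?_) fun x => ?_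
  · induction hv using Submodule.span_induction with
    | mem v hv =>
      obtain ⟨l, hl, rfl⟩ := hv
      rw [hX.leibniz _ _ _ (monomial_mem_deg l), ← sum_deg, mul_comm, zpow_mul, hl, ← zpow_mul,
        mul_comm]
    | zero => simp
    | add y z _ _ hy hz => simp only [add_mul, map_add, hy, hz, smul_add]; abel
    | smul c y _ hy => simp only [smul_mul_assoc, map_smul, hy, smul_add, smul_comm c]
  · have h : ∀ p r, ∀ v ∈ deg n M P gh p r, X v ∈ parity n M P gh (p + r + (k - 1)) := by
      intro p r v hv
      cases p with
      | zero => rw [hX.map_fn _ _ hv]; exact zero_mem _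
      | succ p =>
        have e : (((p + 1 : ℕ) : ℤ) + r + (k - 1)) = p + (r + k) := by push_cast; ring
        rw [e]
        exact deg_le_parity _ _ (hX.map_deg _ _ _ hv)
    exact h _ _ _ (gen_mem_deg x)

/-- A monomial `v` is a form of horizontal degree zero, and its horizontal differential has the
value `total ξ v` at `ξ`. The evolutionary condition in this lowest degree is the claim. -/
theorem total_apply (hX : IsEvolutionary k X) (ξ : VF n M) (v : VForm n M P gh) :
    X (total ξ v) = total ξ (X v) := by
  induction v using induction_monomial with
  | zero => simp
  | add v w hv hw => simp [hv, hw]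
  | smul c v hv => simp [hv]
  | monomial l =>
    have h := hX.evolutionary 0 _ _ (fun _ => (l.map gen).prod)
      (Cochain.isForm_zero_iff.2 fun _ => monomial_mem_deg l)
    rw [contr_eq, contr_eq, contr_sign, map_smul, smul_smul, neg_smul, neg_add_eq_zero] at h
    have h0 : ((-1 : ℝ) ^ k * (-1 : ℝ) ^ (((0 : ℕ) : ℤ) * (k - 1))) ≠ 0 := by
      simp only [ne_eq, mul_eq_zero, not_or]
      exact ⟨zpow_ne_zero _ (by norm_num), zpow_ne_zero _ (by norm_num)⟩
    have h2 := congrFun (smul_right_injective _ h0 h) fun _ => ξ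
    simpa [horD] using h2

/-- Converse of `total_apply`: commuting with total derivatives in the algebra of vertical forms
gives the evolutionary condition in all horizontal degrees. It is the criterion applied to brackets.
-/
theorem of_isDer (hX : IsDer (k - 1) X) (h0 : ∀ r, ∀ f ∈ deg n M P gh 0 r, X f = 0)
    (hdeg : ∀ p r, ∀ v ∈ deg n M P gh (p + 1) r, X v ∈ deg n M P gh p (r + k))
    (htot : ∀ ξ v, X (total ξ v) = total ξ (X v)) : IsEvolutionary k X := by
  refine ⟨h0, hdeg, fun p r v hv w => hX.leibniz _ v (deg_le_parity p r hv) w,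
    fun q p r α hα => ?_⟩
  rw [contr_eq, contr_eq, map_smul, Cochain.horD_compLeft htot, contr_sign, smul_smul, neg_smul,
    neg_add_cancel]

theorem isDer_lieV (hX : IsEvolutionary k X) : IsDer k (lieV k X) := by
  have h := hX.isDer.commutator isDer_delta
  rw [mul_one, sub_add_cancel] at h
  have e : lieV k X = X * delta - (-1 : ℝ) ^ (k - 1) • (delta * X) := by
    refine LinearMap.ext fun v => ?_
    simp [lieV, neg_one_zpow_sub_one]
  rwa [e]

theorem lieV_apply (k : ℤ) (X : Module.End ℝ (VForm n M P gh)) (v : VForm n M P gh) :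
    lieV k X v = X (delta v) + (-1 : ℝ) ^ k • delta (X v) := rfl

theorem delta_delta (v : VForm n M P gh) : delta (delta v) = 0 :=
  LinearMap.congr_fun delta_mul_delta v

theorem delta_total (ξ : VF n M) (v : VForm n M P gh) : delta (total ξ v) = total ξ (delta v) :=
  LinearMap.congr_fun (commute_delta_total ξ) v

theorem lieV_total (hX : IsEvolutionary k X) (ξ : VF n M) (v : VForm n M P gh) :
    lieV k X (total ξ v) = total ξ (lieV k X v) := by
  simp only [lieV_apply, hX.total_apply, delta_total, map_add, map_smul]

theorem lieV_mem_deg (hX : IsEvolutionary k X) {p : ℕ} {r : ℤ} {v : VForm n M P gh}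
    (hv : v ∈ deg n M P gh p r) : lieV k X v ∈ deg n M P gh p (r + k) := by
  rw [lieV_apply]
  refine add_mem (hX.map_deg _ _ _ (delta_mem_deg hv)) (Submodule.smul_mem _ _ ?_)
  rcases p with _ | p
  · rw [hX.map_fn _ _ hv, map_zero]; exact zero_mem _
  · exact delta_mem_deg (hX.map_deg _ _ _ hv)

theorem lieV_delta (k : ℤ) (X : Module.End ℝ (VForm n M P gh)) (v : VForm n M P gh) :
    lieV k X (delta v) = (-1 : ℝ) ^ k • delta (lieV k X v) := by
  simp only [lieV_apply, delta_delta, map_zero, map_add, map_smul, smul_zero, add_zero, zero_add]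

/-- The graded commutator of two contractions is a derivation that lowers the vertical degree by
two, whereas generators have vertical degree at most one. -/
theorem apply_comm (hX : IsEvolutionary k X) (hY : IsEvolutionary l Y) (v : VForm n M P gh) :
    X (Y v) = (-1 : ℝ) ^ ((k - 1) * (l - 1)) • Y (X v) := by
  have h := (hX.isDer.commutator hY.isDer).ext IsDer.zero fun x => ?_
  · have h2 := LinearMap.congr_fun h v
    simpa [sub_eq_zero] using h2
  have hzero : ∀ {k l X Y}, IsEvolutionary (P := P) k X → IsEvolutionary (gh := gh) l Y →
      X (Y (gen x)) = 0 := fun {k l X Y} hX hY => by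
    have hx := gen_mem_deg x
    cases x
    · rw [hY.map_fn _ _ hx, map_zero]
    · exact hX.map_fn _ _ (hY.map_deg 0 _ _ hx)
    · rw [hY.map_fn _ _ hx, map_zero]
    · exact hX.map_fn _ _ (hY.map_deg 0 _ _ hx)
  simp [hzero hX hY, hzero hY hX]

theorem bracket_apply (k l : ℤ) (X Y : Module.End ℝ (VForm n M P gh)) (v : VForm n M P gh) :
    bracket k l X Y v = lieV k X (Y v) - (-1 : ℝ) ^ (k * (l - 1)) • Y (lieV k X v) := rfl

theorem bracket (hX : IsEvolutionary k X) (hY : IsEvolutionary l Y) :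
    IsEvolutionary (k + l) (bracket k l X Y) := by
  refine of_isDer ?_ (fun r f hf => ?_) (fun p r v hv => ?_) fun ξ v => ?_
  · have h := hX.isDer_lieV.commutator hY.isDer
    rwa [← add_sub_assoc] at h
  · simp only [bracket_apply, hY.map_fn r f hf, hY.map_fn _ _ (hX.lieV_mem_deg hf), map_zero,
      smul_zero, sub_zero]
  · refine sub_mem ?_ (Submodule.smul_mem _ _ ?_)
    · have := hX.lieV_mem_deg (hY.map_deg _ _ _ hv)
      rwa [add_assoc, add_comm l] at this
    · have := hY.map_deg _ _ _ (hX.lieV_mem_deg hv)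
      rwa [add_assoc] at this
  · simp only [bracket_apply, hY.total_apply, hX.lieV_total, map_sub, map_smul]

end IsEvolutionary

open IsEvolutionary

theorem zpow_mul_sub_one (k l : ℤ) :
    (-1 : ℝ) ^ (k * (l - 1)) = (-1 : ℝ) ^ (k * l) * (-1 : ℝ) ^ k := by
  rw [mul_sub, mul_one, zpow_sub₀ (by norm_num)]
  rcases neg_one_zpow_eq_or k with h | h <;> simp [h, div_neg]

theorem zpow_sub_one_mul_sub_one (k l : ℤ) : (-1 : ℝ) ^ ((k - 1) * (l - 1))
    = -((-1 : ℝ) ^ (k * l) * (-1 : ℝ) ^ k * (-1 : ℝ) ^ l) := by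
  rw [zpow_mul_sub_one, mul_comm (k - 1) l, zpow_mul_sub_one, neg_one_zpow_sub_one, mul_comm l k]
  ring

/-- A formal consequence of `δ² = 0`: Lie derivatives commute with `δ` up to sign, so taking the Lie
derivative of `[L_X, i_Y]` gives `[L_X, L_Y]`. -/
theorem lieV_bracket (k l : ℤ) (X Y : Module.End ℝ (VForm n M P gh)) (v : VForm n M P gh) :
    lieV (k + l) (bracket k l X Y) v
      = lieV k X (lieV l Y v) - (-1 : ℝ) ^ (k * l) • lieV l Y (lieV k X v) := by
  simp only [lieV_apply, bracket_apply, map_add, map_sub, map_smul, delta_delta, zpow_mul_sub_one,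
    neg_one_zpow_add, map_zero, smul_zero, add_zero, zero_add]
  rcases neg_one_zpow_eq_or k with h | h <;> rcases neg_one_zpow_eq_or l with h' | h' <;>
    rcases neg_one_zpow_eq_or (k * l) with h'' | h'' <;>
    simp only [h, h', h'', one_smul, neg_smul, mul_one, neg_neg, mul_neg, smul_neg] <;> abel

/-- Up to sign, the failure of graded antisymmetry is the graded commutator of `δ` with the graded
commutator of `i_X` and `i_Y`; the latter vanishes by `apply_comm`. -/
theorem bracket_swap {k l : ℤ} {X Y : Module.End ℝ (VForm n M P gh)} (hX : IsEvolutionary k X)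
    (hY : IsEvolutionary l Y) (v : VForm n M P gh) :
    bracket k l X Y v = -((-1 : ℝ) ^ (k * l) • bracket l k Y X v) := by
  simp only [lieV_apply, bracket_apply, map_add, map_smul, zpow_mul_sub_one k l,
    zpow_mul_sub_one l k, mul_comm l k, hX.apply_comm hY, zpow_sub_one_mul_sub_one]
  rcases neg_one_zpow_eq_or k with h | h <;> rcases neg_one_zpow_eq_or l with h' | h' <;>
    rcases neg_one_zpow_eq_or (k * l) with h'' | h'' <;>
    simp only [h, h', h'', one_smul, neg_smul, mul_one, neg_neg, mul_neg, smul_neg] <;> abel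

/-- The contraction with a field of ghost number one is an even operator, so `[X, Q] = 0` is plain
commutation of `L_X` with `i_Q`. -/
theorem bracket_eq_zero_iff {k : ℤ} {X Q : Module.End ℝ (VForm n M P gh)} :
    bracket k 1 X Q = 0 ↔ ∀ v, lieV k X (Q v) = Q (lieV k X v) := by
  rw [LinearMap.ext_iff]
  refine forall_congr' fun v => ?_
  simp [bracket_apply, sub_eq_zero]

theorem bracket_mem_symmetries {k l : ℤ} {X Y Q : Module.End ℝ (VForm n M P gh)}
    (hX : X ∈ symmetries Q k) (hY : Y ∈ symmetries Q l) :
    bracket k l X Y ∈ symmetries Q (k + l) := by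
  obtain ⟨hX, hX'⟩ := hX
  obtain ⟨hY, hY'⟩ := hY
  rw [bracket_eq_zero_iff] at hX' hY'
  refine ⟨IsEvolutionary.bracket hX hY, bracket_eq_zero_iff.2 fun v => ?_⟩
  simp only [lieV_bracket, hX', hY', map_sub, map_smul]

theorem homological_bracket_mem_symmetries {l : ℤ} {Y Q : Module.End ℝ (VForm n M P gh)}
    (hQ : IsEvolutionary 1 Q) (hQQ : bracket 1 1 Q Q = 0) (hY : IsEvolutionary l Y) :
    bracket 1 l Q Y ∈ symmetries Q (1 + l) := by
  refine ⟨IsEvolutionary.bracket hQ hY, bracket_eq_zero_iff.2 fun v => ?_⟩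
  -- `[Q, Q] = 0` gives `2 L_Q² = 0`.
  have hsq : ∀ w, lieV 1 Q (lieV 1 Q w) = 0 := fun w => by
    have h := lieV_bracket 1 1 Q Q w
    have h0 : lieV (1 + 1) (0 : Module.End ℝ (VForm n M P gh)) w = 0 := by simp [lieV_apply]
    rw [hQQ, h0, mul_one, zpow_one, neg_smul, one_smul, sub_neg_eq_add, ← two_smul ℝ] at h
    exact (smul_eq_zero_iff_right (by norm_num : (2 : ℝ) ≠ 0)).1 h.symm
  rw [bracket_eq_zero_iff] at hQQ
  -- Interchanging `L_Y` and `i_Q` costs `[Y, Q]`, which antisymmetry expresses through `[Q, Y] =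
  -- L_Q i_Y + (-1)^l i_Y L_Q`.
  have hswap : ∀ w, lieV l Y (Q w) = Q (lieV l Y w)
      - (-1 : ℝ) ^ l • (lieV 1 Q (Y w) + (-1 : ℝ) ^ l • Y (lieV 1 Q w)) := fun w => by
    have h := bracket_swap hY hQ w
    simp only [bracket_apply, sub_self, mul_zero, zpow_zero, one_smul, mul_one, one_mul,
      neg_one_zpow_sub_one, neg_smul, sub_neg_eq_add] at h
    rw [sub_eq_iff_eq_add] at h
    rw [h]; abel
  simp only [lieV_bracket, hswap, hQQ, map_sub, map_add, map_smul, map_zero, hsq, one_mul]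
  rcases neg_one_zpow_eq_or l with h | h <;> simp only [h, one_smul, neg_smul] <;> abel

/-! ### The ideal of the shell -/

section Shell

variable {Q : Module.End ℝ (VForm n M P gh)}

theorem mul_mul_mem_shellIdeal {v : VForm n M P gh} (hv : v ∈ shellIdeal Q) (a b : VForm n M P gh) :
    a * v * b ∈ shellIdeal Q := by
  induction hv using Submodule.span_induction with
  | mem v hv =>
    obtain ⟨a', b', r, f, hf, h⟩ := hv
    refine Submodule.subset_span ⟨a * a', b' * b, r, f, hf, ?_⟩
    rcases h with rfl | rfl
    · left; simp only [mul_assoc]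
    · right; simp only [mul_assoc]
  | zero => simp
  | add y z _ _ hy hz => rw [mul_add, add_mul]; exact add_mem hy hz
  | smul c y _ hy => rw [mul_smul_comm, smul_mul_assoc]; exact Submodule.smul_mem _ c hy

theorem mul_mem_shellIdeal_left {v : VForm n M P gh} (hv : v ∈ shellIdeal Q) (a : VForm n M P gh) :
    a * v ∈ shellIdeal Q := by
  simpa using mul_mul_mem_shellIdeal hv a 1

theorem mul_mem_shellIdeal_right {v : VForm n M P gh} (hv : v ∈ shellIdeal Q) (b : VForm n M P gh) :
    v * b ∈ shellIdeal Q := by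
  simpa using mul_mul_mem_shellIdeal hv 1 b

theorem lieV_fn_mem_shellIdeal {r : ℤ} {f : VForm n M P gh} (hf : f ∈ deg n M P gh 0 r) :
    lieV 1 Q f ∈ shellIdeal Q :=
  Submodule.subset_span ⟨1, 1, r, f, hf, Or.inl (by simp)⟩

theorem delta_lieV_fn_mem_shellIdeal {r : ℤ} {f : VForm n M P gh} (hf : f ∈ deg n M P gh 0 r) :
    delta (lieV 1 Q f) ∈ shellIdeal Q :=
  Submodule.subset_span ⟨1, 1, r, f, hf, Or.inr (by simp)⟩

/-- By the Leibniz rule a derivation preserves an ideal once it maps the ideal generators into it.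
These have definite parity, so only the left cofactor has to be decomposed by parity. -/
theorem VForm.IsDer.map_shellIdeal (hQ : IsEvolutionary 1 Q) {e : ℤ} {D : Module.End ℝ (VForm n M P gh)}
    (hD : IsDer e D)
    (h : ∀ r, ∀ f ∈ deg n M P gh 0 r,
      D (lieV 1 Q f) ∈ shellIdeal Q ∧ D (delta (lieV 1 Q f)) ∈ shellIdeal Q)
    {v : VForm n M P gh} (hv : v ∈ shellIdeal Q) : D v ∈ shellIdeal Q := by
  have key : ∀ s, ∀ g ∈ parity n M P gh s, g ∈ shellIdeal Q → D g ∈ shellIdeal Q →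
      ∀ a b, D (a * g * b) ∈ shellIdeal Q := by
    intro s g hg hgI hDg a b
    induction a using induction_parity with
    | zero => simp
    | add a a' ha ha' => rw [add_mul, add_mul, map_add]; exact add_mem ha ha'
    | homogeneous t a ha =>
      rw [mul_assoc, hD.leibniz t a ha, hD.leibniz s g hg]
      refine add_mem (mul_mem_shellIdeal_left (mul_mem_shellIdeal_right hgI _) _)
        (Submodule.smul_mem _ _ (mul_mem_shellIdeal_left (add_mem ?_ (Submodule.smul_mem _ _ ?_)) _))
      · exact mul_mem_shellIdeal_right hDg _
      · exact mul_mem_shellIdeal_right hgI _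
  induction hv using Submodule.span_induction with
  | mem v hv =>
    obtain ⟨a, b, r, f, hf, h'⟩ := hv
    have hL := hQ.lieV_mem_deg hf
    rcases h' with rfl | rfl
    · exact key _ _ (deg_le_parity _ _ hL) (lieV_fn_mem_shellIdeal hf) (h r f hf).1 a b
    · exact key _ _ (deg_le_parity _ _ (delta_mem_deg hL)) (delta_lieV_fn_mem_shellIdeal hf)
        (h r f hf).2 a b
  | zero => simp
  | add y z _ _ hy hz => rw [map_add]; exact add_mem hy hz
  | smul c y _ hy => rw [map_smul]; exact Submodule.smul_mem _ c hy

theorem delta_mem_shellIdeal (hQ : IsEvolutionary 1 Q) {v : VForm n M P gh}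
    (hv : v ∈ shellIdeal Q) : delta v ∈ shellIdeal Q := by
  refine isDer_delta.map_shellIdeal hQ (fun r f hf => ⟨delta_lieV_fn_mem_shellIdeal hf, ?_⟩) hv
  rw [delta_delta]; exact zero_mem _

theorem total_mem_shellIdeal (hQ : IsEvolutionary 1 Q) (ξ : VF n M) {v : VForm n M P gh}
    (hv : v ∈ shellIdeal Q) : total ξ v ∈ shellIdeal Q := by
  refine (isDer_total ξ).map_shellIdeal hQ (fun r f hf => ⟨?_, ?_⟩) hv
  · rw [← hQ.lieV_total]; exact lieV_fn_mem_shellIdeal (total_mem_deg ξ hf)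
  · rw [← delta_total, ← hQ.lieV_total]; exact delta_lieV_fn_mem_shellIdeal (total_mem_deg ξ hf)

/-- `i_X` kills the function `Qf`, so `i_X δ(Qf) = L_X (Qf)`. As `X` commutes with `Q`, this is `±
Q(Xf)`, again a generator of the ideal. -/
theorem symmetry_mem_shellIdeal (hQ : IsEvolutionary 1 Q) {k : ℤ}
    {X : Module.End ℝ (VForm n M P gh)} (hX : X ∈ symmetries Q k) {v : VForm n M P gh}
    (hv : v ∈ shellIdeal Q) : X v ∈ shellIdeal Q := by
  obtain ⟨hX, hX'⟩ := hX
  change IsEvolutionary k X at hX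
  rw [bracket_eq_zero_iff] at hX'
  refine hX.isDer.map_shellIdeal hQ (fun r f hf => ⟨?_, ?_⟩) hv
  · rw [hX.map_fn _ _ (hQ.lieV_mem_deg hf)]; exact zero_mem _
  · have h1 : X (delta (lieV 1 Q f)) = lieV k X (lieV 1 Q f) := by
      rw [lieV_apply k, hX.map_fn _ _ (hQ.lieV_mem_deg hf), map_zero, smul_zero, add_zero]
    have h2 : lieV k X (lieV 1 Q f) = (-1 : ℝ) ^ k • lieV 1 Q (lieV k X f) := by
      have h3 : ∀ w, lieV 1 Q w = Q (delta w) - delta (Q w) := fun w => by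
        rw [lieV_apply, zpow_one, neg_smul, one_smul, sub_eq_add_neg]
      have h4 : lieV k X (delta (Q f)) = (-1 : ℝ) ^ k • delta (Q (lieV k X f)) := by
        rw [lieV_delta, hX']
      rw [h3, map_sub, h4, hX', lieV_delta, h3, map_smul, smul_sub]
    rw [h1, h2]
    exact Submodule.smul_mem _ _ (lieV_fn_mem_shellIdeal (hX.lieV_mem_deg hf))

/-- The Lie derivative along `Q` of any form vanishes on the shell. -/
theorem lieV_mem_shellIdeal (hQ : IsEvolutionary 1 Q) (v : VForm n M P gh) :
    lieV 1 Q v ∈ shellIdeal Q := by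
  -- `L_Q` anticommutes with `δ`, so on generators of vertical degree one it yields `δ(Qf)` up to
  -- sign.
  have hd : ∀ r, ∀ f ∈ deg n M P gh 0 r, lieV 1 Q (delta f) ∈ shellIdeal Q := fun r f hf => by
    rw [lieV_delta]; exact Submodule.smul_mem _ _ (delta_lieV_fn_mem_shellIdeal hf)
  have hg : ∀ x : Gen n M P gh, lieV 1 Q (gen x) ∈ shellIdeal Q := fun x => by
    cases x with
    | fn f => exact lieV_fn_mem_shellIdeal (gen_mem_deg (.fn f))
    | dfn f =>
      have := hd _ _ (gen_mem_deg (.fn f))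
      rwa [delta_gen] at this
    | fld i D => exact lieV_fn_mem_shellIdeal (gen_mem_deg (.fld i D))
    | dfld i D =>
      have := hd _ _ (gen_mem_deg (.fld i D))
      rwa [delta_gen] at this
  induction v using induction_monomial with
  | zero => simp
  | add v w hv hw => rw [map_add]; exact add_mem hv hw
  | smul c v hv => rw [map_smul]; exact Submodule.smul_mem _ c hv
  | monomial l =>
    induction l with
    | nil => simp [hQ.isDer_lieV.map_one]
    | cons x l ih =>
      simp only [List.map_cons, List.prod_cons, hQ.isDer_lieV.leibniz _ _ (gen_mem_parity x)]
      exact add_mem (mul_mem_shellIdeal_right (hg x) _)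
        (Submodule.smul_mem _ _ (mul_mem_shellIdeal_left ih _))

end Shell

open VForm IsEvolutionary

/-! ### Contraction and differentials modulo the shell and exact forms -/

section Operators

variable {q p : ℕ} {r k l : ℤ} {X Y Q : Module.End ℝ (VForm n M P gh)}

theorem contr_apply (k : ℤ) (X : Module.End ℝ (VForm n M P gh)) (α : Cochain n M P gh q)
    (ξ : Fin q → VF n M) : contr k X α ξ = (-1 : ℝ) ^ (q * (k - 1)) • X (α ξ) := rfl

theorem verD_apply (α : Cochain n M P gh q) (ξ : Fin q → VF n M) :
    verD α ξ = (-1 : ℝ) ^ q • delta (α ξ) := rfl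

theorem lieD_apply (k : ℤ) (X : Module.End ℝ (VForm n M P gh)) (α : Cochain n M P gh q)
    (ξ : Fin q → VF n M) : lieD k X α ξ = (-1 : ℝ) ^ (q * k) • lieV k X (α ξ) := by
  simp only [lieD, Pi.add_apply, Pi.smul_apply, contr_apply, verD_apply, lieV_apply, map_smul,
    zpow_mul_sub_one, zpow_natCast]
  rcases neg_one_pow_eq_or ℝ q with h | h <;> rcases neg_one_zpow_eq_or k with h' | h' <;>
    rcases neg_one_zpow_eq_or ((q : ℤ) * k) with h'' | h'' <;>
    simp only [h, h', h'', one_smul, neg_smul, mul_one, mul_neg, neg_neg, smul_add, smul_neg]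

theorem contr_mem_forms (hX : IsEvolutionary k X) {α : Cochain n M P gh q}
    (hα : α ∈ forms q (p + 1) r) : contr k X α ∈ forms q p (k + r) := by
  rw [contr_eq]
  refine Submodule.smul_mem _ _ (Cochain.isForm_compLeft (fun a v => ?_) (fun v hv => ?_) hα)
  · rw [hX.isDer.map_baseFn_mul, hX.map_fn _ _ (baseFn_mem_deg a), zero_mul, zero_add]
  · rw [add_comm]; exact hX.map_deg _ _ _ hv

theorem contr_eq_zero (hX : IsEvolutionary k X) {α : Cochain n M P gh q}
    (hα : α ∈ forms q 0 r) : contr k X α = 0 := by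
  funext ξ
  rw [contr_apply, hX.map_fn _ _ (IsForm.mem_deg hα ξ), smul_zero]
  rfl

theorem verD_mem_forms {α : Cochain n M P gh q} (hα : α ∈ forms q p r) :
    verD α ∈ forms q (p + 1) r := by
  rw [verD_eq]
  refine Submodule.smul_mem _ _ (Cochain.isForm_compLeft (fun a v => ?_)
    (fun v hv => delta_mem_deg hv) hα)
  rw [isDer_delta.map_baseFn_mul, delta_baseFn, zero_mul, zero_add]

theorem horD_contr (hX : IsEvolutionary k X) (α : Cochain n M P gh q) :
    contr k X (horD α) = -((-1 : ℝ) ^ k • horD (contr k X α)) := by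
  rw [contr_eq, contr_eq, map_smul, Cochain.horD_compLeft hX.total_apply, contr_sign, smul_smul,
    neg_smul]

theorem horD_verD (α : Cochain n M P gh q) : horD (verD α) = -verD (horD α) := by
  rw [verD_eq, verD_eq, map_smul, Cochain.horD_compLeft delta_total, pow_succ, mul_neg, mul_one,
    neg_smul, neg_neg]

theorem verD_verD (α : Cochain n M P gh q) : verD (verD α) = 0 := by
  funext ξ
  simp only [verD_apply, map_smul, delta_delta, smul_zero]
  rfl

theorem contr_contr (hX : IsEvolutionary k X) (hY : IsEvolutionary l Y) (α : Cochain n M P gh q) :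
    contr k X (contr l Y α) = (-1 : ℝ) ^ ((k - 1) * (l - 1)) • contr l Y (contr k X α) := by
  funext ξ
  simp only [contr_apply, Pi.smul_apply, map_smul, hX.apply_comm hY, smul_smul]
  congr 1
  ring

theorem contr_bracket (k l : ℤ) (X Y : Module.End ℝ (VForm n M P gh)) (α : Cochain n M P gh q) :
    contr (k + l) (bracket k l X Y) α
      = lieD k X (contr l Y α) - (-1 : ℝ) ^ (k * (l - 1)) • contr l Y (lieD k X α) := by
  funext ξ
  -- The sign for moving `i_{[X,Y]}` past `dx^J` is the product of the signs for `L_X` and `i_Y`.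
  have h : (-1 : ℝ) ^ ((q : ℤ) * (k + l - 1))
      = (-1 : ℝ) ^ ((q : ℤ) * k) * (-1 : ℝ) ^ ((q : ℤ) * (l - 1)) := by
    rw [← neg_one_zpow_add]; congr 1; ring
  simp only [contr_apply, lieD_apply, Pi.smul_apply, Pi.sub_apply, bracket_apply, map_smul,
    smul_smul, smul_sub, h]
  congr 2
  ring

theorem mem_onShellZero {α : Cochain n M P gh q} :
    α ∈ onShellZero Q q ↔ ∀ ξ, α ξ ∈ shellIdeal Q := by
  simp [onShellZero, Submodule.mem_pi]

theorem contr_mem_onShellZero (hQ : IsEvolutionary 1 Q) (hX : X ∈ symmetries Q k)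
    {α : Cochain n M P gh q} (hα : α ∈ onShellZero Q q) : contr k X α ∈ onShellZero Q q :=
  mem_onShellZero.2 fun ξ =>
    Submodule.smul_mem _ _ (symmetry_mem_shellIdeal hQ hX (mem_onShellZero.1 hα ξ))

theorem verD_mem_onShellZero (hQ : IsEvolutionary 1 Q)
    {α : Cochain n M P gh q} (hα : α ∈ onShellZero Q q) : verD α ∈ onShellZero Q q :=
  mem_onShellZero.2 fun ξ =>
    Submodule.smul_mem _ _ (delta_mem_shellIdeal hQ (mem_onShellZero.1 hα ξ))

theorem lieD_mem_onShellZero (hQ : IsEvolutionary 1 Q) (α : Cochain n M P gh q) :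
    lieD 1 Q α ∈ onShellZero Q q :=
  mem_onShellZero.2 fun ξ => by
    rw [lieD_apply]; exact Submodule.smul_mem _ _ (lieV_mem_shellIdeal hQ _)

theorem horD_mem_onShellZero (hQ : IsEvolutionary 1 Q)
    {α : Cochain n M P gh q} (hα : α ∈ onShellZero Q q) : horD α ∈ onShellZero Q (q + 1) := by
  rw [mem_onShellZero] at hα ⊢
  intro ξ
  simp only [horD, LinearMap.coe_mk, AddHom.coe_mk]
  refine (shellIdeal Q).sum_mem fun i _ => (shellIdeal Q).smul_mem _
    ((shellIdeal Q).sub_mem ?_ ?_)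
  · exact total_mem_shellIdeal hQ _ (hα _)
  · refine Submodule.sum_mem _ fun j _ => ?_
    split_ifs
    · exact hα _
    · exact zero_mem _

theorem contr_mem_horExact (hX : IsEvolutionary k X) {α : Cochain n M P gh q}
    (hα : α ∈ horExact (p + 1) r q) : contr k X α ∈ horExact p (k + r) q := by
  cases q with
  | zero =>
    obtain rfl : α = 0 := (Submodule.mem_bot ℝ).1 hα
    rw [map_zero]; exact zero_mem _
  | succ q =>
    obtain ⟨γ, hγ, rfl⟩ := hα
    rw [horD_contr hX]
    exact neg_mem (Submodule.smul_mem _ _ ⟨_, contr_mem_forms hX hγ, rfl⟩)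

theorem verD_mem_horExact {α : Cochain n M P gh q} (hα : α ∈ horExact p r q) :
    verD α ∈ horExact (p + 1) r q := by
  cases q with
  | zero =>
    obtain rfl : α = 0 := (Submodule.mem_bot ℝ).1 hα
    rw [map_zero]; exact zero_mem _
  | succ q =>
    obtain ⟨γ, hγ, rfl⟩ := hα
    rw [← neg_neg (verD _), ← horD_verD]
    exact neg_mem ⟨_, verD_mem_forms hγ, rfl⟩

theorem horD_eq_zero_of_mem_horExact {α : Cochain n M P gh q} (hα : α ∈ horExact p r q) :
    horD α = 0 := by
  cases q with
  | zero =>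
    obtain rfl : α = 0 := (Submodule.mem_bot ℝ).1 hα
    rw [map_zero]
  | succ q =>
    obtain ⟨γ, hγ, rfl⟩ := hα
    exact Cochain.horD_horD hγ

/-- The two summands use different properties of `X`: the shell ideal is preserved because `X`
commutes with `Q`, exact forms because `X` is evolutionary. -/
theorem contr_mem_onShellExact (hQ : IsEvolutionary 1 Q) (hX : X ∈ symmetries Q k)
    {α : Cochain n M P gh q} (hα : α ∈ onShellExact Q q (p + 1) r) :
    contr k X α ∈ onShellExact Q q p (k + r) := by
  obtain ⟨s, hs, e, he, rfl⟩ := Submodule.mem_sup.1 hα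
  rw [map_add]
  exact Submodule.add_mem_sup (contr_mem_onShellZero hQ hX hs) (contr_mem_horExact hX.1 he)

theorem verD_mem_onShellExact (hQ : IsEvolutionary 1 Q) {α : Cochain n M P gh q}
    (hα : α ∈ onShellExact Q q p r) : verD α ∈ onShellExact Q q (p + 1) r := by
  obtain ⟨s, hs, e, he, rfl⟩ := Submodule.mem_sup.1 hα
  rw [map_add]
  exact Submodule.add_mem_sup (verD_mem_onShellZero hQ hs) (verD_mem_horExact he)

/-- `d² = 0` removes the exact summand, and total derivatives preserve the shell ideal. -/
theorem horD_mem_onShellZero_of_mem_onShellExact (hQ : IsEvolutionary 1 Q)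
    {α : Cochain n M P gh q} (hα : α ∈ onShellExact Q q p r) : horD α ∈ onShellZero Q (q + 1) := by
  obtain ⟨s, hs, e, he, rfl⟩ := Submodule.mem_sup.1 hα
  rw [map_add, horD_eq_zero_of_mem_horExact he, add_zero]
  exact horD_mem_onShellZero hQ hs

end Operators

/-! ### The flat part of a horizontal form -/

section FlatPart

variable {q : ℕ} {r : ℤ}

theorem flatPart_eq (α : Cochain n M P gh q) :
    flatPart α = (LinearMap.id - zeroPart : Module.End ℝ (VForm n M P gh)).compLeft _ α := rfl

theorem horD_flatPart (α : Cochain n M P gh q) : horD (flatPart α) = flatPart (horD α) := by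
  rw [flatPart_eq, flatPart_eq, Cochain.horD_compLeft fun ξ v => ?_]
  simp only [LinearMap.sub_apply, LinearMap.id_apply, zeroPart_total, map_sub]

theorem isFlat_flatPart (α : Cochain n M P gh q) : IsFlat (flatPart α) := fun ξ => by
  rw [flatPart, map_sub, zeroSection_baseFn, sub_self]

/-- `δ` kills functions on `M`. Consequently a form and its flat part are Hamiltonians of the same
symmetries. -/
theorem verD_flatPart (α : Cochain n M P gh q) : verD (flatPart α) = verD α := by
  funext ξ
  rw [verD_apply, flatPart, map_sub, delta_baseFn, sub_zero, verD_apply]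

theorem flatPart_mem_forms {α : Cochain n M P gh q} (hα : α ∈ forms q 0 r) :
    flatPart α ∈ forms q 0 r := by
  rw [flatPart_eq]
  refine Cochain.isForm_compLeft (fun a v => ?_) (fun v hv => sub_mem hv (zeroPart_mem_deg hv)) hα
  change baseFn a * v - baseFn (zeroSection (baseFn a * v)) = baseFn a * (v - baseFn (zeroSection v))
  rw [map_mul, zeroSection_baseFn, baseFn_mul, mul_sub]

theorem flatPart_eq_self {α : Cochain n M P gh q} (hα : IsFlat α) : flatPart α = α := by
  funext ξ
  have h0 := baseFn_algebraMap (P := P) (gh := gh) (n := n) (M := M) 0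
  rw [map_zero, map_zero] at h0
  rw [flatPart, hα ξ, h0, sub_zero]

end FlatPart

/-! ### On-shell Hamiltonian forms, their bracket and the map from symmetries -/

section GaugeSystem

variable {Q : Module.End ℝ (VForm n M P gh)} {m : ℕ} {g : ℤ} {Ω : Cochain n M P gh m}
  {j k l : ℤ} {W X Y : Module.End ℝ (VForm n M P gh)} {α β γ : Cochain n M P gh m}

theorem flatPart_mem_hamiltonianPairs (h : (X, α) ∈ hamiltonianPairs Q g Ω k) :
    (X, flatPart α) ∈ hamiltonianPairs Q g Ω k :=
  ⟨h.1, flatPart_mem_forms h.2.1, by rw [verD_flatPart]; exact h.2.2⟩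

/-- Flat on-shell Hamiltonian forms are conservation laws. -/
theorem isConservationLaw_flatPart (hΩ : IsGaugeSystem Q m g Ω)
    (hd : horD Ω ∈ onShellZero Q (m + 1)) (hflat : FlatVerticalCohomologyTrivial Q)
    (hα : α ∈ hamiltonianForms Q g Ω k) : IsConservationLaw Q (flatPart α) := by
  obtain ⟨⟨X, α⟩, h, rfl⟩ := hα
  have hQ := hΩ.evolutionary
  change horD (flatPart α) ∈ _
  -- The flat cohomology condition is applied to `d α̂`, which is flat because `d` commutes with the
  -- flat part. It remains to see that `δ d α̂ = -d δα` vanishes on the shell.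
  refine hflat _ (k + g) _ (Cochain.isForm_horD (flatPart_mem_forms h.2.1))
    (by rw [horD_flatPart]; exact isFlat_flatPart _) ?_
  rw [← neg_neg (verD _), ← horD_verD, verD_flatPart]
  refine neg_mem ?_
  -- `d (i_X Ω - δα)` vanishes on the shell, and so does `d i_X Ω = ± i_X dΩ` by hypothesis on `Ω`;
  -- hence `d δα` does too.
  have h1 := horD_mem_onShellZero_of_mem_onShellExact hQ h.2.2
  rw [map_sub] at h1
  have h2 : horD (contr k X Ω) ∈ onShellZero Q (m + 1) := by
    have h3 := Submodule.smul_mem _ (-(-1 : ℝ) ^ k) (contr_mem_onShellZero hQ h.1 hd)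
    rwa [horD_contr h.1.1, smul_neg, neg_smul, neg_neg, smul_smul, neg_one_zpow_mul_self,
      one_smul] at h3
  exact (Submodule.sub_mem_iff_right _ h2).1 h1

theorem verD_contr_mem_onShellExact (hΩ : IsGaugeSystem Q m g Ω)
    (h : (X, α) ∈ hamiltonianPairs Q g Ω k) :
    verD (contr k X Ω) ∈ onShellExact Q m 2 (k + g) := by
  have h1 := verD_mem_onShellExact hΩ.evolutionary h.2.2
  rwa [map_sub, verD_verD, sub_zero] at h1

/-- In `L_X Ω = i_X δΩ ± δ i_X Ω` the first term is exact because `δΩ` is and `X` is evolutionary.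
The second is `≈ ± δδα = 0`. -/
theorem lieD_mem_onShellExact (hΩ : IsGaugeSystem Q m g Ω)
    (h : (X, α) ∈ hamiltonianPairs Q g Ω k) : lieD k X Ω ∈ onShellExact Q m 2 (k + g) :=
  add_mem (Submodule.mem_sup_right (contr_mem_horExact h.1.1 hΩ.presymplectic))
    (Submodule.smul_mem _ _ (verD_contr_mem_onShellExact hΩ h))

/-- The bracket of on-shell Hamiltonian symmetries has the Hamiltonian `(-1)^k i_X i_Y Ω`. -/
theorem bracket_mem_hamiltonianPairs (hΩ : IsGaugeSystem Q m g Ω)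
    (hX : (X, α) ∈ hamiltonianPairs Q g Ω k) (hY : (Y, β) ∈ hamiltonianPairs Q g Ω l) :
    (bracket k l X Y, (-1 : ℝ) ^ k • contr k X (contr l Y Ω)) ∈ hamiltonianPairs Q g Ω (k + l) := by
  have hQ := hΩ.evolutionary
  refine ⟨bracket_mem_symmetries hX.1 hY.1, ?_, ?_⟩
  · rw [add_assoc]
    exact Submodule.smul_mem _ _ (contr_mem_forms hX.1.1 (contr_mem_forms hY.1.1 hΩ.form))
  -- In `i_{[X,Y]} Ω = L_X i_Y Ω ∓ i_Y L_X Ω` the part `(-1)^k δ i_X i_Y Ω` of the first term is `δ`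
  -- of the proposed Hamiltonian. The two remaining terms contract forms that are `≈ 0` with
  -- symmetries.
  · have h1 : contr (k + l) (bracket k l X Y) Ω - verD ((-1 : ℝ) ^ k • contr k X (contr l Y Ω))
        = contr k X (verD (contr l Y Ω))
          - (-1 : ℝ) ^ (k * (l - 1)) • contr l Y (lieD k X Ω) := by
      rw [contr_bracket, lieD, map_smul]
      abel
    rw [h1]
    refine sub_mem ?_ (Submodule.smul_mem _ _ ?_)
    · rw [add_assoc]
      exact contr_mem_onShellExact hQ hX.1 (verD_contr_mem_onShellExact hΩ hY)
    · rw [add_comm k, add_assoc]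
      exact contr_mem_onShellExact hQ hY.1 (lieD_mem_onShellExact hΩ hX)

theorem contr_contr_antisymm (hX : IsEvolutionary k X) (hY : IsEvolutionary l Y) :
    (-1 : ℝ) ^ k • contr k X (contr l Y Ω)
      = -(-1 : ℝ) ^ (k * l) • ((-1 : ℝ) ^ l • contr l Y (contr k X Ω)) := by
  rw [contr_contr hX hY, smul_smul, smul_smul, zpow_sub_one_mul_sub_one]
  congr 1
  rcases neg_one_zpow_eq_or k with h | h <;> simp [h]

/-- As `Ω` has vertical degree two, `i_W i_X i_Y Ω = 0`, so `L_W` acts on `i_X i_Y Ω` as `i_W δ`. Up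
to sign and `≈`, the iterated bracket is therefore `L_W` of `i_X i_Y Ω`, and Jacobi is the rule
`[L_W, i_X] = i_{[W,X]}` applied twice, together with `L_W Ω ≈ 0`. -/
theorem contr_contr_jacobi (hΩ : IsGaugeSystem Q m g Ω) (hW : (W, γ) ∈ hamiltonianPairs Q g Ω j)
    (hX : (X, α) ∈ hamiltonianPairs Q g Ω k) (hY : (Y, β) ∈ hamiltonianPairs Q g Ω l) :
    (-1 : ℝ) ^ j • contr j W (contr (k + l) (bracket k l X Y) Ω)
      - ((-1 : ℝ) ^ (j + k) • contr (j + k) (bracket j k W X) (contr l Y Ω)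
        + (-1 : ℝ) ^ (j * k) • ((-1 : ℝ) ^ k • contr k X (contr (j + l) (bracket j l W Y) Ω)))
      ∈ onShellExact Q m 0 (j + (k + l) + g) := by
  have hQ := hΩ.evolutionary
  have h0 : contr j W (contr k X (contr l Y Ω)) = 0 :=
    contr_eq_zero hW.1.1 (contr_mem_forms hX.1.1 (contr_mem_forms hY.1.1 hΩ.form))
  have h1 : lieD j W (contr k X (contr l Y Ω)) = contr j W (verD (contr k X (contr l Y Ω))) := by
    rw [lieD, h0, map_zero, smul_zero, add_zero]
  -- An exact identity for the Jacobi defect: it consists of `i_W` applied to `i_{[X,Y]} Ω - δ{α,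
  -- β}`, and of `i_X i_Y L_W Ω`, up to signs.
  have h2 : (-1 : ℝ) ^ j • contr j W (contr (k + l) (bracket k l X Y) Ω)
      - ((-1 : ℝ) ^ (j + k) • contr (j + k) (bracket j k W X) (contr l Y Ω)
        + (-1 : ℝ) ^ (j * k) • ((-1 : ℝ) ^ k • contr k X (contr (j + l) (bracket j l W Y) Ω)))
      = (-1 : ℝ) ^ j • contr j W (contr (k + l) (bracket k l X Y) Ω
          - verD ((-1 : ℝ) ^ k • contr k X (contr l Y Ω)))
        + ((-1 : ℝ) ^ (j * k) * (-1 : ℝ) ^ k * (-1 : ℝ) ^ (j * (l - 1)))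
          • contr k X (contr l Y (lieD j W Ω)) := by
    rw [contr_bracket j k, contr_bracket j l, h1]
    simp only [map_sub, map_smul, smul_sub, smul_smul, neg_one_zpow_add, zpow_mul_sub_one j k]
    rcases neg_one_zpow_eq_or j with h | h <;> rcases neg_one_zpow_eq_or k with h' | h' <;>
      simp only [h, h', one_smul, neg_smul, mul_one, one_mul, neg_neg, mul_neg, neg_mul] <;> abel
  rw [h2]
  refine add_mem (Submodule.smul_mem _ _ ?_) (Submodule.smul_mem _ _ ?_)
  · rw [add_assoc]
    exact contr_mem_onShellExact hQ hW.1 (bracket_mem_hamiltonianPairs hΩ hX hY).2.2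
  · have e : j + (k + l) + g = k + (l + (j + g)) := by ring
    rw [e]
    exact contr_mem_onShellExact hQ hX.1
      (contr_mem_onShellExact hQ hY.1 (lieD_mem_onShellExact hΩ hW))

/-- Trivial symmetries have the Hamiltonian zero. -/
theorem homological_bracket_mem_hamiltonianPairs (hΩ : IsGaugeSystem Q m g Ω)
    (hY : Y ∈ evolutionary l) : (bracket 1 l Q Y, 0) ∈ hamiltonianPairs Q g Ω (1 + l) := by
  have hQ := hΩ.evolutionary
  refine ⟨homological_bracket_mem_symmetries hQ hΩ.homological hY, zero_mem _, ?_⟩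
  change contr (1 + l) (bracket 1 l Q Y) Ω - verD 0 ∈ _
  rw [map_zero, sub_zero, contr_bracket]
  -- `L_Q i_Y Ω` vanishes on the shell, as `L_Q` of any form does. `i_Y L_Q Ω` is exact; this needs
  -- only that `Y` is evolutionary, for `Y` may fail to preserve the shell.
  refine sub_mem (Submodule.mem_sup_left (lieD_mem_onShellZero hQ _))
    (Submodule.smul_mem _ _ (Submodule.mem_sup_right ?_))
  have e : 1 + l + g = l + (g + 1) := by ring
  rw [e]
  exact contr_mem_horExact hY hΩ.invariant

theorem LamH.mk_eq_mk {a b : hamiltonianForms Q g Ω k} :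
    LamH.mk Q g Ω k a = LamH.mk Q g Ω k b ↔ a.1 - b.1 ∈ onShellExact Q m 0 (k + g) :=
  Submodule.Quotient.eq _

/-- Membership can be tested on any representative, since `α ≈ α'` implies `δα ≈ δα'`. -/
theorem LamH.mk_mem_constants (hΩ : IsGaugeSystem Q m g Ω) {a : hamiltonianForms Q g Ω k} :
    LamH.mk Q g Ω k a ∈ LamH.constants Q g Ω k ↔ verD a.1 ∈ onShellExact Q m 1 (k + g) := by
  constructor
  · rintro ⟨b, hb, hab⟩
    have h1 := verD_mem_onShellExact hΩ.evolutionary (LamH.mk_eq_mk.1 hab)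
    rw [map_sub] at h1
    have hb' : verD b.1 ∈ onShellExact Q m 1 (k + g) := hb
    exact (Submodule.sub_mem_iff_right _ hb').1 h1
  · exact fun h => ⟨a, h, rfl⟩

theorem snd_mem_hamiltonianForms (h : (X, α) ∈ hamiltonianPairs Q g Ω k) :
    α ∈ hamiltonianForms Q g Ω k :=
  ⟨_, h, rfl⟩

theorem LamH.exists_eq_mk (a : LamH Q g Ω k) :
    ∃ (X : _) (α : _) (h : (X, α) ∈ hamiltonianPairs Q g Ω k),
      a = LamH.mk Q g Ω k ⟨α, snd_mem_hamiltonianForms h⟩ := by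
  obtain ⟨⟨_, ⟨X, α⟩, h, rfl⟩, rfl⟩ := Submodule.mkQ_surjective _ a
  exact ⟨X, α, h, rfl⟩

theorem LamH.recast_mk (e : k = l) (h : α ∈ hamiltonianForms Q g Ω k)
    (h' : α ∈ hamiltonianForms Q g Ω l) :
    (LamH.mk Q g Ω k ⟨α, h⟩).recast e = LamH.mk Q g Ω l ⟨α, h'⟩ := by
  subst e; rfl

/-- The class of the Hamiltonian form of a pair. -/
def LamH.ofPair (Q : Module.End ℝ (VForm n M P gh)) {m : ℕ} (g : ℤ) (Ω : Cochain n M P gh m)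
    (k : ℤ) : hamiltonianPairs Q g Ω k →ₗ[ℝ] LamH Q g Ω k :=
  LamH.mk Q g Ω k ∘ₗ (LinearMap.snd ℝ _ _).submoduleMap (hamiltonianPairs Q g Ω k)

/-- The bracket as a bilinear map on pairs of a symmetry and a Hamiltonian form. -/
def pairBracket (hΩ : IsGaugeSystem Q m g Ω) (k l : ℤ) :
    hamiltonianPairs Q g Ω k →ₗ[ℝ] hamiltonianPairs Q g Ω l →ₗ[ℝ] LamH Q g Ω (k + l) :=
  LinearMap.mk₂ ℝ (fun x y => LamH.mk Q g Ω (k + l)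
      ⟨(-1 : ℝ) ^ k • contr k x.1.1 (contr l y.1.1 Ω), _,
        bracket_mem_hamiltonianPairs hΩ x.2 y.2, rfl⟩)
    (fun x x' y => by
      refine Eq.trans (congrArg _ (Subtype.ext ?_)) (map_add (LamH.mk Q g Ω (k + l)) _ _)
      simp [contr_add_left])
    (fun c x y => by
      refine Eq.trans (congrArg _ (Subtype.ext ?_)) (map_smul (LamH.mk Q g Ω (k + l)) c _)
      simp [contr_smul_left, smul_comm c])
    (fun x y y' => by
      refine Eq.trans (congrArg _ (Subtype.ext ?_)) (map_add (LamH.mk Q g Ω (k + l)) _ _)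
      simp [contr_add_left])
    (fun c x y => by
      refine Eq.trans (congrArg _ (Subtype.ext ?_)) (map_smul (LamH.mk Q g Ω (k + l)) c _)
      simp [contr_smul_left, smul_comm c])

/-- The bracket depends only on the differentials of the Hamiltonian forms. -/
theorem pairBracket_congr (hΩ : IsGaugeSystem Q m g Ω) {x x' : hamiltonianPairs Q g Ω k}
    {y y' : hamiltonianPairs Q g Ω l} (hx : verD (x.1.2 - x'.1.2) ∈ onShellExact Q m 1 (k + g))
    (hy : verD (y.1.2 - y'.1.2) ∈ onShellExact Q m 1 (l + g)) :
    pairBracket hΩ k l x y = pairBracket hΩ k l x' y' := by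
  have hQ := hΩ.evolutionary
  -- `i_X Ω` is determined up to `≈` by `δα`.
  have key : ∀ {k : ℤ} {x x' : hamiltonianPairs Q g Ω k},
      verD (x.1.2 - x'.1.2) ∈ onShellExact Q m 1 (k + g) →
      contr k x.1.1 Ω - contr k x'.1.1 Ω ∈ onShellExact Q m 1 (k + g) := fun {k x x'} h => by
    have h1 := add_mem (sub_mem x.2.2.2 x'.2.2.2) h
    rw [map_sub] at h1
    convert h1 using 1
    abel
  refine LamH.mk_eq_mk.2 ?_
  change (-1 : ℝ) ^ k • contr k x.1.1 (contr l y.1.1 Ω)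
    - (-1 : ℝ) ^ k • contr k x'.1.1 (contr l y'.1.1 Ω) ∈ _
  -- The two symmetries are replaced one at a time. Commuting the contractions puts the difference
  -- of `i_X Ω` and `i_X' Ω` innermost, where it is known to be `≈ 0`.
  have h1 : (-1 : ℝ) ^ k • contr k x.1.1 (contr l y.1.1 Ω)
      - (-1 : ℝ) ^ k • contr k x'.1.1 (contr l y'.1.1 Ω)
      = (-1 : ℝ) ^ k • contr k x.1.1 (contr l y.1.1 Ω - contr l y'.1.1 Ω)
        + ((-1 : ℝ) ^ k * (-1 : ℝ) ^ ((k - 1) * (l - 1)))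
          • contr l y'.1.1 (contr k x.1.1 Ω - contr k x'.1.1 Ω) := by
    rw [map_sub, map_sub, mul_smul, smul_sub ((-1 : ℝ) ^ ((k - 1) * (l - 1))),
      ← contr_contr x.2.1.1 y'.2.1.1, ← contr_contr x'.2.1.1 y'.2.1.1, smul_sub, smul_sub]
    abel
  rw [h1]
  refine add_mem (Submodule.smul_mem _ _ ?_) (Submodule.smul_mem _ _ ?_)
  · rw [add_assoc]
    exact contr_mem_onShellExact hQ x.2.1 (key hy)
  · rw [add_comm k, add_assoc]
    exact contr_mem_onShellExact hQ y'.2.1 (key hx)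

/-- `B` is induced by `{α, β} = (-1)^k i_X i_Y Ω`. -/
def IsHamiltonianBracket (Q : Module.End ℝ (VForm n M P gh)) {m : ℕ} (g : ℤ)
    (Ω : Cochain n M P gh m)
    (B : ∀ k l : ℤ, LamH Q g Ω k →ₗ[ℝ] LamH Q g Ω l →ₗ[ℝ] LamH Q g Ω (k + l)) : Prop :=
  ∀ k l X Y, ∀ α β : Cochain n M P gh m,
    ∀ (hα : (X, α) ∈ hamiltonianPairs Q g Ω k) (hβ : (Y, β) ∈ hamiltonianPairs Q g Ω l),
    ∃ hαβ : (bracket k l X Y, (-1 : ℝ) ^ k • contr k X (contr l Y Ω))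
        ∈ hamiltonianPairs Q g Ω (k + l),
      B k l (LamH.mk Q g Ω k ⟨α, (X, α), hα, rfl⟩) (LamH.mk Q g Ω l ⟨β, (Y, β), hβ, rfl⟩)
        = LamH.mk Q g Ω (k + l) ⟨_, _, hαβ, rfl⟩

/-- Over a field the surjection from pairs `(X, α)` to classes of `α` has a linear section, along
which `pairBracket` is pulled back. By `pairBracket_congr` the result is independent of the section
and has the prescribed value on every pair. -/
theorem exists_isHamiltonianBracket (hΩ : IsGaugeSystem Q m g Ω) :
    ∃ B, IsHamiltonianBracket Q g Ω B := by
  have hsurj : ∀ k, LinearMap.range (LamH.ofPair Q g Ω k) = ⊤ := fun k =>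
    LinearMap.range_eq_top.2
      ((Submodule.mkQ_surjective _).comp (LinearMap.submoduleMap_surjective _ _))
  choose σ hσ using fun k => (LamH.ofPair Q g Ω k).exists_rightInverse_of_surjective (hsurj k)
  refine ⟨fun k l => (pairBracket hΩ k l).compl₁₂ (σ k) (σ l), fun k l X Y α β hα hβ =>
    ⟨bracket_mem_hamiltonianPairs hΩ hα hβ, ?_⟩⟩
  have h1 : ∀ (k : ℤ) (x : hamiltonianPairs Q g Ω k),
      verD ((σ k (LamH.ofPair Q g Ω k x)).1.2 - x.1.2) ∈ onShellExact Q m 1 (k + g) := fun k x =>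
    verD_mem_onShellExact hΩ.evolutionary
      (LamH.mk_eq_mk.1 (LinearMap.congr_fun (hσ k) (LamH.ofPair Q g Ω k x)))
  exact pairBracket_congr hΩ (h1 k ⟨(X, α), hα⟩) (h1 l ⟨(Y, β), hβ⟩)

namespace IsHamiltonianBracket

variable {B : ∀ k l : ℤ, LamH Q g Ω k →ₗ[ℝ] LamH Q g Ω l →ₗ[ℝ] LamH Q g Ω (k + l)}

/-- The left side involves only the classes of `α` and `β`, so the bracket may be computed with any
symmetries of these forms. -/
theorem apply_mk (hΩ : IsGaugeSystem Q m g Ω) (hB : IsHamiltonianBracket Q g Ω B)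
    (hX : (X, α) ∈ hamiltonianPairs Q g Ω k) (hY : (Y, β) ∈ hamiltonianPairs Q g Ω l) :
    B k l (LamH.mk Q g Ω k ⟨α, snd_mem_hamiltonianForms hX⟩)
        (LamH.mk Q g Ω l ⟨β, snd_mem_hamiltonianForms hY⟩)
      = LamH.mk Q g Ω (k + l) ⟨(-1 : ℝ) ^ k • contr k X (contr l Y Ω),
          snd_mem_hamiltonianForms (bracket_mem_hamiltonianPairs hΩ hX hY)⟩ :=
  (hB k l X Y α β hX hY).2

theorem antisymm (hΩ : IsGaugeSystem Q m g Ω) (hB : IsHamiltonianBracket Q g Ω B) (k l : ℤ) (a : LamH Q g Ω k)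
    (b : LamH Q g Ω l) :
    B k l a b = -(-1 : ℝ) ^ (k * l) • (B l k b a).recast (add_comm l k) := by
  obtain ⟨X, α, hX, rfl⟩ := a.exists_eq_mk
  obtain ⟨Y, β, hY, rfl⟩ := b.exists_eq_mk
  rw [hB.apply_mk hΩ hX hY, hB.apply_mk hΩ hY hX, LamH.recast_mk (add_comm l k) _
    (add_comm l k ▸ snd_mem_hamiltonianForms (bracket_mem_hamiltonianPairs hΩ hY hX))]
  refine Eq.trans (congrArg _ (Subtype.ext ?_)) (map_smul (LamH.mk Q g Ω (k + l)) _ _)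
  exact contr_contr_antisymm hX.1.1 hY.1.1

theorem jacobi (hΩ : IsGaugeSystem Q m g Ω) (hB : IsHamiltonianBracket Q g Ω B) (j k l : ℤ)
    (c : LamH Q g Ω j) (a : LamH Q g Ω k) (b : LamH Q g Ω l) :
    B j (k + l) c (B k l a b)
      = (B (j + k) l (B j k c a) b).recast (add_assoc j k l)
        + (-1 : ℝ) ^ (j * k) • (B k (j + l) a (B j l c b)).recast (add_left_comm k j l) := by
  obtain ⟨W, γ, hW, rfl⟩ := c.exists_eq_mk
  obtain ⟨X, α, hX, rfl⟩ := a.exists_eq_mk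
  obtain ⟨Y, β, hY, rfl⟩ := b.exists_eq_mk
  have hXY := bracket_mem_hamiltonianPairs hΩ hX hY
  have hWX := bracket_mem_hamiltonianPairs hΩ hW hX
  have hWY := bracket_mem_hamiltonianPairs hΩ hW hY
  rw [hB.apply_mk hΩ hX hY, hB.apply_mk hΩ hW hX, hB.apply_mk hΩ hW hY, hB.apply_mk hΩ hW hXY,
    hB.apply_mk hΩ hWX hY, hB.apply_mk hΩ hX hWY,
    LamH.recast_mk (add_assoc j k l) _
      (add_assoc j k l ▸ snd_mem_hamiltonianForms (bracket_mem_hamiltonianPairs hΩ hWX hY)),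
    LamH.recast_mk (add_left_comm k j l) _
      (add_left_comm k j l ▸ snd_mem_hamiltonianForms (bracket_mem_hamiltonianPairs hΩ hX hWY)),
    ← map_smul (LamH.mk Q g Ω (j + (k + l))), ← map_add (LamH.mk Q g Ω (j + (k + l)))]
  exact LamH.mk_eq_mk.2 (contr_contr_jacobi hΩ hW hX hY)

theorem constants_central (hΩ : IsGaugeSystem Q m g Ω) (hB : IsHamiltonianBracket Q g Ω B)
    (k l : ℤ) {z : LamH Q g Ω k} (hz : z ∈ LamH.constants Q g Ω k) (b : LamH Q g Ω l) :
    B k l z b = 0 := by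
  obtain ⟨X, α, hX, rfl⟩ := z.exists_eq_mk
  obtain ⟨Y, β, hY, rfl⟩ := b.exists_eq_mk
  have h0 : verD α ∈ onShellExact Q m 1 (k + g) := (LamH.mk_mem_constants hΩ).1 hz
  -- Since `δα ≈ 0`, the zero vector field is also a symmetry of `α`, and the bracket may be
  -- computed with it.
  have h0' : (0, α) ∈ hamiltonianPairs Q g Ω k := by
    refine ⟨zero_mem _, hX.2.1, ?_⟩
    change contr k 0 Ω - verD α ∈ _
    rw [contr_zero_left, zero_sub]
    exact neg_mem h0
  rw [hB.apply_mk hΩ h0' hY]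
  refine Eq.trans (congrArg _ (Subtype.ext ?_)) (map_zero (LamH.mk Q g Ω (k + l)))
  change (-1 : ℝ) ^ k • contr k 0 (contr l Y Ω) = 0
  rw [contr_zero_left, smul_zero]

end IsHamiltonianBracket

/-- `h` sends a symmetry to the class of its Hamiltonians. -/
def IsHamiltonianMap (Q : Module.End ℝ (VForm n M P gh)) {m : ℕ} (g : ℤ) (Ω : Cochain n M P gh m)
    (h : ∀ k : ℤ, hamiltonianSymmetries Q g Ω k →ₗ[ℝ] LamH Q g Ω k ⧸ LamH.constants Q g Ω k) :
    Prop :=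
  ∀ k (X : hamiltonianSymmetries Q g Ω k) (α : hamiltonianForms Q g Ω k),
    h k X = Submodule.Quotient.mk (LamH.mk Q g Ω k α) ↔ (X.1, α.1) ∈ hamiltonianPairs Q g Ω k

/-- A linear section of `(X, α) ↦ X` chooses a Hamiltonian linearly in `X`. Two Hamiltonians of the
same `X` differ by a form with `δ`-differential `≈ 0`, so modulo the constants the choice is
immaterial. -/
theorem exists_isHamiltonianMap (hΩ : IsGaugeSystem Q m g Ω) :
    ∃ h, IsHamiltonianMap Q g Ω h := by
  have hsurj : ∀ k, LinearMap.range
      ((LinearMap.fst ℝ _ _).submoduleMap (hamiltonianPairs Q g Ω k)) = ⊤ := fun k =>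
    LinearMap.range_eq_top.2 (LinearMap.submoduleMap_surjective _ _)
  have hproj : ∀ k, Module.Projective ℝ (hamiltonianSymmetries Q g Ω k) := fun k =>
    @Module.Projective.of_free ℝ _ (hamiltonianSymmetries Q g Ω k) _ _
      (Module.Free.of_divisionRing ℝ (hamiltonianSymmetries Q g Ω k))
  choose τ hτ using fun k => @LinearMap.exists_rightInverse_of_surjective ℝ _ _ _ _ _ _ _ (hproj k) _ (hsurj k)
  refine ⟨fun k => (LamH.constants Q g Ω k).mkQ ∘ₗ LamH.ofPair Q g Ω k ∘ₗ τ k, fun k X α => ?_⟩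
  have hX : (τ k X).1.1 = X.1 := congrArg Subtype.val (LinearMap.congr_fun (hτ k) X)
  have h1 : (τ k X).1 ∈ hamiltonianPairs Q g Ω k := (τ k X).2
  refine (Submodule.Quotient.eq _).trans ?_
  have h2 : LamH.ofPair Q g Ω k (τ k X) - LamH.mk Q g Ω k α
      = LamH.mk Q g Ω k ((⟨(τ k X).1.2, _, h1, rfl⟩ : hamiltonianForms Q g Ω k) - α) :=
    (map_sub (LamH.mk Q g Ω k) _ _).symm
  refine (h2 ▸ LamH.mk_mem_constants hΩ).trans ?_
  change verD ((τ k X).1.2 - α.1) ∈ _ ↔ _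
  -- The relations for `α` and for the chosen Hamiltonian differ exactly by the `δ`-differential of
  -- the difference of the two forms, so one gives the other precisely when the class of that
  -- difference is constant.
  have h3 : contr k X.1 Ω - verD α.1
      = (contr k (τ k X).1.1 Ω - verD (τ k X).1.2) + verD ((τ k X).1.2 - α.1) := by
    rw [hX, map_sub]; abel
  constructor
  · intro h
    obtain ⟨⟨_, α'⟩, hα, hα'⟩ := α.2
    refine ⟨hX ▸ h1.1, hα' ▸ hα.2.1, ?_⟩
    rw [h3]
    exact add_mem h1.2.2 h
  · intro h
    have h4 := h.2.2
    rw [h3] at h4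
    exact (Submodule.add_mem_iff_right _ h1.2.2).1 h4

namespace IsHamiltonianMap

variable {h : ∀ k : ℤ, hamiltonianSymmetries Q g Ω k →ₗ[ℝ] LamH Q g Ω k ⧸ LamH.constants Q g Ω k}

/-- Any representatives of `h(X)` and `h(Y)` are Hamiltonians of `X` and `Y` themselves, by the
characterization of `h`; their bracket is then a Hamiltonian of `[X, Y]`. -/
theorem map_bracket
    {B : ∀ k l : ℤ, LamH Q g Ω k →ₗ[ℝ] LamH Q g Ω l →ₗ[ℝ] LamH Q g Ω (k + l)}
    (hΩ : IsGaugeSystem Q m g Ω) (hh : IsHamiltonianMap Q g Ω h)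
    (hB : IsHamiltonianBracket Q g Ω B) {k l : ℤ}
    {X : hamiltonianSymmetries Q g Ω k} {Y : hamiltonianSymmetries Q g Ω l}
    {Z : hamiltonianSymmetries Q g Ω (k + l)} (hZ : Z.1 = bracket k l X.1 Y.1)
    {a : LamH Q g Ω k} {b : LamH Q g Ω l} (ha : h k X = Submodule.Quotient.mk a)
    (hb : h l Y = Submodule.Quotient.mk b) :
    h (k + l) Z = Submodule.Quotient.mk (B k l a b) := by
  obtain ⟨_, α, hα, rfl⟩ := a.exists_eq_mk
  obtain ⟨_, β, hβ, rfl⟩ := b.exists_eq_mk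
  have hX := (hh k X _).1 ha
  have hY := (hh l Y _).1 hb
  rw [hB.apply_mk hΩ hX hY]
  refine (hh (k + l) Z _).2 ?_
  rw [hZ]
  exact bracket_mem_hamiltonianPairs hΩ hX hY

theorem map_trivial (hΩ : IsGaugeSystem Q m g Ω) (hh : IsHamiltonianMap Q g Ω h) {l : ℤ}
    (hY : Y ∈ evolutionary l) :
    ∃ hY : bracket 1 l Q Y ∈ hamiltonianSymmetries Q g Ω (1 + l), h (1 + l) ⟨_, hY⟩ = 0 := by
  have h1 := homological_bracket_mem_hamiltonianPairs hΩ hY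
  refine ⟨⟨_, h1, rfl⟩, ((hh (1 + l) _ ⟨0, _, h1, rfl⟩).2 h1).trans ?_⟩
  exact (congrArg Submodule.Quotient.mk (map_zero (LamH.mk Q g Ω (1 + l)))).trans
    (Submodule.Quotient.mk_zero _)

end IsHamiltonianMap

theorem bracket_mem_hamiltonianSymmetries (hΩ : IsGaugeSystem Q m g Ω)
    (hX : X ∈ hamiltonianSymmetries Q g Ω k) (hY : Y ∈ hamiltonianSymmetries Q g Ω l) :
    bracket k l X Y ∈ hamiltonianSymmetries Q g Ω (k + l) := by
  obtain ⟨⟨X, α⟩, hX, rfl⟩ := hX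
  obtain ⟨⟨Y, β⟩, hY, rfl⟩ := hY
  exact ⟨_, bracket_mem_hamiltonianPairs hΩ hX hY, rfl⟩

theorem flatPart_mem_hamiltonianForms (hα : α ∈ hamiltonianForms Q g Ω k) :
    flatPart α ∈ hamiltonianForms Q g Ω k := by
  obtain ⟨⟨X, α⟩, hX, rfl⟩ := hα
  exact ⟨_, flatPart_mem_hamiltonianPairs hX, rfl⟩

end GaugeSystem

end
end
end JetForms

/-! ### The proposition for sections of graded vector bundles -/

theorem proposition3p4 {n : ℕ} {M : Type*} [TopologicalSpace M]
    [ChartedSpace (EuclideanSpace ℝ (Fin n)) M] [IsManifold (𝓡 n) ∞ M] [T2Space M]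
    [SigmaCompactSpace M]
    {ι : Type*} [Fintype ι] (F : ι → Type*) [∀ i, NormedAddCommGroup (F i)]
    [∀ i, NormedSpace ℝ (F i)] [∀ i, FiniteDimensional ℝ (F i)]
    (E : ι → M → Type*) [∀ i x, AddCommGroup (E i x)] [∀ i x, Module ℝ (E i x)]
    [∀ i x, TopologicalSpace (E i x)] [∀ i, TopologicalSpace (Bundle.TotalSpace (F i) (E i))]
    [∀ i, FiberBundle (F i) (E i)] [∀ i, VectorBundle ℝ (F i) (E i)]
    [∀ i, ContMDiffVectorBundle ∞ (F i) (E i) (𝓡 n)] (gh : ι → ℤ)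
    (Q : Module.End ℝ (VForm n M (fun i => ContMDiffSection (𝓡 n) (F i) ∞ (E i)) gh))
    (m : ℕ) (g : ℤ) (Ω : Cochain n M (fun i => ContMDiffSection (𝓡 n) (F i) ∞ (E i)) gh m)
    (hQΩ : IsGaugeSystem Q m g Ω)
    (hi : horD Ω ∈ onShellZero Q (m + 1))
    (hii : FlatVerticalCohomologyTrivial Q) :
    (∀ k, ∀ α ∈ hamiltonianForms Q g Ω k,
      flatPart α ∈ hamiltonianForms Q g Ω k ∧ IsFlat (flatPart α) ∧
        IsConservationLaw Q (flatPart α)) ∧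
    (∀ k, ∀ α ∈ hamiltonianForms Q g Ω k, IsFlat α → IsConservationLaw Q α) ∧
    (∀ k l, ∀ X ∈ hamiltonianSymmetries Q g Ω k, ∀ Y ∈ hamiltonianSymmetries Q g Ω l,
      bracket k l X Y ∈ hamiltonianSymmetries Q g Ω (k + l)) ∧
    ∃ (B : ∀ k l : ℤ, LamH Q g Ω k →ₗ[ℝ] LamH Q g Ω l →ₗ[ℝ] LamH Q g Ω (k + l))
      (h : ∀ k : ℤ, hamiltonianSymmetries Q g Ω k →ₗ[ℝ] LamH Q g Ω k ⧸ LamH.constants Q g Ω k),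
      (∀ k l X Y, ∀ α β : Cochain n M (fun i => ContMDiffSection (𝓡 n) (F i) ∞ (E i)) gh m,
        ∀ (hα : (X, α) ∈ hamiltonianPairs Q g Ω k) (hβ : (Y, β) ∈ hamiltonianPairs Q g Ω l),
        ∃ hαβ : (bracket k l X Y, (-1 : ℝ) ^ k • contr k X (contr l Y Ω))
            ∈ hamiltonianPairs Q g Ω (k + l),
          B k l (LamH.mk Q g Ω k ⟨α, (X, α), hα, rfl⟩) (LamH.mk Q g Ω l ⟨β, (Y, β), hβ, rfl⟩)
            = LamH.mk Q g Ω (k + l) ⟨_, _, hαβ, rfl⟩) ∧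
      (∀ k l a b, B k l a b = -(-1 : ℝ) ^ (k * l) • (B l k b a).recast (add_comm l k)) ∧
      (∀ j k l c a b, B j (k + l) c (B k l a b)
        = (B (j + k) l (B j k c a) b).recast (add_assoc j k l)
          + (-1 : ℝ) ^ (j * k) • (B k (j + l) a (B j l c b)).recast (add_left_comm k j l)) ∧
      (∀ k l, ∀ z ∈ LamH.constants Q g Ω k, ∀ b, B k l z b = 0) ∧
      (∀ k (X : hamiltonianSymmetries Q g Ω k) (α : hamiltonianForms Q g Ω k),
        h k X = Submodule.Quotient.mk (LamH.mk Q g Ω k α) ↔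
          (X.1, α.1) ∈ hamiltonianPairs Q g Ω k) ∧
      (∀ k l (X : hamiltonianSymmetries Q g Ω k) (Y : hamiltonianSymmetries Q g Ω l)
        (Z : hamiltonianSymmetries Q g Ω (k + l)), Z.1 = bracket k l X.1 Y.1 →
        ∀ a b, h k X = Submodule.Quotient.mk a → h l Y = Submodule.Quotient.mk b →
          h (k + l) Z = Submodule.Quotient.mk (B k l a b)) ∧
      (∀ l, ∀ Y ∈ evolutionary l, ∃ hY : bracket 1 l Q Y ∈ hamiltonianSymmetries Q g Ω (1 + l),
        h (1 + l) ⟨_, hY⟩ = 0) := by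
  refine (exists_isHamiltonianBracket hQΩ).elim fun B hB => ?_
  refine (exists_isHamiltonianMap hQΩ).elim fun h hh => ?_
  refine ⟨?_, ?_, ?_, B, h, hB, ?_, ?_, ?_, hh, ?_, ?_⟩
  · intro k α hα
    exact ⟨flatPart_mem_hamiltonianForms hα, isFlat_flatPart α,
      isConservationLaw_flatPart hQΩ hi hii hα⟩
  · intro k α hα hflat
    have h1 := isConservationLaw_flatPart hQΩ hi hii hα
    rwa [flatPart_eq_self hflat] at h1
  · intro k l X hX Y hY
    exact bracket_mem_hamiltonianSymmetries hQΩ hX hY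
  · exact hB.antisymm hQΩ
  · exact hB.jacobi hQΩ
  · intro k l z hz b
    exact hB.constants_central hQΩ k l hz b
  · intro k l X Y Z hZ a b ha hb
    exact hh.map_bracket hQΩ hB hZ ha hb
  · intro l Y hY
    exact hh.map_trivial hQΩ hY
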